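/- Let $G=(V,E)$ be a finite simple graph with $n$ vertices and $m$ edges, let $m^*(G)$ be the size of a largest matching of $G$, and let $k\ge 1$ be an integer. The down-up walk on matchings of size $k$ is the Markov chain on the set $\mathcal M_k$ of matchings of $G$ with exactly $k$ edges which, from $M\in\mathcal M_k$, draws $e\in M$ and $e'\in E$ independently and uniformly, and moves to $M\cup\{e'\}\setminus\{e\}$ if this set is in $\mathcal M_k$ and stays at $M$ otherwise. With $P$ its transition matrix and $\pi$ the uniform distribution on $\mathcal M_k$, its $\varepsilon$-mixing time is $$\tau(\varepsilon)=\max_{x\in\mathcal M_k}\min\{t\ge 0 : d_{\mathrm{TV}}(P^t(x,\cdot),\pi)<\varepsilon\}.$$ (1) There is an absolute constant $C$ such that for every $\delta\in(0,1)$, every finite simple graph $G$, every integer $k$ with $1\le k\le(1-\delta)m^*(G)$, and every $0<\varepsilon\le 1/2$, the mixing time $\tau(\varepsilon)$ is finite and $$\tau(\varepsilon)\le C\, n^{4/\delta}\, m^4\, k\,\log(1/\varepsilon).$$ (2) For every integer $\Delta\ge 0$ and every $\delta\in(0,1)$ there is a constant $C=C(\Delta,\delta)$ such that for every finite simple graph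 $G$ of maximum degree at most $\Delta$, every integer $k$ with $1\le k\le(1-\delta)m^*(G)$, and every $0<\varepsilon\le 1/2$, the mixing time $\tau(\varepsilon)$ is finite and $$\tau(\varepsilon)\le C\, n^{6}\, k\,\log(1/\varepsilon).$$ -/

import Mathlib

open scoped BigOperators

namespace MatchingWalk

/-- `M` is a matching of `G`: a finite set of edges of `G`, no two of which share a vertex. -/
def IsMatching {V : Type*} (G : SimpleGraph V) (M : Finset (Sym2 V)) : Prop :=
  (∀ e ∈ M, e ∈ G.edgeSet) ∧ ∀ e ∈ M, ∀ f ∈ M, ∀ v : V, v ∈ e → v ∈ f → e = f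

open Classical in
/-- The matching number `m*(G)`: the size of a largest matching of `G`. -/
noncomputable def matchingNumber {V : Type*} [Fintype V] (G : SimpleGraph V) : ℕ :=
  (Finset.univ.filter fun M : Finset (Sym2 V) => IsMatching G M).sup Finset.card

/-- The state space: the matchings of `G` with exactly `k` edges. -/
abbrev Matchings {V : Type*} (G : SimpleGraph V) (k : ℕ) : Type _ :=
  {M : Finset (Sym2 V) // IsMatching G M ∧ M.card = k}

noncomputable instance {V : Type*} [Fintype V] (G : SimpleGraph V) (k : ℕ) :
    Fintype (Matchings G k) :=
  Fintype.ofFinite _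

open Classical in
/-- One move of the walk from `M` once the edges `e` (to remove) and `e'` (to add) are drawn:
go to `M ∪ {e'} \ {e}` if this is a matching with `k` edges, otherwise stay at `M`. -/
noncomputable def step {V : Type*} {G : SimpleGraph V} {k : ℕ}
    (M : Matchings G k) (e e' : Sym2 V) : Matchings G k :=
  if h : IsMatching G ((M.1 ∪ {e'}) \ {e}) ∧ ((M.1 ∪ {e'}) \ {e}).card = k then
    ⟨(M.1 ∪ {e'}) \ {e}, h⟩
  else M

open Classical in
/-- Transition matrix of the down-up walk on matchings with `k` edges: `downUpWalk G k x y` is the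
probability that `step x e e' = y`, for independent uniform `e ∈ x` and `e' ∈ E(G)`. -/
noncomputable def downUpWalk {V : Type*} [Fintype V] (G : SimpleGraph V) (k : ℕ) :
    Matrix (Matchings G k) (Matchings G k) ℝ :=
  Matrix.of fun x y =>
    (((x.1 ×ˢ G.edgeFinset).filter fun p => step x p.1 p.2 = y).card : ℝ) /
      ((x.1 ×ˢ G.edgeFinset).card : ℝ)

/-- The uniform distribution on a finite set. -/
noncomputable def uniformDist (Ω : Type*) [Fintype Ω] : Ω → ℝ :=
  fun _ => 1 / (Fintype.card Ω : ℝ)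

/-- Total variation distance between two probability vectors on a finite set. -/
noncomputable def tvDist {Ω : Type*} [Fintype Ω] (μ ν : Ω → ℝ) : ℝ :=
  (1 / 2) * ∑ x, |μ x - ν x|

open Classical in
/-- The `ε`-mixing time `max_x min {t : d_TV(P^t(x, ·), π) < ε}` of a transition matrix `P` on a
finite state space with respect to `π`; it is `⊤` if from some starting state the distance to `π`
never falls below `ε`. -/
noncomputable def mixingTime {Ω : Type*} [Fintype Ω] (P : Matrix Ω Ω ℝ) (π : Ω → ℝ) (ε : ℝ) :
    ℕ∞ :=
  ⨆ x : Ω, ⨅ t : ℕ, ⨅ _ : tvDist (fun y => (P ^ t) x y) π < ε, (t : ℕ∞)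

end MatchingWalk

/-!
The proof is a Poincaré inequality for the uniform distribution on the matchings with `k` edges,
obtained by comparing it with the matchings with `k + 1` edges. Write `N j` for the number of
matchings with `j` edges.

A function `f` on `k`-matchings is extended to `(k+1)`-matchings `W` by averaging `f (W - e)` over
`e ∈ W` (`upAverage`), and the sum of `(f X - f Y)²` over all `X` of size `k` and `Y` of size
`k + 1` is estimated. The pairs with given `X ∆ Y` and `X ∩ Y` are parametrized by the choice, on each
component of `X ∆ Y`, of the alternate class of edges that belongs to `X`. On the components with
an odd number of edges these choices range over the two middle layers of a cube of odd dimension,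
on the others over a full cube. Passing from `X` to `Y` is complementation, and
`sum_sq_sub_compl_mixed_le` decomposes it into exchanges of single components at the cost of a factor
linear in the number of components, always staying in sizes `k` and `k + 1`.

One component `C` with more edges in `Y` than in `X` is exchanged by sliding along the alternating
path `C`, each slide being a move of the walk, followed by adding the last edge. The complementary
matching `Y` is transformed at the same time, with the next edge left out. The slides of such
pairs are injective (`TraceState.Slide.left_unique`), so each move of the walk is used by at most
as many paths, at a given time, as there are complementary matchings; this is the congestion
bound `sum_flip_odd_le`. A balanced component is reduced to this case by removing one of its edges
first (`exists_erase_mem_components`).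

The result is a Poincaré inequality with constant polynomial in `k`, the number `m` of edges and
the ratio `N k / N (k + 1)` (`sum_sq_le_swapEnergy`). The parametrization above also gives the
log-concavity of `N`, so the ratio only increases up to the matching number `m*`, and its
`(m* - k)`-th power is at most `N k`. With `N k ≤ n ^ (2 k)` this bounds the ratio by
`n ^ (2 / δ - 2)`; with `N k ≤ 2 ^ m` and `m ≤ 2 Δ m*` it bounds it by a constant depending on `Δ`
and `δ`. Finally the walk is symmetric and stays put with probability at least `k / m`, so
the Poincaré inequality implies geometric decay in mean square.
-/

namespace MatchingWalk

open Finset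
open scoped symmDiff Classical

/-! ### Closed edge sets and components of a symmetric difference -/

section Components

variable {V : Type*}

/-- `B` is a union of connected components of the edge set `H`: it contains every edge of `H` that
shares a vertex with an edge of `B`. -/
def IsClosedIn (H B : Finset (Sym2 V)) : Prop :=
  B ⊆ H ∧ ∀ e ∈ B, ∀ f ∈ H, ∀ v : V, v ∈ e → v ∈ f → f ∈ B

theorem IsClosedIn.sdiff {H B : Finset (Sym2 V)} (h : IsClosedIn H B) : IsClosedIn H (H \ B) := by
  refine ⟨sdiff_subset, fun e he f hf v hv hv' => ?_⟩
  rw [mem_sdiff] at he ⊢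
  exact ⟨hf, fun hfB => he.2 (h.2 f hfB e he.1 v hv' hv)⟩

theorem IsClosedIn.biUnion {H : Finset (Sym2 V)} {U : Finset (Finset (Sym2 V))}
    (h : ∀ B ∈ U, IsClosedIn H B) : IsClosedIn H (U.biUnion id) := by
  refine ⟨biUnion_subset.2 fun B hB => (h B hB).1, fun e he f hf v hv hv' => ?_⟩
  simp only [mem_biUnion, id] at he ⊢
  obtain ⟨B, hB, heB⟩ := he
  exact ⟨B, hB, (h B hB).2 e heB f hf v hv hv'⟩

/-- The connected component of the edge `e` in `H`, as the smallest closed set containing `e`. -/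
noncomputable def component (H : Finset (Sym2 V)) (e : Sym2 V) : Finset (Sym2 V) :=
  H.filter fun f => ∀ B, IsClosedIn H B → e ∈ B → f ∈ B

/-- The connected components of the edge set `H`. -/
noncomputable def components (H : Finset (Sym2 V)) : Finset (Finset (Sym2 V)) :=
  H.image (component H)

theorem mem_component_self {H : Finset (Sym2 V)} {e : Sym2 V} (he : e ∈ H) :
    e ∈ component H e := by
  simp [component, he]

theorem component_subset_of_isClosedIn {H B : Finset (Sym2 V)} {e : Sym2 V}
    (hB : IsClosedIn H B) (he : e ∈ B) : component H e ⊆ B := by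
  intro f hf
  simp only [component, mem_filter] at hf
  exact hf.2 B hB he

theorem component_isClosedIn (H : Finset (Sym2 V)) (e : Sym2 V) :
    IsClosedIn H (component H e) := by
  refine ⟨filter_subset _ _, fun f hf g hg v hv hv' => ?_⟩
  simp only [component, mem_filter] at hf ⊢
  exact ⟨hg, fun B hB he => hB.2 f (hf.2 B hB he) g hg v hv hv'⟩

theorem component_eq_of_mem {H : Finset (Sym2 V)} {e f : Sym2 V} (he : e ∈ H)
    (hf : f ∈ component H e) : component H f = component H e := by
  have hfH := (component_isClosedIn H e).1 hf
  refine Subset.antisymm (component_subset_of_isClosedIn (component_isClosedIn H e) hf) ?_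
  refine component_subset_of_isClosedIn (component_isClosedIn H f) ?_
  by_contra hne
  have h := component_subset_of_isClosedIn (component_isClosedIn H f).sdiff
    (mem_sdiff.2 ⟨he, hne⟩) hf
  exact (mem_sdiff.1 h).2 (mem_component_self hfH)

theorem component_mem_components {H : Finset (Sym2 V)} {e : Sym2 V} (he : e ∈ H) :
    component H e ∈ components H :=
  mem_image_of_mem _ he

theorem eq_component_of_mem {H C : Finset (Sym2 V)} {e : Sym2 V} (hC : C ∈ components H)
    (he : e ∈ C) : C = component H e := by
  obtain ⟨f, hf, rfl⟩ := mem_image.1 hC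
  exact (component_eq_of_mem hf he).symm

theorem isClosedIn_of_mem_components {H C : Finset (Sym2 V)} (hC : C ∈ components H) :
    IsClosedIn H C := by
  obtain ⟨f, hf, rfl⟩ := mem_image.1 hC
  exact component_isClosedIn H f

theorem nonempty_of_mem_components {H C : Finset (Sym2 V)} (hC : C ∈ components H) :
    C.Nonempty := by
  obtain ⟨f, hf, rfl⟩ := mem_image.1 hC
  exact ⟨f, mem_component_self hf⟩

theorem subset_of_mem_components {H B C : Finset (Sym2 V)} {e : Sym2 V} (hC : C ∈ components H)
    (hB : IsClosedIn H B) (heC : e ∈ C) (heB : e ∈ B) : C ⊆ B := by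
  rw [eq_component_of_mem hC heC]
  exact component_subset_of_isClosedIn hB heB

/-- The components of `H` are its minimal nonempty closed subsets. -/
theorem mem_components_of_minimal {H C : Finset (Sym2 V)} (hC : IsClosedIn H C)
    (hne : C.Nonempty) (hmin : ∀ B, IsClosedIn H B → B ⊆ C → B.Nonempty → B = C) :
    C ∈ components H := by
  obtain ⟨e, he⟩ := hne
  have h := hmin _ (component_isClosedIn H e) (component_subset_of_isClosedIn hC he)
    ⟨e, mem_component_self (hC.1 he)⟩
  rw [← h]
  exact component_mem_components (hC.1 he)

theorem eq_of_mem_components {H C C' : Finset (Sym2 V)} {e : Sym2 V} (hC : C ∈ components H)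
    (hC' : C' ∈ components H) (he : e ∈ C) (he' : e ∈ C') : C = C' := by
  rw [eq_component_of_mem hC he, eq_component_of_mem hC' he']

theorem biUnion_components_of_isClosedIn {H B : Finset (Sym2 V)} (hB : IsClosedIn H B) :
    ((components H).filter (· ⊆ B)).biUnion id = B := by
  ext e
  simp only [mem_biUnion, mem_filter, id]
  constructor
  · rintro ⟨C, ⟨-, hCB⟩, he⟩
    exact hCB he
  · intro he
    exact ⟨_, ⟨component_mem_components (hB.1 he), component_subset_of_isClosedIn hB he⟩,
      mem_component_self (hB.1 he)⟩

theorem mem_of_subset_biUnion {H C : Finset (Sym2 V)} {U : Finset (Finset (Sym2 V))}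
    (hU : U ⊆ components H) (hC : C ∈ components H) {e : Sym2 V} (he : e ∈ C)
    (h : e ∈ U.biUnion id) : C ∈ U := by
  simp only [mem_biUnion, id] at h
  obtain ⟨C', hC', he'⟩ := h
  rwa [eq_of_mem_components hC (hU hC') he he']

end Components

section Flip

variable {V : Type*} {G : SimpleGraph V}

theorem IsMatching.subset {M N : Finset (Sym2 V)} (hM : IsMatching G M) (h : N ⊆ M) :
    IsMatching G N :=
  ⟨fun e he => hM.1 e (h he), fun e he f hf => hM.2 e (h he) f (h hf)⟩

/-- Swapping the roles of two matchings on a union of components of their symmetric difference. -/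
theorem IsMatching.symmDiff_of_isClosedIn {X Y B : Finset (Sym2 V)} (hX : IsMatching G X)
    (hY : IsMatching G Y) (hB : IsClosedIn (X ∆ Y) B) : IsMatching G (X ∆ B) := by
  have key : ∀ e ∈ X, e ∉ B → ∀ f ∈ B, f ∉ X → ∀ v, v ∈ e → v ∈ f → e = f := by
    intro e he heB f hf hfX v hv hv'
    have hfY : f ∈ Y := by
      have := hB.1 hf
      rw [mem_symmDiff] at this
      tauto
    by_cases heY : e ∈ Y
    · exact hY.2 e heY f hfY v hv hv'
    · exact absurd (hB.2 f hf e (mem_symmDiff.2 (Or.inl ⟨he, heY⟩)) v hv' hv) heB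
  have hBY : ∀ f ∈ B, f ∉ X → f ∈ Y := by
    intro f hf hfX
    have := hB.1 hf
    rw [mem_symmDiff] at this
    tauto
  constructor
  · intro e he
    rcases mem_symmDiff.1 he with ⟨h, -⟩ | ⟨h, h'⟩
    · exact hX.1 e h
    · exact hY.1 e (hBY e h h')
  · intro e he f hf v hv hv'
    rcases mem_symmDiff.1 he with ⟨h, h'⟩ | ⟨h, h'⟩ <;>
      rcases mem_symmDiff.1 hf with ⟨g, g'⟩ | ⟨g, g'⟩
    · exact hX.2 e h f g v hv hv'
    · exact key e h h' f g g' v hv hv'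
    · exact (key f g g' e h h' v hv' hv).symm
    · exact hY.2 e (hBY e h h') f (hBY f g g') v hv hv'

theorem card_symmDiff_add {X Y B : Finset (Sym2 V)} (hB : B ⊆ X ∆ Y) :
    (X ∆ B).card + (X ∩ B).card = X.card + (Y ∩ B).card := by
  have h1 : X ∆ B = (X \ B) ∪ (Y ∩ B) := by
    ext e
    have := @hB e
    simp only [mem_symmDiff, mem_union, mem_sdiff, mem_inter] at this ⊢
    tauto
  have h2 : Disjoint (X \ B) (Y ∩ B) :=
    disjoint_left.2 fun e he he' => (mem_sdiff.1 he).2 (mem_inter.1 he').2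
  rw [h1, card_union_of_disjoint h2]
  have := card_sdiff_add_card_inter X B
  omega

theorem card_inter_add_card_inter {X Y B : Finset (Sym2 V)} (hB : B ⊆ X ∆ Y) :
    (X ∩ B).card + (Y ∩ B).card = B.card := by
  have h1 : B = (X ∩ B) ∪ (Y ∩ B) := by
    ext e
    have := @hB e
    simp only [mem_symmDiff, mem_union, mem_inter] at this ⊢
    tauto
  have h2 : Disjoint (X ∩ B) (Y ∩ B) := by
    refine disjoint_left.2 fun e he he' => ?_
    have := hB (mem_inter.1 he).2
    simp only [mem_symmDiff, mem_inter] at *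
    tauto
  rw [← card_union_of_disjoint h2, ← h1]

/-- The vertices covered by an edge set. -/
noncomputable def covered (M : Finset (Sym2 V)) : Finset V :=
  M.biUnion Sym2.toFinset

theorem mem_covered {M : Finset (Sym2 V)} {v : V} : v ∈ covered M ↔ ∃ e ∈ M, v ∈ e := by
  simp [covered]

/-- A matching covers two vertices per edge. -/
theorem IsMatching.card_covered {M : Finset (Sym2 V)} (hM : IsMatching G M) :
    (covered M).card = 2 * M.card := by
  unfold covered
  rw [card_biUnion]
  · rw [sum_congr rfl (g := fun _ => 2), sum_const, smul_eq_mul, mul_comm]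
    intro e he
    exact Sym2.card_toFinset_of_not_isDiag _ (G.not_isDiag_of_mem_edgeSet (hM.1 e he))
  · intro e he f hf hne
    refine disjoint_left.2 fun v hv hv' => hne ?_
    exact hM.2 e he f hf v (Sym2.mem_toFinset.1 hv) (Sym2.mem_toFinset.1 hv')

end Flip

/-! ### Transforming a matching along an alternating path -/

section Trace

variable {V : Type*} {G : SimpleGraph V}

/-- A stage of the transformation of a matching along an alternating path. `M` is the current
matching, `v w` is the next edge to be added to it, and `F` is the complementary matching with that
edge left out. -/
@[ext]
structure TraceState (V : Type*) where
  M : Finset (Sym2 V)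
  F : Finset (Sym2 V)
  v : V
  w : V

/-- The vertex `v` is not covered by `M`, the vertex `w` is not covered by `F`, and `v w` is an
edge. -/
structure TraceState.Valid (G : SimpleGraph V) (s : TraceState V) : Prop where
  matchingM : IsMatching G s.M
  matchingF : IsMatching G s.F
  free_v : ∀ e ∈ s.M, s.v ∉ e
  free_w : ∀ e ∈ s.F, s.w ∉ e
  adj : G.Adj s.v s.w

/-- One step along an alternating path `v w u z`: the current matching gains `v w` and loses `w u`,
and the next edge to be added is `u z`. -/
structure TraceState.Slide (s t : TraceState V) : Prop where
  mem_M : s(s.w, t.v) ∈ s.M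
  mem_F : s(t.v, t.w) ∈ s.F
  eq_M : t.M = insert s(s.v, s.w) (s.M.erase s(s.w, t.v))
  eq_F : t.F = insert s(s.w, t.v) (s.F.erase s(t.v, t.w))

theorem IsMatching.eq_of_mk_mem {M : Finset (Sym2 V)} (hM : IsMatching G M) {a b c : V}
    (h : s(a, b) ∈ M) (h' : s(a, c) ∈ M) : b = c := by
  exact Sym2.congr_right.1 (hM.2 _ h _ h' a (by simp) (by simp))

/-- Sliding is reversible: this is what bounds the congestion of the paths. -/
theorem TraceState.Slide.left_unique {s s' t : TraceState V} (h : s.Slide t) (h' : s'.Slide t)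
    (hs : s.Valid G) (hs' : s'.Valid G) (ht : t.Valid G) : s = s' := by
  obtain ⟨M, F, v, w⟩ := s
  obtain ⟨M₁, F₁, v₁, w₁⟩ := s'
  obtain ⟨M', F', u, z⟩ := t
  obtain ⟨h1, h2, h3, h4⟩ := h
  obtain ⟨g1, g2, g3, g4⟩ := h'
  obtain ⟨-, -, s3, s4, -⟩ := hs
  obtain ⟨-, -, r3, r4, -⟩ := hs'
  obtain ⟨t1, t2, -, -, -⟩ := ht
  dsimp only at *
  have hw : w = w₁ := by
    refine t2.eq_of_mk_mem (a := u) ?_ ?_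
    · rw [h4, Sym2.eq_swap]; exact mem_insert_self _ _
    · rw [g4, Sym2.eq_swap]; exact mem_insert_self _ _
  subst hw
  have hv : v = v₁ := by
    refine t1.eq_of_mk_mem (a := w) ?_ ?_
    · rw [h3, Sym2.eq_swap]; exact mem_insert_self _ _
    · rw [g3, Sym2.eq_swap]; exact mem_insert_self _ _
  subst hv
  have hM : ∀ N : Finset (Sym2 V), s(w, u) ∈ N → (∀ e ∈ N, v ∉ e) →
      insert s(w, u) ((insert s(v, w) (N.erase s(w, u))).erase s(v, w)) = N := by
    intro N hN hv
    rw [erase_insert, insert_erase hN]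
    exact fun hmem => hv _ (mem_of_mem_erase hmem) (by simp)
  have hF : ∀ N : Finset (Sym2 V), s(u, z) ∈ N → (∀ e ∈ N, w ∉ e) →
      insert s(u, z) ((insert s(w, u) (N.erase s(u, z))).erase s(w, u)) = N := by
    intro N hN hv
    rw [erase_insert, insert_erase hN]
    exact fun hmem => hv _ (mem_of_mem_erase hmem) (by simp)
  have e1 := hM M h1 s3
  have e2 := hM M₁ g1 r3
  have e3 := hF F h2 s4
  have e4 := hF F₁ g2 r4
  rw [← h3] at e1
  rw [← g3] at e2
  rw [← h4] at e3
  rw [← g4] at e4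
  rw [TraceState.mk.injEq]
  exact ⟨e1.symm.trans e2, e3.symm.trans e4, rfl, rfl⟩

/-- The invariant of a state reached in transforming `X` along the component `C` of `X ∆ Y`; `A` is
the set of edges passed so far, including the next edge `v w` to be added. -/
structure TraceState.Inv (G : SimpleGraph V) (X Y C A : Finset (Sym2 V)) (s : TraceState V) :
    Prop where
  valid : s.Valid G
  subset : A ⊆ C
  mem_A : s(s.v, s.w) ∈ A
  mem_Y : s(s.v, s.w) ∈ Y
  eq_M : s.M = X ∆ (A.erase s(s.v, s.w))
  eq_F : s.F = Y ∆ A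
  closed : ∀ e ∈ A, ∀ f ∈ X ∆ Y, ∀ a, a ≠ s.w → a ∈ e → a ∈ f → f ∈ A
  card_M : s.M.card = X.card
  card_F : s.F.card + 1 = Y.card

/-- A run of slides from `s`, which ends by adding an edge and thereby turns `X` into `X ∆ C`. -/
structure TraceRun (G : SimpleGraph V) (X Y C : Finset (Sym2 V)) (s : TraceState V) (n : ℕ)
    (st : ℕ → TraceState V) : Prop where
  zero : st 0 = s
  slide : ∀ i < n, (st i).Slide (st (i + 1))
  valid : ∀ i ≤ n, (st i).Valid G
  card_M : ∀ i ≤ n, (st i).M.card = X.card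
  card_F : ∀ i ≤ n, (st i).F.card + 1 = Y.card
  last : insert s((st n).v, (st n).w) (st n).M = X ∆ C

theorem IsMatching.insert_mk {M : Finset (Sym2 V)} (hM : IsMatching G M) {v w : V}
    (hvw : G.Adj v w) (hv : ∀ e ∈ M, v ∉ e) (hw : ∀ e ∈ M, w ∉ e) :
    IsMatching G (insert s(v, w) M) := by
  constructor
  · intro e he
    rcases mem_insert.1 he with rfl | he
    · simpa using hvw
    · exact hM.1 e he
  · have key : ∀ e ∈ M, ∀ a, a ∈ s(v, w) → a ∉ e := by
      intro e he a ha
      rcases Sym2.mem_iff.1 ha with h | h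
      · rw [h]; exact hv e he
      · rw [h]; exact hw e he
    intro e he f hf a ha ha'
    rcases mem_insert.1 he with he | he <;> rcases mem_insert.1 hf with hf | hf
    · rw [he, hf]
    · exact absurd ha' (key f hf a (he ▸ ha))
    · exact absurd ha (key e he a (hf ▸ ha'))
    · exact hM.2 e he f hf a ha ha'

/-- As long as the end `w` of the next edge is covered, the path can be continued: it cannot get
stuck because `C` has more edges in `Y` than in `X`. -/
theorem TraceState.Inv.step {X Y C A : Finset (Sym2 V)} {s : TraceState V} (hX : IsMatching G X)
    (hY : IsMatching G Y) (hC : C ∈ components (X ∆ Y)) (hmaj : (X ∩ C).card < (Y ∩ C).card)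
    (hs : s.Inv G X Y C A) :
    insert s(s.v, s.w) s.M = X ∆ C ∨
      ∃ t A', s.Slide t ∧ t.Inv G X Y C A' ∧ (X \ A').card < (X \ A).card := by
  have hCcl := isClosedIn_of_mem_components hC
  have hCH := hCcl.1
  obtain ⟨M, F, v, w⟩ := s
  obtain ⟨⟨hM, hF, hv, hw, hadj⟩, hAC, he0A, he0Y, eqM, eqF, hcl, cM, cF⟩ := hs
  dsimp only at *
  have hAH : A ⊆ X ∆ Y := hAC.trans hCH
  have he0X : s(v, w) ∉ X := by
    have := hAH he0A
    rw [mem_symmDiff] at this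
    tauto
  have hmemM : ∀ e, e ∈ M ↔ (e ∈ X ∧ (e = s(v, w) ∨ e ∉ A)) ∨
      (e ∉ X ∧ e ≠ s(v, w) ∧ e ∈ A) := by
    intro e
    rw [eqM, mem_symmDiff, mem_erase]
    tauto
  have hmemF : ∀ e, e ∈ F ↔ (e ∈ Y ∧ e ∉ A) ∨ (e ∈ A ∧ e ∉ Y) := by
    intro e
    rw [eqF, mem_symmDiff]
  have hXY : ∀ e ∈ A, e ∈ X → e ∉ Y := by
    intro e he heX heY
    have := hAH he
    rw [mem_symmDiff] at this
    tauto
  -- the only edge of `Y` at `w` is `v w`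
  have hYw : ∀ f ∈ Y, w ∈ f → f = s(v, w) := fun f hf hwf =>
    hY.2 f hf _ he0Y w hwf (by simp)
  by_cases hwM : ∃ g ∈ M, w ∈ g
  · right
    obtain ⟨g, hgM, hwg⟩ := hwM
    obtain ⟨u, rfl⟩ := Sym2.mem_iff_exists.1 hwg
    have hne : s(w, u) ≠ s(v, w) := by
      intro h
      exact hv _ hgM (by rw [h]; simp)
    have hgY : s(w, u) ∉ Y := fun h => hne (hYw _ h (by simp))
    have hgA : s(w, u) ∉ A := by
      intro h
      exact hw _ ((hmemF _).2 (Or.inr ⟨h, hgY⟩)) (by simp)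
    have hgX : s(w, u) ∈ X := by
      exact ((hmemM _).1 hgM).elim (fun h => h.1) fun h => absurd h.2.2 hgA
    have hgH : s(w, u) ∈ X ∆ Y := mem_symmDiff.2 (Or.inl ⟨hgX, hgY⟩)
    have hgC : s(w, u) ∈ C := hCcl.2 _ (hAC he0A) _ hgH w (by simp) (by simp)
    have hwu : G.Adj w u := by simpa using hX.1 _ hgX
    have hXg : ∀ f ∈ X, ∀ a, a ∈ f → a ∈ s(w, u) → f = s(w, u) := fun f hf a ha ha' =>
      hX.2 f hf _ hgX a ha ha'
    have hMw : ∀ e ∈ M.erase s(w, u), w ∉ e := fun e he hwe =>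
      (mem_erase.1 he).1 (hM.2 e (mem_erase.1 he).2 _ hgM w hwe (by simp))
    have hMu : ∀ e ∈ M.erase s(w, u), u ∉ e := fun e he hwe =>
      (mem_erase.1 he).1 (hM.2 e (mem_erase.1 he).2 _ hgM u hwe (by simp))
    have huv : u ≠ v := fun h => hv _ hgM (by simp [h])
    have heqM' : insert s(v, w) (M.erase s(w, u)) = X ∆ (insert s(w, u) A) := by
      ext e
      rw [mem_insert, mem_erase, hmemM, mem_symmDiff, mem_insert]
      by_cases h1 : e = s(v, w)
      · simp [h1, he0A, he0X]
      · by_cases h2 : e = s(w, u)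
        · simp only [h2, hne, hgX, false_and, or_false, ne_eq, not_true_eq_false, true_or,
            and_false, or_self]
        · simp [h1, h2, and_comm]
    have hcard : (insert s(v, w) (M.erase s(w, u))).card = X.card := by
      rw [card_insert_of_notMem, card_erase_add_one hgM, cM]
      intro h
      exact hv _ (mem_erase.1 h).2 (by simp)
    -- closedness of the enlarged set at all vertices except `u`
    have hcl' : ∀ e ∈ A, ∀ f ∈ X ∆ Y, ∀ a, a ∈ e → a ∈ f → f ∈ insert s(w, u) A := by
      intro e he f hf a ha ha'
      by_cases haw : a = w
      · subst haw
        rcases mem_symmDiff.1 hf with h | h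
        · rw [hXg f h.1 a ha' (by simp)]; exact mem_insert_self _ _
        · rw [hYw f h.1 ha']; exact mem_insert_of_mem he0A
      · exact mem_insert_of_mem (hcl e he f hf a haw ha ha')
    by_cases huF : ∃ f ∈ F, u ∈ f
    · obtain ⟨f, hfF, huf⟩ := huF
      obtain ⟨z, rfl⟩ := Sym2.mem_iff_exists.1 huf
      have hfX : s(u, z) ∉ X := by
        intro h
        have h' := hXg _ h u (by simp) (by simp)
        rw [h'] at hfF
        exact ((hmemF _).1 hfF).elim (fun h => hgY h.1) fun h => hgA h.1
      have hfY : s(u, z) ∈ Y ∧ s(u, z) ∉ A := by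
        rcases (hmemF _).1 hfF with h | h
        · exact h
        · exact (mem_symmDiff.1 (hAH h.1)).elim (fun h' => absurd h'.1 hfX)
            fun h' => absurd h'.1 h.2
      have hfH : s(u, z) ∈ X ∆ Y := mem_symmDiff.2 (Or.inr ⟨hfY.1, hfX⟩)
      have hfC : s(u, z) ∈ C := hCcl.2 _ hgC _ hfH u (by simp) (by simp)
      have huz : G.Adj u z := by simpa using hY.1 _ hfY.1
      have hFu : ∀ e ∈ F.erase s(u, z), u ∉ e := fun e he hwe =>
        (mem_erase.1 he).1 (hF.2 e (mem_erase.1 he).2 _ hfF u hwe (by simp))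
      have hFz : ∀ e ∈ F.erase s(u, z), z ∉ e := fun e he hwe =>
        (mem_erase.1 he).1 (hF.2 e (mem_erase.1 he).2 _ hfF z hwe (by simp))
      have hzw : z ≠ w := fun h => hw _ hfF (by simp [h])
      have hgf : s(w, u) ≠ s(u, z) := fun h => hfX (h ▸ hgX)
      refine ⟨⟨insert s(v, w) (M.erase s(w, u)), insert s(w, u) (F.erase s(u, z)), u, z⟩,
        insert s(u, z) (insert s(w, u) A), ⟨hgM, hfF, rfl, rfl⟩,
        ⟨⟨?_, ?_, ?_, ?_, huz⟩, ?_, mem_insert_self _ _, hfY.1, ?_, ?_, ?_, hcard, ?_⟩, ?_⟩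
      · exact (hM.subset (erase_subset _ _)).insert_mk hadj
          (fun e he => hv e (mem_of_mem_erase he)) hMw
      · exact (hF.subset (erase_subset _ _)).insert_mk hwu
          (fun e he => hw e (mem_of_mem_erase he)) hFu
      · intro e he
        rcases mem_insert.1 he with rfl | he
        · simp [huv, hwu.ne']
        · exact hMu e he
      · intro e he
        rcases mem_insert.1 he with rfl | he
        · simp [hzw, huz.ne']
        · exact hFz e he
      · exact insert_subset hfC (insert_subset hgC hAC)
      · dsimp only
        rw [erase_insert, heqM']
        rw [mem_insert]
        rintro (h | h)
        · exact hgf h.symm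
        · exact hfY.2 h
      · ext e
        rw [mem_insert, mem_erase, hmemF, mem_symmDiff, mem_insert, mem_insert]
        by_cases h1 : e = s(u, z)
        · simp [h1, hgf.symm, hfY.1]
        · by_cases h2 : e = s(w, u)
          · simp [h2, hgY]
          · simp [h1, h2]
      · intro e he f hf a haz ha ha'
        dsimp only at haz
        have hu : a = u → f ∈ insert s(u, z) (insert s(w, u) A) := by
          rintro rfl
          rcases mem_symmDiff.1 hf with h | h
          · rw [hXg f h.1 a ha' (by simp)]; simp
          · rw [hY.2 f h.1 _ hfY.1 a ha' (by simp)]; simp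
        rcases mem_insert.1 he with he | he
        · subst he
          rcases Sym2.mem_iff.1 ha with h | h
          · exact hu h
          · exact absurd h haz
        · rcases mem_insert.1 he with he | he
          · subst he
            rcases Sym2.mem_iff.1 ha with h | h
            · exact mem_insert_of_mem (hcl' _ he0A f hf a (by simp [h]) ha')
            · exact hu h
          · exact mem_insert_of_mem (hcl' e he f hf a ha ha')
      · dsimp only
        rw [card_insert_of_notMem, card_erase_add_one hfF, cF]
        intro h
        exact hw _ (mem_erase.1 h).2 (by simp)
      · refine card_lt_card ⟨?_, fun h => ?_⟩
        · exact sdiff_subset_sdiff (Subset.refl _)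
            ((subset_insert _ _).trans (subset_insert _ _))
        · have := h (mem_sdiff.2 ⟨hgX, hgA⟩)
          simp at this
    · exfalso
      push Not at huF
      have hclosed : IsClosedIn (X ∆ Y) (insert s(w, u) A) := by
        refine ⟨(insert_subset hgC hAC).trans hCH, fun e he f hf a ha ha' => ?_⟩
        rcases mem_insert.1 he with rfl | he
        · rcases Sym2.mem_iff.1 ha with h | h
          · exact hcl' _ he0A f hf a (by simp [h]) ha'
          · rcases mem_symmDiff.1 hf with h' | h'
            · rw [hXg f h'.1 a ha' (by simp [h])]; exact mem_insert_self _ _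
            · by_contra hfA
              rw [mem_insert, not_or] at hfA
              exact huF f ((hmemF f).2 (Or.inl ⟨h'.1, hfA.2⟩)) (h ▸ ha')
        · exact hcl' e he f hf a ha ha'
      have hCeq : insert s(w, u) A = C := Subset.antisymm (insert_subset hgC hAC)
        (subset_of_mem_components hC hclosed hgC (mem_insert_self _ _))
      rw [heqM', hCeq] at hcard
      have := card_symmDiff_add hCH
      omega
  · left
    push Not at hwM
    have hclosed : IsClosedIn (X ∆ Y) A := by
      refine ⟨hAH, fun e he f hf a ha ha' => ?_⟩
      by_cases haw : a = w
      · subst haw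
        rcases mem_symmDiff.1 hf with h | h
        · by_contra hfA
          exact hwM f ((hmemM f).2 (Or.inl ⟨h.1, Or.inr hfA⟩)) ha'
        · rw [hYw f h.1 ha']; exact he0A
      · exact hcl e he f hf a haw ha ha'
    have hCeq : A = C := Subset.antisymm hAC
      (subset_of_mem_components hC hclosed (hAC he0A) he0A)
    rw [← hCeq]
    ext e
    rw [mem_insert, hmemM, mem_symmDiff]
    by_cases h1 : e = s(v, w)
    · simp [h1, he0A, he0X]
    · simp [h1, and_comm]

theorem TraceState.Inv.exists_run {X Y C : Finset (Sym2 V)} (hX : IsMatching G X)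
    (hY : IsMatching G Y) (hC : C ∈ components (X ∆ Y)) (hmaj : (X ∩ C).card < (Y ∩ C).card)
    (n : ℕ) : ∀ (A : Finset (Sym2 V)) (s : TraceState V), s.Inv G X Y C A → (X \ A).card ≤ n →
      ∃ m ≤ n, ∃ st, TraceRun G X Y C s m st := by
  have base : ∀ (A : Finset (Sym2 V)) (s : TraceState V), s.Inv G X Y C A →
      insert s(s.v, s.w) s.M = X ∆ C → TraceRun G X Y C s 0 fun _ => s := fun A s hs h =>
    ⟨rfl, fun i hi => absurd hi (Nat.not_lt_zero i), fun _ _ => hs.valid, fun _ _ => hs.card_M,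
      fun _ _ => hs.card_F, h⟩
  induction n with
  | zero =>
    intro A s hs hn
    rcases hs.step hX hY hC hmaj with h | ⟨t, A', -, -, hlt⟩
    · exact ⟨0, le_rfl, _, base A s hs h⟩
    · omega
  | succ n ih =>
    intro A s hs hn
    rcases hs.step hX hY hC hmaj with h | ⟨t, A', hst, ht, hlt⟩
    · exact ⟨0, Nat.zero_le _, _, base A s hs h⟩
    · obtain ⟨m, hm, st, hrun⟩ := ih A' t ht (by omega)
      refine ⟨m + 1, by omega, fun i => Nat.casesOn i s st, rfl, ?_, ?_, ?_, ?_, hrun.last⟩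
      · rintro (_ | i) hi
        · change s.Slide (st 0)
          rw [hrun.zero]
          exact hst
        · exact hrun.slide i (by omega)
      · rintro (_ | i) hi
        · exact hs.valid
        · exact hrun.valid i (by omega)
      · rintro (_ | i) hi
        · exact hs.card_M
        · exact hrun.card_M i (by omega)
      · rintro (_ | i) hi
        · exact hs.card_F
        · exact hrun.card_F i (by omega)

/-- If a component of `X ∆ Y` has more edges in `Y` than in `X`, then it has a vertex covered by
`Y` but not by `X`, and sliding from there transforms `X` into `X ∆ C`. -/
theorem exists_traceRun {X Y C : Finset (Sym2 V)} (hX : IsMatching G X)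
    (hY : IsMatching G Y) (hC : C ∈ components (X ∆ Y)) (hmaj : (X ∩ C).card < (Y ∩ C).card) :
    ∃ v w, s(v, w) ∈ Y ∧ s(v, w) ∈ C ∧ ∃ m ≤ X.card, ∃ st,
      TraceRun G X Y C ⟨X, Y.erase s(v, w), v, w⟩ m st := by
  have hCcl := isClosedIn_of_mem_components hC
  have hlt : (covered (X ∩ C)).card < (covered (Y ∩ C)).card := by
    rw [(hX.subset inter_subset_left).card_covered, (hY.subset inter_subset_left).card_covered]
    omega
  obtain ⟨v, hvY, hvX⟩ := exists_mem_notMem_of_card_lt_card hlt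
  obtain ⟨e, heYC, hve⟩ := mem_covered.1 hvY
  obtain ⟨w, rfl⟩ := Sym2.mem_iff_exists.1 hve
  obtain ⟨heY, heC⟩ := mem_inter.1 heYC
  have heX : s(v, w) ∉ X := by
    have := hCcl.1 heC
    rw [mem_symmDiff] at this
    tauto
  have hvfree : ∀ f ∈ X, v ∉ f := by
    intro f hf hvf
    refine hvX (mem_covered.2 ⟨f, mem_inter.2 ⟨hf, ?_⟩, hvf⟩)
    by_cases hfY : f ∈ Y
    · rwa [hY.2 f hfY _ heY v hvf (by simp)]
    · exact hCcl.2 _ heC f (mem_symmDiff.2 (Or.inl ⟨hf, hfY⟩)) v (by simp) hvf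
  refine ⟨v, w, heY, heC, TraceState.Inv.exists_run hX hY hC hmaj X.card {s(v, w)} _ ?_
    (card_le_card sdiff_subset)⟩
  refine ⟨⟨hX, hY.subset (erase_subset _ _), hvfree, ?_, by simpa using hY.1 _ heY⟩,
    by simpa using heC, by simp, heY, ?_, ?_, ?_, rfl, card_erase_add_one heY⟩
  · intro f hf hwf
    exact (mem_erase.1 hf).1 (hY.2 f (mem_erase.1 hf).2 _ heY w hwf (by simp))
  · ext f
    simp [mem_symmDiff]
  · ext f
    simp only [mem_erase, mem_symmDiff, mem_singleton]
    by_cases h : f = s(v, w)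
    · simp [h, heY]
    · simp [h]
  · intro f hf g hg a haw ha ha'
    rw [mem_singleton] at hf ⊢
    subst hf
    have hav : a = v := by
      rcases Sym2.mem_iff.1 ha with h | h
      · exact h
      · exact absurd h haw
    subst hav
    rcases mem_symmDiff.1 hg with h | h
    · exact absurd ha' (hvfree g h.1)
    · exact hY.2 g h.1 _ heY a ha' (by simp)

/-- The two matchings differ by at most one in size on a component. -/
theorem card_inter_eq_succ_of_lt {X Y C : Finset (Sym2 V)} (hX : IsMatching G X)
    (hY : IsMatching G Y) (hC : C ∈ components (X ∆ Y)) (hmaj : (X ∩ C).card < (Y ∩ C).card) :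
    (Y ∩ C).card = (X ∩ C).card + 1 := by
  obtain ⟨v, w, -, -, m, -, st, hrun⟩ := exists_traceRun hX hY hC hmaj
  have h1 := hrun.card_M m le_rfl
  have h2 := card_insert_le s((st m).v, (st m).w) (st m).M
  rw [hrun.last] at h2
  have := card_symmDiff_add (isClosedIn_of_mem_components hC).1
  omega

end Trace

/-! ### Removing an edge from a balanced component -/

section Even

variable {V : Type*} {G : SimpleGraph V}

theorem erase_symmDiff_of_mem {X Y : Finset (Sym2 V)} {x : Sym2 V} (hY : x ∉ Y) :
    (X.erase x) ∆ Y = (X ∆ Y).erase x := by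
  ext e
  simp only [mem_symmDiff, mem_erase]
  by_cases h : e = x
  · simp [h, hY]
  · simp [h]

theorem erase_symmDiff_erase {X C : Finset (Sym2 V)} {x : Sym2 V} (hX : x ∈ X) (hC : x ∈ C) :
    (X.erase x) ∆ (C.erase x) = X ∆ C := by
  ext e
  simp only [mem_symmDiff, mem_erase]
  by_cases h : e = x
  · simp [h, hX, hC]
  · simp [h]

/-- If `x` is the only edge of a component at one of its ends, then removing `x` leaves the
component connected. -/
theorem erase_mem_components_of_leaf {H C : Finset (Sym2 V)} {v u : V} (hC : C ∈ components H)
    (hx : s(v, u) ∈ C) (hne : (C.erase s(v, u)).Nonempty)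
    (hleaf : ∀ f ∈ H, v ∈ f → f = s(v, u)) : C.erase s(v, u) ∈ components (H.erase s(v, u)) := by
  have hCcl := isClosedIn_of_mem_components hC
  refine mem_components_of_minimal ⟨erase_subset_erase _ hCcl.1, ?_⟩ hne ?_
  · intro e he f hf a ha ha'
    exact mem_erase.2 ⟨(mem_erase.1 hf).1,
      hCcl.2 e (mem_erase.1 he).2 f (mem_erase.1 hf).2 a ha ha'⟩
  · intro B hB hBC hBne
    have hxB : s(v, u) ∉ B := fun h => (mem_erase.1 (hBC h)).1 rfl
    by_cases htouch : ∃ e ∈ B, u ∈ e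
    · obtain ⟨e, he, hue⟩ := htouch
      have hcl : IsClosedIn H (insert s(v, u) B) := by
        refine ⟨insert_subset (hCcl.1 hx) (hB.1.trans (erase_subset _ _)), ?_⟩
        intro f hf g hg a ha ha'
        by_cases hgx : g = s(v, u)
        · rw [hgx]; exact mem_insert_self _ _
        · refine mem_insert_of_mem ?_
          rcases mem_insert.1 hf with rfl | hf
          · rcases Sym2.mem_iff.1 ha with h | h
            · exact absurd (hleaf g hg (h ▸ ha')) hgx
            · exact hB.2 e he g (mem_erase.2 ⟨hgx, hg⟩) u hue (h ▸ ha')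
          · exact hB.2 f hf g (mem_erase.2 ⟨hgx, hg⟩) a ha ha'
      have := subset_of_mem_components hC hcl hx (mem_insert_self _ _)
      refine Subset.antisymm hBC fun f hf => ?_
      exact (mem_insert.1 (this (mem_erase.1 hf).2)).resolve_left (mem_erase.1 hf).1
    · exfalso
      push Not at htouch
      have hcl : IsClosedIn H B := by
        refine ⟨hB.1.trans (erase_subset _ _), fun f hf g hg a ha ha' => ?_⟩
        by_cases hgx : g = s(v, u)
        · exfalso
          subst hgx
          rcases Sym2.mem_iff.1 ha' with rfl | rfl
          · have := hleaf f ((hB.1.trans (erase_subset _ _)) hf) ha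
            exact hxB (this ▸ hf)
          · exact htouch f hf ha
        · exact hB.2 f hf g (mem_erase.2 ⟨hgx, hg⟩) a ha ha'
      obtain ⟨f, hf⟩ := hBne
      exact hxB (subset_of_mem_components hC hcl (mem_erase.1 (hBC hf)).2 hf hx)

/-- If both matchings cover the same vertices of a component (so that it is a cycle), then it stays
connected when an edge is removed. A proper part of the rest would have an odd number of
vertices, yet be perfectly matched. -/
theorem erase_mem_components_of_cycle {X Y C : Finset (Sym2 V)} (hX : IsMatching G X)
    (hY : IsMatching G Y) (hC : C ∈ components (X ∆ Y)) {x : Sym2 V} (hxX : x ∈ X) (hxC : x ∈ C)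
    (hne : (C.erase x).Nonempty) (hcov : covered (X ∩ C) = covered (Y ∩ C)) :
    C.erase x ∈ components ((X ∆ Y).erase x) := by
  have hCcl := isClosedIn_of_mem_components hC
  have hxY : x ∉ Y := by
    have := hCcl.1 hxC
    rw [mem_symmDiff] at this
    tauto
  refine mem_components_of_minimal ⟨erase_subset_erase _ hCcl.1, ?_⟩ hne ?_
  · intro e he f hf a ha ha'
    exact mem_erase.2 ⟨(mem_erase.1 hf).1,
      hCcl.2 e (mem_erase.1 he).2 f (mem_erase.1 hf).2 a ha ha'⟩
  · intro B hB hBC hBne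
    have hBC' : B ⊆ C := hBC.trans (erase_subset _ _)
    have hBH : B ⊆ X ∆ Y := hB.1.trans (erase_subset _ _)
    have hxB : x ∉ B := fun h => (mem_erase.1 (hBC h)).1 rfl
    -- `B` cannot touch `x` at one end only
    have parity : ∀ a b, x = s(a, b) → (∃ e ∈ B, a ∈ e) → ¬ (∃ e ∈ B, b ∈ e) → False := by
      rintro a b rfl ⟨e, he, hae⟩ hb
      push Not at hb
      have heX : e ∉ X := fun h => hxB ((hX.2 e h _ hxX a hae (by simp)) ▸ he)
      have heY : e ∈ Y := by
        have := hBH he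
        rw [mem_symmDiff] at this
        tauto
      have h1 : covered (Y ∩ B) = insert a (covered (X ∩ B)) := by
        ext v
        rw [mem_insert, mem_covered, mem_covered]
        constructor
        · rintro ⟨f, hf, hvf⟩
          obtain ⟨hfY, hfB⟩ := mem_inter.1 hf
          have hv : v ∈ covered (X ∩ C) := by
            rw [hcov]
            exact mem_covered.2 ⟨f, mem_inter.2 ⟨hfY, hBC' hfB⟩, hvf⟩
          obtain ⟨g, hg, hvg⟩ := mem_covered.1 hv
          obtain ⟨hgX, hgC⟩ := mem_inter.1 hg
          by_cases hgx : g = s(a, b)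
          · rw [hgx] at hvg
            rcases Sym2.mem_iff.1 hvg with h | h
            · exact Or.inl h
            · exact absurd (h ▸ hvf) (hb f hfB)
          · exact Or.inr ⟨g, mem_inter.2 ⟨hgX,
              hB.2 f hfB g (mem_erase.2 ⟨hgx, hCcl.1 hgC⟩) v hvf hvg⟩, hvg⟩
        · rintro (rfl | ⟨f, hf, hvf⟩)
          · exact ⟨e, mem_inter.2 ⟨heY, he⟩, hae⟩
          · obtain ⟨hfX, hfB⟩ := mem_inter.1 hf
            have hv : v ∈ covered (Y ∩ C) := by
              rw [← hcov]
              exact mem_covered.2 ⟨f, mem_inter.2 ⟨hfX, hBC' hfB⟩, hvf⟩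
            obtain ⟨g, hg, hvg⟩ := mem_covered.1 hv
            obtain ⟨hgY, hgC⟩ := mem_inter.1 hg
            have hgx : g ≠ s(a, b) := fun h => hxY (h ▸ hgY)
            exact ⟨g, mem_inter.2 ⟨hgY,
              hB.2 f hfB g (mem_erase.2 ⟨hgx, hCcl.1 hgC⟩) v hvf hvg⟩, hvg⟩
      have h2 : a ∉ covered (X ∩ B) := by
        rw [mem_covered]
        rintro ⟨f, hf, haf⟩
        obtain ⟨hfX, hfB⟩ := mem_inter.1 hf
        exact hxB ((hX.2 f hfX _ hxX a haf (by simp)) ▸ hfB)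
      have h3 := congrArg Finset.card h1
      rw [card_insert_of_notMem h2, (hX.subset inter_subset_left).card_covered,
        (hY.subset inter_subset_left).card_covered] at h3
      omega
    by_cases htouch : ∃ v ∈ x, ∃ e ∈ B, v ∈ e
    · have hboth : ∀ v ∈ x, ∃ e ∈ B, v ∈ e := by
        obtain ⟨a, hax, ha⟩ := htouch
        obtain ⟨b, rfl⟩ := Sym2.mem_iff_exists.1 hax
        intro v hv
        rcases Sym2.mem_iff.1 hv with rfl | rfl
        · exact ha
        · by_contra hb
          exact parity _ _ rfl ha hb
      have hcl : IsClosedIn (X ∆ Y) (insert x B) := by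
        refine ⟨insert_subset (hCcl.1 hxC) hBH, ?_⟩
        intro f hf g hg a ha ha'
        by_cases hgx : g = x
        · rw [hgx]; exact mem_insert_self _ _
        · refine mem_insert_of_mem ?_
          rcases mem_insert.1 hf with rfl | hf
          · obtain ⟨e, he, hae⟩ := hboth a ha
            exact hB.2 e he g (mem_erase.2 ⟨hgx, hg⟩) a hae ha'
          · exact hB.2 f hf g (mem_erase.2 ⟨hgx, hg⟩) a ha ha'
      have := subset_of_mem_components hC hcl hxC (mem_insert_self _ _)
      refine Subset.antisymm hBC fun f hf => ?_
      exact (mem_insert.1 (this (mem_erase.1 hf).2)).resolve_left (mem_erase.1 hf).1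
    · exfalso
      push Not at htouch
      have hcl : IsClosedIn (X ∆ Y) B := by
        refine ⟨hBH, fun f hf g hg a ha ha' => ?_⟩
        by_cases hgx : g = x
        · exact absurd ha (htouch a (hgx ▸ ha') f hf)
        · exact hB.2 f hf g (mem_erase.2 ⟨hgx, hg⟩) a ha ha'
      obtain ⟨f, hf⟩ := hBne
      exact hxB (subset_of_mem_components hC hcl (hBC' hf) hf hxC)

/-- A balanced component (an even path or a cycle) has an edge of `X` whose removal leaves an
alternating path with one more edge in `Y` than in `X`. -/
theorem exists_erase_mem_components {X Y C : Finset (Sym2 V)} (hX : IsMatching G X)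
    (hY : IsMatching G Y) (hC : C ∈ components (X ∆ Y)) (hbal : (X ∩ C).card = (Y ∩ C).card) :
    ∃ x ∈ X, x ∈ C ∧ C.erase x ∈ components ((X.erase x) ∆ Y) ∧
      ((X.erase x) ∩ C.erase x).card < (Y ∩ C.erase x).card ∧
      (X.erase x) ∆ (C.erase x) = X ∆ C := by
  have hCcl := isClosedIn_of_mem_components hC
  have hcard := card_inter_add_card_inter hCcl.1
  have hpos := (nonempty_of_mem_components hC).card_pos
  have hne : ∀ x ∈ C, (C.erase x).Nonempty := fun x hx => by
    rw [← card_pos, card_erase_of_mem hx]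
    omega
  have hmain : ∃ x ∈ X, x ∈ C ∧ C.erase x ∈ components ((X ∆ Y).erase x) := by
    by_cases hsub : covered (X ∩ C) ⊆ covered (Y ∩ C)
    · have hcov : covered (X ∩ C) = covered (Y ∩ C) := by
        refine eq_of_subset_of_card_le hsub ?_
        rw [(hX.subset inter_subset_left).card_covered,
          (hY.subset inter_subset_left).card_covered, hbal]
      have : (X ∩ C).Nonempty := by
        rw [← card_pos]
        omega
      obtain ⟨x, hx⟩ := this
      obtain ⟨hxX, hxC⟩ := mem_inter.1 hx
      exact ⟨x, hxX, hxC, erase_mem_components_of_cycle hX hY hC hxX hxC (hne x hxC) hcov⟩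
    · obtain ⟨v, hvX, hvY⟩ := not_subset.1 hsub
      obtain ⟨x, hx, hvx⟩ := mem_covered.1 hvX
      obtain ⟨u, rfl⟩ := Sym2.mem_iff_exists.1 hvx
      obtain ⟨hxX, hxC⟩ := mem_inter.1 hx
      refine ⟨_, hxX, hxC, erase_mem_components_of_leaf hC hxC (hne _ hxC) ?_⟩
      intro f hf hvf
      rcases mem_symmDiff.1 hf with h | h
      · exact hX.2 f h.1 _ hxX v hvf (by simp)
      · exact absurd (mem_covered.2
          ⟨f, mem_inter.2 ⟨h.1, hCcl.2 _ hxC f hf v (by simp) hvf⟩, hvf⟩) hvY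
  obtain ⟨x, hxX, hxC, hx⟩ := hmain
  have hxY : x ∉ Y := by
    have := hCcl.1 hxC
    rw [mem_symmDiff] at this
    tauto
  refine ⟨x, hxX, hxC, ?_, ?_, erase_symmDiff_erase hxX hxC⟩
  · rwa [erase_symmDiff_of_mem hxY]
  · have h1 : Y ∩ C.erase x = Y ∩ C := by
      ext e
      simp only [mem_inter, mem_erase]
      by_cases h : e = x
      · simp [h, hxY]
      · simp [h]
    rw [h1, ← hbal]
    refine card_lt_card ⟨fun e he => ?_, fun h => ?_⟩
    · simp only [mem_inter, mem_erase] at he ⊢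
      tauto
    · have := h (mem_inter.2 ⟨hxX, hxC⟩)
      simp at this

end Even

/-! ### Pairs of matchings with given symmetric difference and intersection -/

section Fibers

variable {V : Type*} {G : SimpleGraph V}

theorem symmDiff_biUnion_inter_of_notMem {H X : Finset (Sym2 V)} {U : Finset (Finset (Sym2 V))}
    {C : Finset (Sym2 V)} (hU : U ⊆ components H) (hC : C ∈ components H) (hCU : C ∉ U) :
    (X ∆ U.biUnion id) ∩ C = X ∩ C := by
  ext e
  rw [mem_inter, mem_inter, mem_symmDiff]
  by_cases he : e ∈ C
  · have : e ∉ U.biUnion id := fun h => hCU (mem_of_subset_biUnion hU hC he h)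
    tauto
  · tauto

theorem symmDiff_biUnion_inter_of_mem {X Y : Finset (Sym2 V)} {U : Finset (Finset (Sym2 V))}
    {C : Finset (Sym2 V)} (hC : C ∈ components (X ∆ Y)) (hCU : C ∈ U) :
    (X ∆ U.biUnion id) ∩ C = Y ∩ C := by
  ext e
  rw [mem_inter, mem_inter, mem_symmDiff]
  by_cases he : e ∈ C
  · have h1 : e ∈ U.biUnion id := mem_biUnion.2 ⟨C, hCU, he⟩
    have h2 := (isClosedIn_of_mem_components hC).1 he
    rw [mem_symmDiff] at h2
    tauto
  · tauto

theorem isClosedIn_biUnion {H : Finset (Sym2 V)} {U : Finset (Finset (Sym2 V))}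
    (hU : U ⊆ components H) : IsClosedIn H (U.biUnion id) :=
  IsClosedIn.biUnion fun _ hB => isClosedIn_of_mem_components (hU hB)

theorem symmDiff_symmDiff_symmDiff_right (X Y B : Finset (Sym2 V)) :
    (X ∆ B) ∆ (Y ∆ B) = X ∆ Y := by
  rw [symmDiff_symmDiff_symmDiff_comm, symmDiff_self, symmDiff_bot]

theorem symmDiff_inter_symmDiff {X Y B : Finset (Sym2 V)} (hB : B ⊆ X ∆ Y) :
    (X ∆ B) ∩ (Y ∆ B) = X ∩ Y := by
  ext e
  have := @hB e
  simp only [mem_symmDiff, mem_inter] at this ⊢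
  tauto

theorem symmDiff_eq_symmDiff_biUnion_sdiff {X Y : Finset (Sym2 V)}
    {U : Finset (Finset (Sym2 V))} (hU : U ⊆ components (X ∆ Y)) :
    Y ∆ U.biUnion id = X ∆ (components (X ∆ Y) \ U).biUnion id := by
  have h1 : (components (X ∆ Y) \ U).biUnion id = (X ∆ Y) \ U.biUnion id := by
    ext e
    rw [mem_sdiff]
    constructor
    · intro he
      obtain ⟨C, hC, heC⟩ := mem_biUnion.1 he
      obtain ⟨hC1, hC2⟩ := mem_sdiff.1 hC
      exact ⟨(isClosedIn_of_mem_components hC1).1 heC,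
        fun h => hC2 (mem_of_subset_biUnion hU hC1 heC h)⟩
    · rintro ⟨he, hne⟩
      refine mem_biUnion.2 ⟨component (X ∆ Y) e, mem_sdiff.2
        ⟨component_mem_components he, fun h => hne ?_⟩, mem_component_self he⟩
      exact mem_biUnion.2 ⟨_, h, mem_component_self he⟩
  rw [h1]
  have h2 := (isClosedIn_biUnion hU).1
  generalize U.biUnion id = W at *
  ext e
  have := @h2 e
  simp only [mem_symmDiff, mem_sdiff] at this ⊢
  tauto

theorem card_inter_biUnion (X : Finset (Sym2 V)) {H : Finset (Sym2 V)}
    {U : Finset (Finset (Sym2 V))} (hU : U ⊆ components H) :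
    (X ∩ U.biUnion id).card = ∑ C ∈ U, (X ∩ C).card := by
  rw [inter_biUnion, card_biUnion]
  · rfl
  · intro C hC C' hC' hne
    refine disjoint_left.2 fun e he he' => hne ?_
    exact eq_of_mem_components (hU hC) (hU hC') (mem_inter.1 he).2 (mem_inter.1 he').2

theorem isClosedIn_symmDiff_of_eq {X Y X' Y' : Finset (Sym2 V)} (hX : IsMatching G X)
    (hY : IsMatching G Y) (hX' : IsMatching G X') (hY' : IsMatching G Y')
    (hH : X ∆ Y = X' ∆ Y') (hI : X ∩ Y = X' ∩ Y') : IsClosedIn (X ∆ Y) (X ∆ X') := by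
  have hH' : ∀ e, e ∈ X ∆ Y ↔ e ∈ X' ∆ Y' := fun e => by rw [hH]
  have hI' : ∀ e, e ∈ X ∩ Y ↔ e ∈ X' ∩ Y' := fun e => by rw [hI]
  simp only [mem_symmDiff] at hH'
  simp only [mem_inter] at hI'
  constructor
  · intro e he
    have h1 := hH' e
    have h2 := hI' e
    rw [mem_symmDiff] at he ⊢
    tauto
  · intro e he f hf a ha ha'
    by_contra hne
    have e1 := hH' e
    have e2 := hI' e
    have f1 := hH' f
    have f2 := hI' f
    have k1 : e ∈ X → f ∈ X → e = f := fun h h' => hX.2 e h f h' a ha ha'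
    have k2 : e ∈ Y → f ∈ Y → e = f := fun h h' => hY.2 e h f h' a ha ha'
    have k3 : e ∈ X' → f ∈ X' → e = f := fun h h' => hX'.2 e h f h' a ha ha'
    have k4 : e ∈ Y' → f ∈ Y' → e = f := fun h h' => hY'.2 e h f h' a ha ha'
    have hef : e ≠ f := fun h => hne (h ▸ he)
    rw [mem_symmDiff] at he hf hne
    have k1' : ¬ (e ∈ X ∧ f ∈ X) := fun h => hef (k1 h.1 h.2)
    have k2' : ¬ (e ∈ Y ∧ f ∈ Y) := fun h => hef (k2 h.1 h.2)
    have k3' : ¬ (e ∈ X' ∧ f ∈ X') := fun h => hef (k3 h.1 h.2)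
    have k4' : ¬ (e ∈ Y' ∧ f ∈ Y') := fun h => hef (k4 h.1 h.2)
    clear k1 k2 k3 k4 hef hH' hI' hH hI
    by_cases p1 : e ∈ X <;> by_cases p2 : f ∈ X <;> by_cases p3 : e ∈ X' <;>
      by_cases p4 : f ∈ X' <;> simp_all

/-- Within the pairs with given symmetric difference and intersection, there is one whose first
matching is never the larger one on a component. -/
theorem exists_base {X Y : Finset (Sym2 V)} (hX : IsMatching G X) (hY : IsMatching G Y) :
    ∃ X₀ Y₀, IsMatching G X₀ ∧ IsMatching G Y₀ ∧ X₀ ∆ Y₀ = X ∆ Y ∧ X₀ ∩ Y₀ = X ∩ Y ∧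
      ∀ C ∈ components (X ∆ Y), (X₀ ∩ C).card ≤ (Y₀ ∩ C).card := by
  set U := (components (X ∆ Y)).filter fun C => (Y ∩ C).card < (X ∩ C).card with hUdef
  have hU : U ⊆ components (X ∆ Y) := filter_subset _ _
  have hcl := isClosedIn_biUnion hU
  refine ⟨X ∆ U.biUnion id, Y ∆ U.biUnion id, hX.symmDiff_of_isClosedIn hY hcl,
    hY.symmDiff_of_isClosedIn hX (by rwa [symmDiff_comm]), symmDiff_symmDiff_symmDiff_right _ _ _,
    symmDiff_inter_symmDiff hcl.1, fun C hC => ?_⟩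
  by_cases hCU : C ∈ U
  · rw [symmDiff_biUnion_inter_of_mem hC hCU,
      symmDiff_biUnion_inter_of_mem (by rwa [symmDiff_comm]) hCU]
    exact (mem_filter.1 hCU).2.le
  · rw [symmDiff_biUnion_inter_of_notMem hU hC hCU, symmDiff_biUnion_inter_of_notMem hU hC hCU]
    by_contra h
    exact hCU (mem_filter.2 ⟨hC, not_le.1 h⟩)

variable [Fintype V]

/-- The pairs of matchings with symmetric difference `H` and intersection `I`. -/
noncomputable def pairsWith (G : SimpleGraph V) (H I : Finset (Sym2 V)) :
    Finset (Finset (Sym2 V) × Finset (Sym2 V)) :=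
  univ.filter fun p => IsMatching G p.1 ∧ IsMatching G p.2 ∧ p.1 ∆ p.2 = H ∧ p.1 ∩ p.2 = I

/-- A parametrization of `pairsWith G H I` by the subsets `U` of `components H`: the matching `ψ U`
uses the majority class of edges on the odd components in `U` and the minority class on
those outside `U`; the set `odd` consists of the components with an odd number of edges. -/
structure FiberParam (G : SimpleGraph V) (H I : Finset (Sym2 V)) where
  ψ : Finset (Finset (Sym2 V)) → Finset (Sym2 V)
  odd : Finset (Finset (Sym2 V))
  base : ℕ
  odd_subset : odd ⊆ components H
  sum_eq : ∀ F : Finset (Sym2 V) → Finset (Sym2 V) → ℝ,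
    ∑ p ∈ pairsWith G H I, F p.1 p.2 =
      ∑ U ∈ (components H).powerset, F (ψ U) (ψ (components H \ U))
  card_ψ : ∀ U ⊆ components H, (ψ U).card = base + (U ∩ odd).card
  ψ_insert : ∀ U ⊆ components H, ∀ C ∈ components H, C ∉ U → ψ (insert C U) = ψ U ∆ C
  symmDiff_ψ : ∀ U ⊆ components H, ψ U ∆ ψ (components H \ U) = H
  card_inter : ∀ U ⊆ components H, ∀ C ∈ components H, C ∉ U →
    (ψ (components H \ U) ∩ C).card = (ψ U ∩ C).card + if C ∈ odd then 1 else 0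

theorem nonempty_fiberParam {H I : Finset (Sym2 V)} (h : (pairsWith G H I).Nonempty) :
    Nonempty (FiberParam G H I) := by
  obtain ⟨⟨X₁, Y₁⟩, hp⟩ := h
  simp only [pairsWith, mem_filter, mem_univ, true_and] at hp
  obtain ⟨hX₁, hY₁, rfl, rfl⟩ := hp
  obtain ⟨X, Y, hX, hY, hH, hI, hle⟩ := exists_base hX₁ hY₁
  rw [← hH, ← hI]
  rw [← hH] at hle
  clear hH hI hX₁ hY₁
  have hψ : ∀ U ⊆ components (X ∆ Y), X ∆ (components (X ∆ Y) \ U).biUnion id =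
      Y ∆ U.biUnion id := fun U hU => (symmDiff_eq_symmDiff_biUnion_sdiff hU).symm
  refine ⟨⟨fun U => X ∆ U.biUnion id,
    (components (X ∆ Y)).filter fun C => (X ∩ C).card < (Y ∩ C).card, X.card,
    filter_subset _ _, ?_, ?_, ?_, ?_, ?_⟩⟩
  · intro F
    symm
    refine sum_bij (fun U _ => (X ∆ U.biUnion id, X ∆ (components (X ∆ Y) \ U).biUnion id))
      ?_ ?_ ?_ (fun _ _ => rfl)
    · intro U hU
      rw [mem_powerset] at hU
      have hcl := isClosedIn_biUnion hU
      rw [hψ U hU]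
      simp only [pairsWith, mem_filter, mem_univ, true_and]
      exact ⟨hX.symmDiff_of_isClosedIn hY hcl,
        hY.symmDiff_of_isClosedIn hX (by rwa [symmDiff_comm]),
        symmDiff_symmDiff_symmDiff_right _ _ _, symmDiff_inter_symmDiff hcl.1⟩
    · intro U hU U' hU' heq
      rw [mem_powerset] at hU hU'
      have h1 : U.biUnion id = U'.biUnion id := symmDiff_right_injective X (Prod.ext_iff.1 heq).1
      have key : ∀ W W' : Finset (Finset (Sym2 V)), W ⊆ components (X ∆ Y) →
          W' ⊆ components (X ∆ Y) → W.biUnion id = W'.biUnion id → W ⊆ W' := by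
        intro W W' hW hW' hWW' C hC
        obtain ⟨e, he⟩ := nonempty_of_mem_components (hW hC)
        refine mem_of_subset_biUnion hW' (hW hC) he ?_
        rw [← hWW']
        exact mem_biUnion.2 ⟨C, hC, he⟩
      exact Subset.antisymm (key U U' hU hU' h1) (key U' U hU' hU h1.symm)
    · rintro ⟨X', Y'⟩ hp
      simp only [pairsWith, mem_filter, mem_univ, true_and] at hp
      obtain ⟨hX', hY', hH, hI⟩ := hp
      have hcl := isClosedIn_symmDiff_of_eq hX hY hX' hY' hH.symm hI.symm
      refine ⟨(components (X ∆ Y)).filter (· ⊆ X ∆ X'), mem_powerset.2 (filter_subset _ _), ?_⟩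
      rw [hψ _ (filter_subset _ _), biUnion_components_of_isClosedIn hcl,
        symmDiff_symmDiff_cancel_left]
      congr 1
      rw [← symmDiff_assoc, symmDiff_comm Y X, ← hH, symmDiff_comm X' Y',
        symmDiff_symmDiff_cancel_right]
  · intro U hU
    have h1 := card_symmDiff_add (isClosedIn_biUnion hU).1
    rw [card_inter_biUnion X hU, card_inter_biUnion Y hU] at h1
    have h2 : ∑ C ∈ U, (Y ∩ C).card = ∑ C ∈ U, (X ∩ C).card +
        (U ∩ (components (X ∆ Y)).filter fun C => (X ∩ C).card < (Y ∩ C).card).card := by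
      rw [← filter_mem_eq_inter, card_filter, ← sum_add_distrib]
      refine sum_congr rfl fun C hC => ?_
      by_cases hlt : (X ∩ C).card < (Y ∩ C).card
      · rw [if_pos (mem_filter.2 ⟨hU hC, hlt⟩), card_inter_eq_succ_of_lt hX hY (hU hC) hlt]
      · rw [if_neg (fun h : C ∈ filter _ _ => hlt (mem_filter.1 h).2)]
        have := hle C (hU hC)
        omega
    omega
  · intro U hU C hC hCU
    have : (insert C U).biUnion id = (U.biUnion id) ∆ C := by
      rw [biUnion_insert, id, union_comm, Disjoint.symmDiff_eq_sup]
      · rfl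
      · refine disjoint_left.2 fun e he he' => hCU (mem_of_subset_biUnion hU hC he' he)
    rw [this, symmDiff_assoc]
  · intro U hU
    rw [hψ U hU, symmDiff_symmDiff_symmDiff_right]
  · intro U hU C hC hCU
    rw [symmDiff_biUnion_inter_of_notMem hU hC hCU,
      symmDiff_biUnion_inter_of_mem hC (mem_sdiff.2 ⟨hC, hCU⟩)]
    by_cases hlt : (X ∩ C).card < (Y ∩ C).card
    · rw [if_pos (mem_filter.2 ⟨hC, hlt⟩), card_inter_eq_succ_of_lt hX hY hC hlt]
    · rw [if_neg (fun h : C ∈ filter _ _ => hlt (mem_filter.1 h).2)]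
      have := hle C hC
      omega

/-- The matchings of `G` with `k` edges, as a finset. -/
noncomputable def matchingsOfCard (G : SimpleGraph V) (k : ℕ) : Finset (Finset (Sym2 V)) :=
  univ.filter fun M => IsMatching G M ∧ M.card = k

theorem mem_matchingsOfCard {k : ℕ} {M : Finset (Sym2 V)} :
    M ∈ matchingsOfCard G k ↔ IsMatching G M ∧ M.card = k := by
  simp [matchingsOfCard]

/-- Sums over pairs of matchings of given sizes, grouped by symmetric difference and
intersection. -/
theorem sum_pairs_eq (a b : ℕ) (F : Finset (Sym2 V) → Finset (Sym2 V) → ℝ) :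
    ∑ X ∈ matchingsOfCard G a, ∑ Y ∈ matchingsOfCard G b, F X Y =
      ∑ q : Finset (Sym2 V) × Finset (Sym2 V), ∑ p ∈ pairsWith G q.1 q.2,
        if p.1.card = a ∧ p.2.card = b then F p.1 p.2 else 0 := by
  rw [← sum_product', ← sum_fiberwise (matchingsOfCard G a ×ˢ matchingsOfCard G b)
    (fun p => (p.1 ∆ p.2, p.1 ∩ p.2))]
  refine sum_congr rfl fun q _ => ?_
  rw [← sum_filter]
  refine sum_congr ?_ fun _ _ => rfl
  ext p
  simp only [mem_filter, mem_product, mem_matchingsOfCard, pairsWith, mem_univ, true_and,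
    Prod.ext_iff]
  tauto

end Fibers

/-! ### Complementation in the middle layers of a cube -/

section Cube

variable {α : Type*} [DecidableEq α]

theorem add_sq_le_of_weights {a b s t : ℝ} (hs : 0 < s) (ht : 0 ≤ t) (hb : t = 0 → b = 0) :
    (a + b) ^ 2 ≤ (s + t) * (a ^ 2 / s + b ^ 2 / t) := by
  rcases ht.eq_or_lt with h | h
  · rw [hb h.symm, ← h]
    have : s * (a ^ 2 / s) = a ^ 2 := by field_simp
    simp [this]
  · have : (s + t) * (a ^ 2 / s + b ^ 2 / t) - (a + b) ^ 2 = (t * a - s * b) ^ 2 / (s * t) := by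
      field_simp
      ring
    have h2 : 0 ≤ (t * a - s * b) ^ 2 / (s * t) := by positivity
    linarith

/-- Cauchy–Schwarz along a path of two steps followed by a path of length `s`. -/
theorem add_add_sq_le {a b c s : ℝ} (hs : 0 < s) :
    (a + b + c) ^ 2 ≤ (s + 2) * (a ^ 2 + b ^ 2 + c ^ 2 / s) := by
  have h1 := add_sq_le_of_weights (a := c) (b := a + b) hs zero_le_two (by norm_num)
  have h2 : (a + b) ^ 2 ≤ 2 * (a ^ 2 + b ^ 2) := by nlinarith [sq_nonneg (a - b)]
  calc (a + b + c) ^ 2 = (c + (a + b)) ^ 2 := by ring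
    _ ≤ (s + 2) * (c ^ 2 / s + (a + b) ^ 2 / 2) := h1
    _ ≤ (s + 2) * (a ^ 2 + b ^ 2 + c ^ 2 / s) := by
      apply mul_le_mul_of_nonneg_left _ (by linarith)
      linarith

theorem sum_swap_exchange (O : Finset α) (r : ℕ) (F : Finset α → α → α → ℝ) :
    ∑ S ∈ powersetCard r O, ∑ i ∈ O \ S, ∑ j ∈ S, F S i j =
      ∑ S ∈ powersetCard r O, ∑ i ∈ O \ S, ∑ j ∈ S, F ((insert i S).erase j) j i := by
  simp only [sum_sigma']
  refine sum_bij' (fun q _ => ⟨(insert q.2.1 q.1).erase q.2.2, q.2.2, q.2.1⟩)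
    (fun q _ => ⟨(insert q.2.1 q.1).erase q.2.2, q.2.2, q.2.1⟩) ?_ ?_ ?_ ?_ ?_
  all_goals
    rintro ⟨S, i, j⟩ h
    simp only [mem_sigma, mem_powersetCard, mem_sdiff] at h
    obtain ⟨⟨hSO, hS⟩, ⟨hi, hiS⟩, hj⟩ := h
    have hij : i ≠ j := fun h => hiS (h ▸ hj)
    have key : (insert j ((insert i S).erase j)).erase i = S := by
      rw [insert_erase (mem_insert_of_mem hj), erase_insert hiS]
    have hcard : ((insert i S).erase j).card = r := by
      rw [card_erase_of_mem (mem_insert_of_mem hj), card_insert_of_notMem hiS]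
      omega
  · simp only [mem_sigma, mem_powersetCard, mem_sdiff, mem_erase]
    exact ⟨⟨(erase_subset _ _).trans (insert_subset hi hSO), hcard⟩, ⟨hSO hj, by simp⟩, hij,
      by simp⟩
  · simp only [mem_sigma, mem_powersetCard, mem_sdiff, mem_erase]
    exact ⟨⟨(erase_subset _ _).trans (insert_subset hi hSO), hcard⟩, ⟨hSO hj, by simp⟩, hij,
      by simp⟩
  · simp only [key]
  · simp only [key]
  · simp only [key]

theorem sum_exchange_eq_offDiag (O : Finset α) (r : ℕ) (F : Finset α → α → α → ℝ) :
    ∑ S ∈ powersetCard (r + 1) O, ∑ i ∈ O \ S, ∑ j ∈ S, F S i j =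
      ∑ q ∈ O.offDiag, ∑ R ∈ powersetCard r ((O.erase q.1).erase q.2),
        F (insert q.2 R) q.1 q.2 := by
  simp only [sum_sigma']
  refine sum_bij' (fun q _ => ⟨(q.2.1, q.2.2), q.1.erase q.2.2⟩)
    (fun q _ => ⟨insert q.1.2 q.2, q.1.1, q.1.2⟩) ?_ ?_ ?_ ?_ ?_
  · rintro ⟨S, i, j⟩ h
    simp only [mem_sigma, mem_powersetCard, mem_sdiff] at h
    obtain ⟨⟨hSO, hS⟩, ⟨hi, hiS⟩, hj⟩ := h
    simp only [mem_sigma, mem_powersetCard, mem_offDiag]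
    refine ⟨⟨hi, hSO hj, fun h => hiS (h ▸ hj)⟩, ?_, ?_⟩
    · intro x hx
      simp only [mem_erase] at hx ⊢
      exact ⟨hx.1, fun h => hiS (h ▸ hx.2), hSO hx.2⟩
    · rw [card_erase_of_mem hj]
      omega
  · rintro ⟨⟨i, j⟩, R⟩ h
    simp only [mem_sigma, mem_powersetCard, mem_offDiag] at h
    obtain ⟨⟨hi, hj, hij⟩, hRO, hR⟩ := h
    have hjR : j ∉ R := fun h => (mem_erase.1 (hRO h)).1 rfl
    have hiR : i ∉ R := fun h => (mem_erase.1 (mem_erase.1 (hRO h)).2).1 rfl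
    simp only [mem_sigma, mem_powersetCard, mem_sdiff, mem_insert]
    refine ⟨⟨insert_subset hj (hRO.trans ((erase_subset _ _).trans (erase_subset _ _))), ?_⟩,
      ⟨hi, not_or.2 ⟨hij, hiR⟩⟩, Or.inl trivial⟩
    rw [card_insert_of_notMem hjR, hR]
  · rintro ⟨S, i, j⟩ h
    simp only [mem_sigma, mem_powersetCard, mem_sdiff] at h
    simp only [insert_erase h.2.2]
  · rintro ⟨⟨i, j⟩, R⟩ h
    simp only [mem_sigma, mem_powersetCard, mem_offDiag] at h
    have hjR : j ∉ R := fun h' => (mem_erase.1 (h.2.1 h')).1 rfl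
    simp only [erase_insert hjR]
  · rintro ⟨S, i, j⟩ h
    simp only [mem_sigma, mem_powersetCard, mem_sdiff] at h
    simp only [insert_erase h.2.2]

theorem sum_offDiag_swap {β : Type*} (O : Finset β) (F : β → β → ℝ) :
    ∑ q ∈ O.offDiag, F q.1 q.2 = ∑ q ∈ O.offDiag, F q.2 q.1 := by
  refine sum_bij' (fun q _ => q.swap) (fun q _ => q.swap) ?_ ?_ ?_ ?_ ?_
  all_goals simp +contextual [eq_comm]

/-- The energy of a function along the edges joining the `p`-subsets to the `(p+1)`-subsets. -/
noncomputable def layerEnergy (O : Finset α) (p : ℕ) (φ : Finset α → ℝ) : ℝ :=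
  ∑ S ∈ powersetCard p O, ∑ j ∈ O \ S, (φ S - φ (insert j S)) ^ 2

/-- Complementation in the middle layers of a cube of odd dimension. By induction: a random
complementary pair is joined by a step up and a step down, followed by a complementary pair in a
cube of dimension smaller by two. -/
theorem sum_sq_sub_compl_le (p : ℕ) : ∀ (O : Finset α) (φ : Finset α → ℝ), O.card = 2 * p + 1 →
    ∑ S ∈ powersetCard p O, (φ S - φ (O \ S)) ^ 2 ≤
      (2 * p + 1) ^ 2 / (p + 1) * layerEnergy O p φ := by
  induction p with
  | zero =>
    intro O φ hO
    obtain ⟨a, rfl⟩ := card_eq_one.1 (by simpa using hO)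
    simp [layerEnergy]
  | succ p ih =>
    intro O φ hO
    set W := layerEnergy O (p + 1) φ with hW
    have hcardS : ∀ S ∈ powersetCard (p + 1) O, S.card = p + 1 ∧ (O \ S).card = p + 2 := by
      intro S hS
      rw [mem_powersetCard] at hS
      refine ⟨hS.2, ?_⟩
      rw [card_sdiff_of_subset hS.1]
      omega
    have h1 : ∑ S ∈ powersetCard (p + 1) O, ∑ i ∈ O \ S, ∑ j ∈ S, (φ S - φ (insert i S)) ^ 2 =
        (p + 1) * W := by
      rw [hW, layerEnergy, mul_sum]
      refine sum_congr rfl fun S hS => ?_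
      rw [mul_sum]
      refine sum_congr rfl fun i _ => ?_
      rw [sum_const, (hcardS S hS).1, nsmul_eq_mul]
      push_cast
      ring
    have h2 : ∑ S ∈ powersetCard (p + 1) O, ∑ i ∈ O \ S, ∑ j ∈ S,
        (φ (insert i S) - φ ((insert i S).erase j)) ^ 2 = (p + 1) * W := by
      rw [sum_swap_exchange O (p + 1)
        (fun S i j => (φ (insert i S) - φ ((insert i S).erase j)) ^ 2), ← h1]
      refine sum_congr rfl fun S _ => sum_congr rfl fun i hi => sum_congr rfl fun j hj => ?_
      rw [insert_erase (mem_insert_of_mem hj), erase_insert (mem_sdiff.1 hi).2]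
      ring
    have h4 : ∑ q ∈ O.offDiag, layerEnergy ((O.erase q.1).erase q.2) p
        (fun R => φ (insert q.1 R)) = (p + 1) * ((p + 1) * W) := by
      rw [sum_offDiag_swap O (fun i j => layerEnergy ((O.erase i).erase j) p
        (fun R => φ (insert i R)))]
      have h := sum_exchange_eq_offDiag O p
        (fun S j _ => ∑ l ∈ (O \ S).erase j, (φ S - φ (insert l S)) ^ 2)
      have h5 : ∀ q ∈ O.offDiag, layerEnergy ((O.erase q.2).erase q.1) p
          (fun R => φ (insert q.2 R)) =
          ∑ R ∈ powersetCard p ((O.erase q.1).erase q.2),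
            ∑ l ∈ (O \ insert q.2 R).erase q.1,
              (φ (insert q.2 R) - φ (insert l (insert q.2 R))) ^ 2 := by
        intro q hq
        rw [layerEnergy, erase_right_comm]
        refine sum_congr rfl fun R _ => sum_congr ?_ fun l _ => ?_
        · ext x
          simp only [mem_sdiff, mem_erase, mem_insert]
          tauto
        · rw [Finset.insert_comm]
      rw [sum_congr rfl h5, ← h, ← mul_assoc, hW, layerEnergy, mul_sum]
      refine sum_congr rfl fun S hS => ?_
      simp only [sum_const, (hcardS S hS).1]
      rw [← smul_sum, nsmul_eq_mul, mul_assoc]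
      push_cast
      congr 1
      rw [mul_sum]
      have h6 : ∀ j ∈ O \ S, ∑ l ∈ (O \ S).erase j, (φ S - φ (insert l S)) ^ 2 =
          ∑ l ∈ O \ S, (φ S - φ (insert l S)) ^ 2 - (φ S - φ (insert j S)) ^ 2 := fun j hj =>
        eq_sub_of_add_eq (sum_erase_add _ _ hj)
      rw [sum_congr rfl h6, sum_sub_distrib, sum_const, (hcardS S hS).2, nsmul_eq_mul, ← mul_sum]
      push_cast
      ring
    have h3 : ∑ S ∈ powersetCard (p + 1) O, ∑ i ∈ O \ S, ∑ j ∈ S,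
        (φ ((insert i S).erase j) - φ (O \ S)) ^ 2 ≤
        (2 * p + 1) ^ 2 / (p + 1) * ((p + 1) * ((p + 1) * W)) := by
      rw [sum_exchange_eq_offDiag O p (fun S i j => (φ ((insert i S).erase j) - φ (O \ S)) ^ 2),
        ← h4, mul_sum]
      refine sum_le_sum fun q hq => ?_
      rw [mem_offDiag] at hq
      have hcard : ((O.erase q.1).erase q.2).card = 2 * p + 1 := by
        rw [card_erase_of_mem (mem_erase.2 ⟨hq.2.2.symm, hq.2.1⟩), card_erase_of_mem hq.1]
        omega
      refine le_trans (le_of_eq ?_) (ih _ (fun R => φ (insert q.1 R)) hcard)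
      refine sum_congr rfl fun R hR => ?_
      have hR' := (mem_powersetCard.1 hR).1
      have e1 : (insert q.1 (insert q.2 R)).erase q.2 = insert q.1 R := by
        rw [Finset.insert_comm, erase_insert]
        rw [mem_insert, not_or]
        exact ⟨hq.2.2.symm, fun h => (mem_erase.1 (hR' h)).1 rfl⟩
      have e2 : O \ insert q.2 R = insert q.1 (((O.erase q.1).erase q.2) \ R) := by
        ext x
        simp only [mem_sdiff, mem_erase, mem_insert]
        constructor
        · intro h
          tauto
        · rintro (rfl | h)
          · refine ⟨hq.1, not_or.2 ⟨hq.2.2, fun h => ?_⟩⟩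
            exact (mem_erase.1 (mem_erase.1 (hR' h)).2).1 rfl
          · tauto
      rw [e1, e2]
    have hpos : (0 : ℝ) < 2 * p + 1 := by positivity
    have hsum : ((p : ℝ) + 1) * (p + 2) *
        ∑ S ∈ powersetCard (p + 1) O, (φ S - φ (O \ S)) ^ 2 ≤
        (2 * p + 1 + 2) * ((p + 1) * W + (p + 1) * W +
          ((2 * p + 1) ^ 2 / (p + 1) * ((p + 1) * ((p + 1) * W))) / (2 * p + 1)) := by
      calc ((p : ℝ) + 1) * (p + 2) * ∑ S ∈ powersetCard (p + 1) O, (φ S - φ (O \ S)) ^ 2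
          = ∑ S ∈ powersetCard (p + 1) O, ∑ i ∈ O \ S, ∑ j ∈ S, (φ S - φ (O \ S)) ^ 2 := by
            rw [mul_sum]
            refine sum_congr rfl fun S hS => ?_
            simp only [sum_const, (hcardS S hS).1, (hcardS S hS).2, nsmul_eq_mul]
            push_cast
            ring
        _ ≤ ∑ S ∈ powersetCard (p + 1) O, ∑ i ∈ O \ S, ∑ j ∈ S, (2 * p + 1 + 2 : ℝ) *
            ((φ S - φ (insert i S)) ^ 2 + (φ (insert i S) - φ ((insert i S).erase j)) ^ 2 +
              (φ ((insert i S).erase j) - φ (O \ S)) ^ 2 / (2 * p + 1)) := by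
            refine sum_le_sum fun S _ => sum_le_sum fun i _ => sum_le_sum fun j _ => ?_
            refine le_trans (le_of_eq ?_) (add_add_sq_le hpos)
            ring
        _ ≤ _ := by
            simp only [← mul_sum, sum_add_distrib, ← sum_div]
            rw [h1, h2]
            apply mul_le_mul_of_nonneg_left _ (by positivity)
            gcongr
    have hfin : (2 * (p : ℝ) + 1 + 2) * ((p + 1) * W + (p + 1) * W +
          ((2 * p + 1) ^ 2 / (p + 1) * ((p + 1) * ((p + 1) * W))) / (2 * p + 1)) =
        ((p : ℝ) + 1) * (p + 2) * ((2 * p + 3) ^ 2 / (p + 2) * W) := by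
      field_simp
      ring
    rw [hfin] at hsum
    have := le_of_mul_le_mul_left hsum (by positivity)
    push_cast
    have e : ((2 * p + 3 : ℝ)) ^ 2 / (p + 2) = (2 * (p + 1) + 1) ^ 2 / (p + 1 + 1) := by
      congr 1 <;> ring
    rwa [e] at this

/-- The energy of a function along the edges of the cube. -/
noncomputable def cubeEnergy (E : Finset α) (φ : Finset α → ℝ) : ℝ :=
  ∑ T ∈ E.powerset, ∑ j ∈ E \ T, (φ T - φ (insert j T)) ^ 2

theorem cubeEnergy_insert {a : α} {E : Finset α} (ha : a ∉ E) (φ : Finset α → ℝ) :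
    cubeEnergy (insert a E) φ = cubeEnergy E φ + cubeEnergy E (fun T => φ (insert a T)) +
      ∑ T ∈ E.powerset, (φ T - φ (insert a T)) ^ 2 := by
  have h1 : ∑ T ∈ E.powerset, ∑ j ∈ insert a E \ T, (φ T - φ (insert j T)) ^ 2 =
      cubeEnergy E φ + ∑ T ∈ E.powerset, (φ T - φ (insert a T)) ^ 2 := by
    rw [cubeEnergy, ← sum_add_distrib]
    refine sum_congr rfl fun T hT => ?_
    have haT : a ∉ T := fun h => ha (mem_powerset.1 hT h)
    rw [insert_sdiff_of_notMem _ haT, sum_insert (fun h => ha (mem_sdiff.1 h).1), add_comm]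
  have h2 : ∑ T ∈ E.powerset, ∑ j ∈ insert a E \ insert a T,
      (φ (insert a T) - φ (insert j (insert a T))) ^ 2 =
      cubeEnergy E (fun T => φ (insert a T)) := by
    refine sum_congr rfl fun T hT => ?_
    rw [insert_sdiff_insert, sdiff_insert_of_notMem ha]
    exact sum_congr rfl fun j _ => by rw [Finset.insert_comm]
  rw [cubeEnergy, sum_powerset_insert ha, h1, h2, add_right_comm]

theorem sum_powerset_compl (E : Finset α) (F : Finset α → ℝ) :
    ∑ T ∈ E.powerset, F (E \ T) = ∑ T ∈ E.powerset, F T := by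
  refine sum_bij' (fun T _ => E \ T) (fun T _ => E \ T) ?_ ?_ ?_ ?_ ?_
  · intro T _; exact mem_powerset.2 sdiff_subset
  · intro T _; exact mem_powerset.2 sdiff_subset
  · intro T hT; exact Finset.sdiff_sdiff_eq_self (mem_powerset.1 hT)
  · intro T hT; exact Finset.sdiff_sdiff_eq_self (mem_powerset.1 hT)
  · intro T _; rfl

/-- Complementation in a cube. -/
theorem sum_sq_sub_compl_powerset_le (E : Finset α) : ∀ φ : Finset α → ℝ,
    ∑ T ∈ E.powerset, (φ T - φ (E \ T)) ^ 2 ≤ E.card * (2 * cubeEnergy E φ) := by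
  induction E using Finset.induction_on with
  | empty => intro φ; simp
  | insert a E ha ih =>
    intro φ
    rw [sum_powerset_insert ha, cubeEnergy_insert ha, card_insert_of_notMem ha]
    set n : ℝ := (E.card : ℝ) with hn
    have hn0 : 0 ≤ n := Nat.cast_nonneg _
    -- for an empty cube `E`, complementation in `E` is trivial
    have hz : ∀ ψ : Finset α → ℝ, ∀ T ∈ E.powerset, n = 0 → ψ T - ψ (E \ T) = 0 := by
      intro ψ T hT h
      have hE : E = ∅ := by
        rw [← card_eq_zero]
        exact Nat.cast_eq_zero.1 h
      subst hE
      simp [subset_empty.1 (mem_powerset.1 hT)]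
    have hstep : ∀ ψ χ : Finset α → ℝ, ∀ T ∈ E.powerset, (ψ T - χ (E \ T)) ^ 2 ≤
        (n + 1) * ((ψ T - ψ (E \ T)) ^ 2 / n + (ψ (E \ T) - χ (E \ T)) ^ 2) := by
      intro ψ χ T hT
      have := add_sq_le_of_weights (a := ψ (E \ T) - χ (E \ T)) (b := ψ T - ψ (E \ T)) one_pos hn0
        (hz ψ T hT)
      calc (ψ T - χ (E \ T)) ^ 2 = (ψ (E \ T) - χ (E \ T) + (ψ T - ψ (E \ T))) ^ 2 := by ring
        _ ≤ _ := this
        _ = _ := by ring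
    have hdiv : ∀ ψ : Finset α → ℝ, (∑ T ∈ E.powerset, (ψ T - ψ (E \ T)) ^ 2) / n ≤
        2 * cubeEnergy E ψ := by
      intro ψ
      refine div_le_of_le_mul₀ hn0 ?_ ?_
      · unfold cubeEnergy
        positivity
      · rw [mul_comm]; exact ih ψ
    have hcompl : ∀ ψ χ : Finset α → ℝ, ∑ T ∈ E.powerset, (ψ T - χ (E \ T)) ^ 2 ≤
        (n + 1) * (2 * cubeEnergy E ψ + ∑ T ∈ E.powerset, (ψ T - χ T) ^ 2) := by
      intro ψ χ
      refine (sum_le_sum (hstep ψ χ)).trans ?_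
      rw [← mul_sum, sum_add_distrib, ← sum_div,
        sum_powerset_compl E (fun T => (ψ T - χ T) ^ 2)]
      gcongr
      exact hdiv ψ
    have e1 := hcompl φ (fun T => φ (insert a T))
    have e2 := hcompl (fun T => φ (insert a T)) φ
    have e3 : ∑ T ∈ E.powerset, (φ (insert a T) - φ T) ^ 2 =
        ∑ T ∈ E.powerset, (φ T - φ (insert a T)) ^ 2 :=
      sum_congr rfl fun T _ => by ring
    have e4 : ∑ T ∈ E.powerset, (φ T - φ (insert a E \ T)) ^ 2 =
        ∑ T ∈ E.powerset, (φ T - φ (insert a (E \ T))) ^ 2 := by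
      refine sum_congr rfl fun T hT => ?_
      rw [insert_sdiff_of_notMem _ (fun h => ha (mem_powerset.1 hT h))]
    have e5 : ∑ T ∈ E.powerset, (φ (insert a T) - φ (insert a E \ insert a T)) ^ 2 =
        ∑ T ∈ E.powerset, (φ (insert a T) - φ (E \ T)) ^ 2 := by
      refine sum_congr rfl fun T hT => ?_
      rw [insert_sdiff_insert, sdiff_insert_of_notMem ha]
    rw [e4, e5]
    rw [e3] at e2
    push_cast
    rw [← hn]
    nlinarith [e1, e2]

theorem sum_powerset_eq_sum_union {K O : Finset α} (hO : O ⊆ K) (p : ℕ) (F : Finset α → ℝ) :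
    ∑ U ∈ K.powerset with (U ∩ O).card = p, F U =
      ∑ S ∈ powersetCard p O, ∑ T ∈ (K \ O).powerset, F (S ∪ T) := by
  rw [sum_sigma']
  refine sum_bij' (fun U _ => ⟨U ∩ O, U \ O⟩) (fun q _ => q.1 ∪ q.2) ?_ ?_ ?_ ?_ ?_
  · intro U hU
    simp only [mem_filter, mem_powerset] at hU
    simp only [mem_sigma, mem_powersetCard, mem_powerset]
    exact ⟨⟨inter_subset_right, hU.2⟩, sdiff_subset_sdiff hU.1 (Subset.refl _)⟩
  · rintro ⟨S, T⟩ h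
    simp only [mem_sigma, mem_powersetCard, mem_powerset] at h
    simp only [mem_filter, mem_powerset]
    refine ⟨union_subset (h.1.1.trans hO) (h.2.trans sdiff_subset), ?_⟩
    rw [← h.1.2]
    congr 1
    ext x
    have h1 := @h.1.1 x
    have h2 := @h.2 x
    simp only [mem_inter, mem_union, mem_sdiff] at h1 h2 ⊢
    tauto
  · intro U _
    ext x
    simp only [mem_inter, mem_union, mem_sdiff]
    tauto
  · rintro ⟨S, T⟩ h
    simp only [mem_sigma, mem_powersetCard, mem_powerset] at h
    have h1 : (S ∪ T) ∩ O = S := by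
      ext x
      have h1 := @h.1.1 x
      have h2 := @h.2 x
      simp only [mem_inter, mem_union, mem_sdiff] at h1 h2 ⊢
      tauto
    have h2 : (S ∪ T) \ O = T := by
      ext x
      have h1 := @h.1.1 x
      have h2 := @h.2 x
      simp only [mem_union, mem_sdiff] at h1 h2 ⊢
      tauto
    simp only [h1, h2]
  · intro U _
    congr 1
    ext x
    simp only [mem_inter, mem_union, mem_sdiff]
    tauto

theorem sum_powersetCard_compl {O : Finset α} {p : ℕ} (hO : O.card = 2 * p + 1)
    (F : Finset α → ℝ) :
    ∑ S ∈ powersetCard p O, F (O \ S) = ∑ S ∈ powersetCard (p + 1) O, F S := by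
  refine sum_bij' (fun T _ => O \ T) (fun T _ => O \ T) ?_ ?_ ?_ ?_ ?_
  · intro T hT
    rw [mem_powersetCard] at hT ⊢
    exact ⟨sdiff_subset, by rw [card_sdiff_of_subset hT.1]; omega⟩
  · intro T hT
    rw [mem_powersetCard] at hT ⊢
    exact ⟨sdiff_subset, by rw [card_sdiff_of_subset hT.1]; omega⟩
  · intro T hT; exact Finset.sdiff_sdiff_eq_self (mem_powersetCard.1 hT).1
  · intro T hT; exact Finset.sdiff_sdiff_eq_self (mem_powersetCard.1 hT).1
  · intro T _; rfl

/-- Complementation in the product of the middle layers of an odd-dimensional cube with a cube: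
flips in the first factor come first, flips in the second one are made in the upper layer. -/
theorem sum_sq_sub_compl_mixed_le {K O : Finset α} (hOK : O ⊆ K) {p : ℕ}
    (hO : O.card = 2 * p + 1) (φ : Finset α → ℝ) :
    ∑ U ∈ K.powerset with (U ∩ O).card = p, (φ U - φ (K \ U)) ^ 2 ≤
      2 * K.card *
        (∑ U ∈ K.powerset with (U ∩ O).card = p, ∑ j ∈ O \ U, (φ U - φ (insert j U)) ^ 2 +
          ∑ U ∈ K.powerset with (U ∩ O).card = p + 1,
            ∑ j ∈ (K \ O) \ U, (φ U - φ (insert j U)) ^ 2) := by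
  rw [sum_powerset_eq_sum_union hOK, sum_powerset_eq_sum_union hOK, sum_powerset_eq_sum_union hOK]
  set E := K \ O with hE
  set n : ℝ := (E.card : ℝ) with hn
  have hn0 : 0 ≤ n := Nat.cast_nonneg _
  have hcard : (K.card : ℝ) = (2 * p + 1) + n := by
    have := card_sdiff_add_card_eq_card hOK
    rw [← this, hO, hn]
    push_cast
    ring
  have hdisj : ∀ x, x ∈ O → x ∉ E := fun x hx hx' => (mem_sdiff.1 hx').2 hx
  have e1 : ∀ S ∈ powersetCard p O, ∀ T ∈ E.powerset, K \ (S ∪ T) = (O \ S) ∪ (E \ T) := by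
    intro S hS T hT
    ext x
    have h1 : x ∈ S → x ∈ O := fun h => (mem_powersetCard.1 hS).1 h
    have h2 : x ∈ T → x ∈ E := fun h => mem_powerset.1 hT h
    have h3 := @hOK x
    simp only [mem_sdiff, mem_union, hE] at *
    tauto
  have e2 : ∀ S T, S ⊆ O → T ⊆ E → O \ (S ∪ T) = O \ S := by
    intro S T hS hT
    ext x
    have h2 := @hT x
    have h3 := hdisj x
    simp only [mem_sdiff, mem_union] at *
    tauto
  have e3 : ∀ S T, S ⊆ O → T ⊆ E → E \ (S ∪ T) = E \ T := by
    intro S T hS hT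
    ext x
    have h2 := @hS x
    have h3 := hdisj x
    simp only [mem_sdiff, mem_union] at *
    tauto
  have hA : ∑ S ∈ powersetCard p O, ∑ T ∈ E.powerset, ∑ j ∈ O \ (S ∪ T),
      (φ (S ∪ T) - φ (insert j (S ∪ T))) ^ 2 =
      ∑ T ∈ E.powerset, layerEnergy O p (fun S => φ (S ∪ T)) := by
    rw [sum_comm]
    refine sum_congr rfl fun T hT => sum_congr rfl fun S hS => ?_
    rw [e2 S T (mem_powersetCard.1 hS).1 (mem_powerset.1 hT)]
    exact sum_congr rfl fun j _ => by simp only [insert_union]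
  have hB : ∑ S ∈ powersetCard (p + 1) O, ∑ T ∈ E.powerset, ∑ j ∈ E \ (S ∪ T),
      (φ (S ∪ T) - φ (insert j (S ∪ T))) ^ 2 =
      ∑ S ∈ powersetCard (p + 1) O, cubeEnergy E (fun T => φ (S ∪ T)) := by
    refine sum_congr rfl fun S hS => sum_congr rfl fun T hT => ?_
    rw [e3 S T (mem_powersetCard.1 hS).1 (mem_powerset.1 hT)]
    exact sum_congr rfl fun j _ => by simp only [union_insert]
  rw [hA, hB]
  have hp : (0 : ℝ) < 2 * p + 1 := by positivity
  have hstep : ∀ S ∈ powersetCard p O, ∀ T ∈ E.powerset,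
      (φ (S ∪ T) - φ (K \ (S ∪ T))) ^ 2 ≤ ((2 * p + 1) + n) *
        ((φ (S ∪ T) - φ ((O \ S) ∪ T)) ^ 2 / (2 * p + 1) +
          (φ ((O \ S) ∪ T) - φ ((O \ S) ∪ (E \ T))) ^ 2 / n) := by
    intro S hS T hT
    rw [e1 S hS T hT]
    refine le_trans (le_of_eq ?_) (add_sq_le_of_weights hp hn0 ?_)
    · ring
    · intro h
      have hE0 : E = ∅ := by
        rw [← card_eq_zero]
        exact Nat.cast_eq_zero.1 h
      rw [hE0] at hT
      rw [hE0, subset_empty.1 (mem_powerset.1 hT)]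
      simp
  refine (sum_le_sum fun S hS => sum_le_sum fun T hT => hstep S hS T hT).trans ?_
  rw [hcard]
  simp only [← mul_sum, sum_add_distrib, ← sum_div]
  have hX : (∑ S ∈ powersetCard p O, ∑ T ∈ E.powerset,
      (φ (S ∪ T) - φ ((O \ S) ∪ T)) ^ 2) / (2 * p + 1) ≤
      2 * ∑ T ∈ E.powerset, layerEnergy O p (fun S => φ (S ∪ T)) := by
    rw [sum_comm, sum_div, mul_sum]
    refine sum_le_sum fun T _ => ?_
    rw [div_le_iff₀ hp]
    refine (sum_sq_sub_compl_le p O (fun S => φ (S ∪ T)) hO).trans ?_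
    have hpos : 0 ≤ layerEnergy O p (fun S => φ (S ∪ T)) := by
      unfold layerEnergy
      positivity
    rw [mul_right_comm]
    apply mul_le_mul_of_nonneg_right _ hpos
    rw [div_le_iff₀ (by positivity)]
    nlinarith
  have hY : (∑ S ∈ powersetCard p O, ∑ T ∈ E.powerset,
      (φ ((O \ S) ∪ T) - φ ((O \ S) ∪ (E \ T))) ^ 2) / n ≤
      2 * ∑ S ∈ powersetCard (p + 1) O, cubeEnergy E (fun T => φ (S ∪ T)) := by
    rw [sum_powersetCard_compl hO (fun S => ∑ T ∈ E.powerset,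
      (φ (S ∪ T) - φ (S ∪ (E \ T))) ^ 2), mul_sum]
    refine div_le_of_le_mul₀ hn0 ?_ ?_
    · unfold cubeEnergy
      positivity
    · rw [mul_comm, mul_sum]
      exact sum_le_sum fun S _ => sum_sq_sub_compl_powerset_le E (fun T => φ (S ∪ T))
  calc _ ≤ ((2 * p + 1) + n) * (2 * ∑ T ∈ E.powerset, layerEnergy O p (fun S => φ (S ∪ T)) +
      2 * ∑ S ∈ powersetCard (p + 1) O, cubeEnergy E (fun T => φ (S ∪ T))) :=
        mul_le_mul_of_nonneg_left (add_le_add hX hY) (by positivity)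
    _ = _ := by ring

end Cube

/-! ### Log-concavity and exchange of single components -/

section PairSums

variable {V : Type*} {G : SimpleGraph V} [Fintype V]

theorem FiberParam.card_compl {H I : Finset (Sym2 V)} (P : FiberParam G H I)
    (U : Finset (Finset (Sym2 V))) :
    (P.ψ (components H \ U)).card + (U ∩ P.odd).card = P.base + P.odd.card := by
  rw [P.card_ψ _ sdiff_subset]
  have h1 : (components H \ U) ∩ P.odd = P.odd \ U := by
    ext C
    have := @P.odd_subset C
    simp only [mem_inter, mem_sdiff]
    tauto
  have h2 := card_sdiff_add_card_inter P.odd U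
  rw [h1, inter_comm U]
  omega

theorem FiberParam.filter_lt {H I : Finset (Sym2 V)} (P : FiberParam G H I)
    {U : Finset (Finset (Sym2 V))} (hU : U ⊆ components H) :
    (components H).filter (fun C => (P.ψ U ∩ C).card < (P.ψ (components H \ U) ∩ C).card) =
      P.odd \ U := by
  ext C
  rw [mem_filter, mem_sdiff]
  constructor
  · rintro ⟨hC, hlt⟩
    by_cases hCU : C ∈ U
    · have h := P.card_inter _ sdiff_subset C hC (fun h => (mem_sdiff.1 h).2 hCU)
      rw [Finset.sdiff_sdiff_eq_self hU] at h
      omega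
    · refine ⟨?_, hCU⟩
      by_contra hO
      have h := P.card_inter U hU C hC hCU
      rw [if_neg hO] at h
      omega
  · rintro ⟨hC, hCU⟩
    refine ⟨P.odd_subset hC, ?_⟩
    rw [P.card_inter U hU C (P.odd_subset hC) hCU, if_pos hC]
    omega

theorem FiberParam.subset_filter_eq {H I : Finset (Sym2 V)} (P : FiberParam G H I)
    {U : Finset (Finset (Sym2 V))} (hU : U ⊆ components H) :
    (components H \ P.odd) \ U ⊆ (components H).filter
      (fun C => (P.ψ U ∩ C).card = (P.ψ (components H \ U) ∩ C).card) := by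
  intro C hC
  simp only [mem_sdiff] at hC
  rw [mem_filter]
  refine ⟨hC.1.1, ?_⟩
  rw [P.card_inter U hU C hC.1.1 hC.2, if_neg hC.1.2, add_zero]

theorem FiberParam.card_and_card_iff {H I : Finset (Sym2 V)} (P : FiberParam G H I)
    {U : Finset (Finset (Sym2 V))} (hU : U ⊆ components H) (p r : ℕ)
    (hO : P.odd.card = p + r) :
    ((P.ψ U).card = P.base + p ∧ (P.ψ (components H \ U)).card = P.base + r) ↔
      (U ∩ P.odd).card = p := by
  have h1 := P.card_ψ U hU
  have h2 := P.card_compl U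
  omega

/-- Either no pair in the fiber has sizes `(a, b)`, or those pairs form one layer of the fiber. -/
theorem FiberParam.sum_layer {H I : Finset (Sym2 V)} (P : FiberParam G H I) (p r : ℕ)
    (hO : P.odd.card = p + r) (F : Finset (Sym2 V) → Finset (Sym2 V) → ℝ) :
    (∑ q ∈ pairsWith G H I, if q.1.card = P.base + p ∧ q.2.card = P.base + r then
        F q.1 q.2 else 0) =
      ∑ U ∈ (components H).powerset with (U ∩ P.odd).card = p,
        F (P.ψ U) (P.ψ (components H \ U)) := by
  rw [P.sum_eq (fun X Y => if X.card = P.base + p ∧ Y.card = P.base + r then F X Y else 0),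
    sum_filter]
  refine sum_congr rfl fun U hU => ?_
  simp only [P.card_and_card_iff (mem_powerset.1 hU) p r hO]

theorem FiberParam.exists_layer {H I : Finset (Sym2 V)} (P : FiberParam G H I) {a b : ℕ}
    {q : Finset (Sym2 V) × Finset (Sym2 V)} (hq : q ∈ pairsWith G H I) (ha : q.1.card = a)
    (hb : q.2.card = b) : ∃ p r, a = P.base + p ∧ b = P.base + r ∧ P.odd.card = p + r := by
  have h := P.sum_eq (fun X Y => if X.card = a ∧ Y.card = b then 1 else 0)
  have hpos : 0 < ∑ q ∈ pairsWith G H I,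
      (if q.1.card = a ∧ q.2.card = b then (1 : ℝ) else 0) := by
    refine sum_pos' (fun _ _ => by split_ifs <;> norm_num) ⟨q, hq, ?_⟩
    rw [if_pos ⟨ha, hb⟩]
    exact one_pos
  rw [h] at hpos
  obtain ⟨U, hU, hne⟩ := exists_ne_zero_of_sum_ne_zero hpos.ne'
  rw [mem_powerset] at hU
  have hUab : (P.ψ U).card = a ∧ (P.ψ (components H \ U)).card = b := by
    by_contra h
    rw [if_neg h] at hne
    exact hne rfl
  have h1 := P.card_ψ U hU
  have h2 := P.card_compl U
  have h3 := card_le_card (inter_subset_right : U ∩ P.odd ⊆ P.odd)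
  exact ⟨(U ∩ P.odd).card, P.odd.card - (U ∩ P.odd).card, by omega, by omega, by omega⟩

/-- The numbers of matchings of each size form a log-concave sequence. -/
theorem card_matchingsOfCard_log_concave (a : ℕ) :
    ((matchingsOfCard G a).card : ℝ) * (matchingsOfCard G (a + 2)).card ≤
      ((matchingsOfCard G (a + 1)).card : ℝ) ^ 2 := by
  have hcard : ∀ b c : ℕ, ((matchingsOfCard G b).card : ℝ) * (matchingsOfCard G c).card =
      ∑ X ∈ matchingsOfCard G b, ∑ Y ∈ matchingsOfCard G c, (1 : ℝ) := by
    intro b c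
    simp
  rw [sq, hcard, hcard, sum_pairs_eq a (a + 2) (fun _ _ => 1),
    sum_pairs_eq (a + 1) (a + 1) (fun _ _ => 1)]
  refine sum_le_sum fun ⟨H, I⟩ _ => ?_
  dsimp only
  have hnn : 0 ≤ ∑ q ∈ pairsWith G H I,
      (if q.1.card = a + 1 ∧ q.2.card = a + 1 then (1 : ℝ) else 0) :=
    sum_nonneg fun _ _ => by split_ifs <;> norm_num
  by_cases hex : ∃ q ∈ pairsWith G H I, q.1.card = a ∧ q.2.card = a + 2
  · obtain ⟨q, hq, ha, hb⟩ := hex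
    obtain ⟨P⟩ := nonempty_fiberParam ⟨q, hq⟩
    obtain ⟨p, r, hp, hr, hO⟩ := P.exists_layer hq ha hb
    obtain rfl : r = p + 2 := by omega
    have e1 := P.sum_layer p (p + 2) hO (fun _ _ => 1)
    have e2 := P.sum_layer (p + 1) (p + 1) (by omega) (fun _ _ => 1)
    rw [← hp, ← hr] at e1
    rw [show P.base + (p + 1) = a + 1 by omega] at e2
    rw [e1, e2, sum_powerset_eq_sum_union P.odd_subset p (fun _ => 1),
      sum_powerset_eq_sum_union P.odd_subset (p + 1) (fun _ => 1)]
    simp only [sum_const, nsmul_eq_mul, mul_one, card_powersetCard]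
    refine mul_le_mul_of_nonneg_right ?_ (Nat.cast_nonneg _)
    have h := Nat.choose_le_middle p P.odd.card
    rw [show P.odd.card / 2 = p + 1 by omega] at h
    exact_mod_cast h
  · push Not at hex
    rw [sum_eq_zero]
    · exact hnn
    · intro q hq
      exact if_neg fun h => hex q hq h.1 h.2

/-- A pair of matchings of sizes `k` and `k + 1` is joined by exchanging the components of its
symmetric difference one after the other, so differences along such pairs are controlled by
differences along the exchange of one component. -/
theorem sum_pairs_sq_sub_le (k : ℕ) (g : Finset (Sym2 V) → ℝ) :
    ∑ X ∈ matchingsOfCard G k, ∑ Y ∈ matchingsOfCard G (k + 1), (g X - g Y) ^ 2 ≤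
      2 * (2 * k + 1) *
        (∑ X ∈ matchingsOfCard G k, ∑ Y ∈ matchingsOfCard G (k + 1),
          ∑ C ∈ components (X ∆ Y) with (X ∩ C).card < (Y ∩ C).card, (g X - g (X ∆ C)) ^ 2 +
        ∑ X ∈ matchingsOfCard G (k + 1), ∑ Y ∈ matchingsOfCard G k,
          ∑ C ∈ components (X ∆ Y) with (X ∩ C).card = (Y ∩ C).card, (g X - g (X ∆ C)) ^ 2) := by
  rw [sum_pairs_eq k (k + 1) (fun X Y => (g X - g Y) ^ 2),
    sum_pairs_eq k (k + 1) (fun X Y => ∑ C ∈ components (X ∆ Y) with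
      (X ∩ C).card < (Y ∩ C).card, (g X - g (X ∆ C)) ^ 2),
    sum_pairs_eq (k + 1) k (fun X Y => ∑ C ∈ components (X ∆ Y) with
      (X ∩ C).card = (Y ∩ C).card, (g X - g (X ∆ C)) ^ 2), ← sum_add_distrib, mul_sum]
  refine sum_le_sum fun ⟨H, I⟩ _ => ?_
  dsimp only
  by_cases hex : ∃ q ∈ pairsWith G H I, q.1.card = k ∧ q.2.card = k + 1
  · obtain ⟨q, hq, ha, hb⟩ := hex
    obtain ⟨P⟩ := nonempty_fiberParam ⟨q, hq⟩
    obtain ⟨p, r, hp, hr, hO⟩ := P.exists_layer hq ha hb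
    obtain rfl : r = p + 1 := by omega
    have e1 := P.sum_layer p (p + 1) hO (fun X Y => (g X - g Y) ^ 2)
    have e2 := P.sum_layer p (p + 1) hO (fun X Y => ∑ C ∈ components (X ∆ Y) with
      (X ∩ C).card < (Y ∩ C).card, (g X - g (X ∆ C)) ^ 2)
    have e3 := P.sum_layer (p + 1) p (by omega) (fun X Y => ∑ C ∈ components (X ∆ Y) with
      (X ∩ C).card = (Y ∩ C).card, (g X - g (X ∆ C)) ^ 2)
    rw [← hp, ← hr] at e1 e2 e3
    rw [e1, e2, e3]
    have hK : ((components H).card : ℝ) ≤ 2 * k + 1 := by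
      have h1 : (components H).card ≤ H.card := card_image_le
      have h2 : H.card ≤ q.1.card + q.2.card := by
        simp only [pairsWith, mem_filter] at hq
        rw [← hq.2.2.2.1]
        exact (card_union_le _ _).trans (add_le_add (card_le_card sdiff_subset)
          (card_le_card sdiff_subset))
      have : (components H).card ≤ 2 * k + 1 := by omega
      exact_mod_cast this
    refine (sum_sq_sub_compl_mixed_le (p := p) P.odd_subset (by omega) (fun U => g (P.ψ U))).trans ?_
    refine mul_le_mul (mul_le_mul_of_nonneg_left hK zero_le_two) ?_ (by positivity)
      (by positivity)
    refine add_le_add (sum_le_sum fun U hU => ?_) (sum_le_sum fun U hU => ?_)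
    · have hU' := mem_powerset.1 (mem_filter.1 hU).1
      rw [P.symmDiff_ψ U hU', P.filter_lt hU']
      refine le_of_eq (sum_congr rfl fun C hC => ?_)
      obtain ⟨hC1, hC2⟩ := mem_sdiff.1 hC
      rw [P.ψ_insert U hU' C (P.odd_subset hC1) hC2]
    · have hU' := mem_powerset.1 (mem_filter.1 hU).1
      rw [P.symmDiff_ψ U hU']
      refine le_trans (le_of_eq ?_) (sum_le_sum_of_subset_of_nonneg (P.subset_filter_eq hU')
        fun _ _ _ => sq_nonneg _)
      refine sum_congr rfl fun C hC => ?_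
      obtain ⟨hC1, hC2⟩ := mem_sdiff.1 hC
      rw [P.ψ_insert U hU' C (mem_sdiff.1 hC1).1 hC2]
  · push Not at hex
    rw [sum_eq_zero]
    · positivity
    · intro q hq
      exact if_neg fun h => hex q hq h.1 h.2

end PairSums

/-! ### Congestion of the paths -/

section Congestion

theorem sum_le_sum_of_injOn {ι κ : Type*} {s : Finset ι} {t : Finset κ} (i : ι → κ)
    (hi : ∀ a ∈ s, i a ∈ t) (hinj : Set.InjOn i s) {f : ι → ℝ} {g : κ → ℝ}
    (hfg : ∀ a ∈ s, f a ≤ g (i a)) (hg : ∀ b ∈ t, 0 ≤ g b) : ∑ a ∈ s, f a ≤ ∑ b ∈ t, g b := by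
  calc ∑ a ∈ s, f a ≤ ∑ a ∈ s, g (i a) := sum_le_sum hfg
    _ = ∑ b ∈ s.image i, g b := (sum_image hinj).symm
    _ ≤ ∑ b ∈ t, g b := sum_le_sum_of_subset_of_nonneg (image_subset_iff.2 hi)
        fun b hb _ => hg b hb

variable {V : Type*} {G : SimpleGraph V}

theorem union_singleton_sdiff {M : Finset (Sym2 V)} {e e' : Sym2 V} (h : e' ≠ e) :
    (M ∪ {e'}) \ {e} = insert e' (M.erase e) := by
  ext x
  simp only [mem_sdiff, mem_union, mem_singleton, mem_insert, mem_erase]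
  by_cases hx : x = e'
  · simp [hx, h]
  · simp [hx, and_comm]

/-- Runs can be traced back to their start. -/
theorem TraceRun.start_eq {X Y C X' Y' C' : Finset (Sym2 V)} {s s' : TraceState V} {m m' : ℕ}
    {st st' : ℕ → TraceState V} (h : TraceRun G X Y C s m st) (h' : TraceRun G X' Y' C' s' m' st')
    (i : ℕ) (hi : i ≤ m) (hi' : i ≤ m') (heq : st i = st' i) : s = s' := by
  induction i with
  | zero => rw [← h.zero, ← h'.zero, heq]
  | succ i ih =>
    refine ih (by omega) (by omega) ?_
    have h1 := h.slide i (by omega)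
    have h2 := h'.slide i (by omega)
    rw [← heq] at h2
    exact h1.left_unique h2 (h.valid i (by omega)) (h'.valid i (by omega)) (h.valid _ hi)

variable [Fintype V]

/-- The Dirichlet form of the walk on `k`-matchings, up to normalization. -/
noncomputable def swapEnergy (G : SimpleGraph V) (k : ℕ) (f : Finset (Sym2 V) → ℝ) : ℝ :=
  ∑ M ∈ matchingsOfCard G k, ∑ e' ∈ G.edgeFinset, ∑ e ∈ M,
    if (M ∪ {e'}) \ {e} ∈ matchingsOfCard G k then (f M - f ((M ∪ {e'}) \ {e})) ^ 2 else 0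

theorem swapEnergy_nonneg (k : ℕ) (f : Finset (Sym2 V) → ℝ) : 0 ≤ swapEnergy G k f :=
  sum_nonneg fun _ _ => sum_nonneg fun _ _ => sum_nonneg fun _ _ => by
    split_ifs <;> positivity

/-- The extension of a function on `k`-matchings to `(k+1)`-matchings by averaging over the removed
edge. -/
noncomputable def upAverage (f : Finset (Sym2 V) → ℝ) (W : Finset (Sym2 V)) : ℝ :=
  (∑ e ∈ W, f (W.erase e)) / W.card

theorem erase_mem_matchingsOfCard {k : ℕ} {W : Finset (Sym2 V)} {e : Sym2 V}
    (hW : W ∈ matchingsOfCard G (k + 1)) (he : e ∈ W) : W.erase e ∈ matchingsOfCard G k := by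
  rw [mem_matchingsOfCard] at hW ⊢
  refine ⟨hW.1.subset (erase_subset _ _), ?_⟩
  rw [card_erase_of_mem he]
  omega

/-- Two `k`-matchings contained in a common `(k+1)`-matching are adjacent. -/
theorem sum_upAverage_sq_le (k : ℕ) (f : Finset (Sym2 V) → ℝ) :
    ∑ W ∈ matchingsOfCard G (k + 1), ∑ e ∈ W, (upAverage f W - f (W.erase e)) ^ 2 ≤
      swapEnergy G k f := by
  have hstep : ∀ W ∈ matchingsOfCard G (k + 1), ∀ e ∈ W,
      (upAverage f W - f (W.erase e)) ^ 2 ≤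
        ∑ y ∈ W.erase e, (f (W.erase e) - f (W.erase y)) ^ 2 := by
    intro W hW e he
    have hc : W.card = k + 1 := (mem_matchingsOfCard.1 hW).2
    have hpos : (0 : ℝ) < W.card := by rw [hc]; positivity
    have h1 : upAverage f W - f (W.erase e) =
        (∑ y ∈ W, (f (W.erase y) - f (W.erase e))) / W.card := by
      rw [sum_sub_distrib, sum_const, nsmul_eq_mul, upAverage]
      field_simp
    have h2 := sq_sum_le_card_mul_sum_sq (s := W) (f := fun y => f (W.erase y) - f (W.erase e))
    have h3 : ∑ y ∈ W.erase e, (f (W.erase e) - f (W.erase y)) ^ 2 =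
        ∑ y ∈ W, (f (W.erase y) - f (W.erase e)) ^ 2 := by
      rw [← add_sum_erase W _ he, sub_self, zero_pow two_ne_zero, zero_add]
      exact sum_congr rfl fun y _ => by ring
    rw [h1, h3, div_pow, div_le_iff₀ (by positivity)]
    refine h2.trans ?_
    rw [mul_comm]
    refine mul_le_mul_of_nonneg_left ?_ (by positivity)
    have : (1 : ℝ) ≤ W.card := by rw [hc]; push_cast; linarith [Nat.cast_nonneg (α := ℝ) k]
    nlinarith
  refine (sum_le_sum fun W hW => sum_le_sum fun e he => hstep W hW e he).trans ?_
  rw [swapEnergy]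
  simp only [sum_sigma']
  refine sum_le_sum_of_injOn (fun q => ⟨q.1.erase q.2.1, q.2.1, q.2.2⟩) ?_ ?_ ?_ ?_
  · rintro ⟨W, e, y⟩ h
    simp only [mem_sigma] at h ⊢
    refine ⟨erase_mem_matchingsOfCard h.1 h.2.1, ?_, h.2.2⟩
    simpa using (mem_matchingsOfCard.1 h.1).1.1 e h.2.1
  · rintro ⟨W, e, y⟩ h ⟨W', e', y'⟩ h' heq
    simp only [mem_coe, mem_sigma] at h h'
    simp only [Sigma.mk.injEq, heq_eq_eq] at heq
    obtain ⟨h1, rfl, rfl⟩ := heq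
    have : W = W' := by rw [← insert_erase h.2.1, h1, insert_erase h'.2.1]
    rw [this]
  · rintro ⟨W, e, y⟩ h
    simp only [mem_sigma] at h
    obtain ⟨hW, he, hy⟩ := h
    have hye := (mem_erase.1 hy)
    dsimp only
    have h1 : (W.erase e ∪ {e}) \ {y} = W.erase y := by
      rw [union_singleton_sdiff hye.1.symm, erase_right_comm, insert_erase]
      exact mem_erase.2 ⟨hye.1.symm, he⟩
    rw [h1, if_pos (erase_mem_matchingsOfCard hW hye.2)]
  · rintro ⟨W, e, y⟩ _
    dsimp only
    split_ifs <;> positivity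

/-- The energy charged to a state of the path construction with matching `M` and next edge `e'`. -/
noncomputable def traceCost (G : SimpleGraph V) (k : ℕ) (f : Finset (Sym2 V) → ℝ)
    (M : Finset (Sym2 V)) (e' : Sym2 V) : ℝ :=
  (∑ e ∈ M, if (M ∪ {e'}) \ {e} ∈ matchingsOfCard G k then
    (f M - f ((M ∪ {e'}) \ {e})) ^ 2 else 0) +
  if insert e' M ∈ matchingsOfCard G (k + 1) then (f M - upAverage f (insert e' M)) ^ 2 else 0

theorem traceCost_nonneg (k : ℕ) (f : Finset (Sym2 V) → ℝ) (M : Finset (Sym2 V)) (e' : Sym2 V) :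
    0 ≤ traceCost G k f M e' :=
  add_nonneg (sum_nonneg fun _ _ => by split_ifs <;> positivity) (by split_ifs <;> positivity)

theorem sum_traceCost_le (k : ℕ) (f : Finset (Sym2 V) → ℝ) :
    ∑ M ∈ matchingsOfCard G k, ∑ e' ∈ G.edgeFinset, traceCost G k f M e' ≤
      2 * swapEnergy G k f := by
  have h1 : ∑ M ∈ matchingsOfCard G k, ∑ e' ∈ G.edgeFinset,
      (if insert e' M ∈ matchingsOfCard G (k + 1) then
        (f M - upAverage f (insert e' M)) ^ 2 else 0) ≤ swapEnergy G k f := by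
    refine le_trans ?_ (sum_upAverage_sq_le k f)
    simp only [sum_sigma']
    rw [← sum_filter]
    have hnot : ∀ M ∈ matchingsOfCard G k, ∀ e', insert e' M ∈ matchingsOfCard G (k + 1) →
        e' ∉ M := by
      intro M hM e' h he
      rw [insert_eq_of_mem he] at h
      have h1 := (mem_matchingsOfCard.1 hM).2
      have h2 := (mem_matchingsOfCard.1 h).2
      omega
    refine sum_le_sum_of_injOn (fun q => ⟨insert q.2 q.1, q.2⟩) ?_ ?_ ?_ ?_
    · rintro ⟨M, e'⟩ h
      simp only [mem_filter, mem_sigma] at h ⊢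
      exact ⟨h.2, mem_insert_self _ _⟩
    · rintro ⟨M, e'⟩ h ⟨M', e''⟩ h' heq
      simp only [mem_coe, mem_filter, mem_sigma] at h h'
      simp only [Sigma.mk.injEq, heq_eq_eq] at heq
      obtain ⟨h1, rfl⟩ := heq
      have : M = M' := by
        rw [← erase_insert (hnot M h.1.1 e' h.2), h1, erase_insert (hnot M' h'.1.1 e' h'.2)]
      rw [this]
    · rintro ⟨M, e'⟩ h
      simp only [mem_filter, mem_sigma] at h
      dsimp only
      rw [erase_insert (hnot M h.1.1 e' h.2)]
      exact le_of_eq (by ring)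
    · rintro ⟨M, e'⟩ _
      positivity
  simp only [traceCost, sum_add_distrib]
  rw [swapEnergy] at h1 ⊢
  linarith

/-- Each edge has two orientations. -/
theorem sum_adj_le (F : Sym2 V → ℝ) (hF : ∀ e, 0 ≤ F e) :
    ∑ q : V × V with G.Adj q.1 q.2, F s(q.1, q.2) ≤ 2 * ∑ e ∈ G.edgeFinset, F e := by
  rw [← sum_fiberwise_of_maps_to (t := G.edgeFinset) (g := fun q : V × V => s(q.1, q.2)), mul_sum]
  · refine sum_le_sum fun e _ => ?_
    induction e using Sym2.ind with
    | _ a b =>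
    have h1 : ∀ q ∈ (univ.filter fun q : V × V => G.Adj q.1 q.2).filter
        (fun q => s(q.1, q.2) = s(a, b)), F s(q.1, q.2) = F s(a, b) := by
      intro q hq
      rw [(mem_filter.1 hq).2]
    rw [sum_congr rfl h1, sum_const, nsmul_eq_mul]
    refine mul_le_mul_of_nonneg_right ?_ (hF _)
    have h2 : ((univ.filter fun q : V × V => G.Adj q.1 q.2).filter
        (fun q => s(q.1, q.2) = s(a, b))) ⊆ {(a, b), (b, a)} := by
      rintro ⟨c, d⟩ hq
      have := (mem_filter.1 hq).2
      simpa [Prod.ext_iff] using this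
    exact_mod_cast (card_le_card h2).trans card_le_two
  · intro q hq
    simpa using (mem_filter.1 hq).2

theorem sq_sum_add_le (m : ℕ) (a : ℕ → ℝ) :
    (∑ i ∈ range (m + 1), a i) ^ 2 ≤ (m + 1) * ∑ i ∈ range (m + 1), a i ^ 2 := by
  have := sq_sum_le_card_mul_sum_sq (s := range (m + 1)) (f := a)
  rw [card_range] at this
  exact_mod_cast this

/-- The cost of one transformation is bounded along its run. -/
theorem TraceRun.sq_sub_le {X Y C : Finset (Sym2 V)} {s : TraceState V} {m k : ℕ}
    {st : ℕ → TraceState V} (h : TraceRun G X Y C s m st) (hX : X.card = k) (hs : s.M = X)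
    (hXC : X ∆ C ∈ matchingsOfCard G (k + 1)) (f : Finset (Sym2 V) → ℝ) :
    (f X - upAverage f (X ∆ C)) ^ 2 ≤
      (m + 1) * ∑ i ∈ range (m + 1), traceCost G k f (st i).M s((st i).v, (st i).w) := by
  set a : ℕ → ℝ := fun i => if i < m then f (st i).M - f (st (i + 1)).M
    else f (st m).M - upAverage f (X ∆ C) with ha
  have htel : f X - upAverage f (X ∆ C) = ∑ i ∈ range (m + 1), a i := by
    rw [sum_range_succ]
    have h1 : ∑ i ∈ range m, a i = ∑ i ∈ range m, (f (st i).M - f (st (i + 1)).M) :=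
      sum_congr rfl fun i hi => if_pos (mem_range.1 hi)
    rw [h1, sum_range_sub', h.zero, hs]
    simp [ha]
  rw [htel]
  refine (sq_sum_add_le m a).trans (mul_le_mul_of_nonneg_left ?_ (by positivity))
  refine sum_le_sum fun i hi => ?_
  rw [mem_range] at hi
  have hnn : ∀ M e', 0 ≤ ∑ e ∈ M, (if (M ∪ {e'}) \ {e} ∈ matchingsOfCard G k then
      (f M - f ((M ∪ {e'}) \ {e})) ^ 2 else 0) := fun M e' =>
    sum_nonneg fun _ _ => by split_ifs <;> positivity
  by_cases him : i < m
  · have hsl := h.slide i him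
    have hval := h.valid i (by omega)
    have hne : s((st i).v, (st i).w) ≠ s((st i).w, (st (i + 1)).v) := by
      intro heq
      refine hval.free_v _ hsl.mem_M ?_
      rw [← heq]
      simp
    have hM : ((st i).M ∪ {s((st i).v, (st i).w)}) \ {s((st i).w, (st (i + 1)).v)} =
        (st (i + 1)).M := by
      rw [union_singleton_sdiff hne, hsl.eq_M]
    have hmem : (st (i + 1)).M ∈ matchingsOfCard G k := by
      rw [mem_matchingsOfCard]
      exact ⟨(h.valid (i + 1) (by omega)).matchingM, (h.card_M (i + 1) (by omega)).trans hX⟩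
    simp only [ha, if_pos him]
    refine le_trans ?_ (le_add_of_nonneg_right (by split_ifs <;> positivity))
    refine le_trans (le_of_eq ?_) (single_le_sum (fun e _ => by split_ifs <;> positivity)
      hsl.mem_M)
    rw [hM, if_pos hmem]
  · obtain rfl : i = m := by omega
    simp only [ha, if_neg him]
    refine le_trans (le_of_eq ?_) (le_add_of_nonneg_left (hnn _ _))
    rw [h.last, if_pos hXC]

theorem symmDiff_mem_matchingsOfCard_of_lt {X Y C : Finset (Sym2 V)} {k : ℕ}
    (hX : X ∈ matchingsOfCard G k) (hY : IsMatching G Y) (hC : C ∈ components (X ∆ Y))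
    (hmaj : (X ∩ C).card < (Y ∩ C).card) : X ∆ C ∈ matchingsOfCard G (k + 1) := by
  rw [mem_matchingsOfCard] at hX ⊢
  have hcl := isClosedIn_of_mem_components hC
  refine ⟨hX.1.symmDiff_of_isClosedIn hY hcl, ?_⟩
  have h1 := card_symmDiff_add hcl.1
  have h2 := card_inter_eq_succ_of_lt hX.1 hY hC hmaj
  omega

theorem symmDiff_mem_matchingsOfCard_of_eq {X Y C : Finset (Sym2 V)} {k : ℕ}
    (hX : X ∈ matchingsOfCard G k) (hY : IsMatching G Y) (hC : C ∈ components (X ∆ Y))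
    (hbal : (X ∩ C).card = (Y ∩ C).card) : X ∆ C ∈ matchingsOfCard G k := by
  rw [mem_matchingsOfCard] at hX ⊢
  have hcl := isClosedIn_of_mem_components hC
  refine ⟨hX.1.symmDiff_of_isClosedIn hY hcl, ?_⟩
  have h1 := card_symmDiff_add hcl.1
  omega

/-- Exchanging one component with more edges in `Y`, summed over all pairs and components: since
slides are reversible, at each time every state is visited at most once. -/
theorem sum_flip_odd_le (k j : ℕ) (f : Finset (Sym2 V) → ℝ) :
    ∑ X ∈ matchingsOfCard G k, ∑ Y ∈ matchingsOfCard G (j + 1),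
      ∑ C ∈ components (X ∆ Y) with (X ∩ C).card < (Y ∩ C).card,
        (f X - upAverage f (X ∆ C)) ^ 2 ≤
      4 * (k + 1) ^ 2 * (matchingsOfCard G j).card * swapEnergy G k f := by
  simp only [sum_sigma']
  set S := (matchingsOfCard G k).sigma fun X => (matchingsOfCard G (j + 1)).sigma fun Y =>
    (components (X ∆ Y)).filter fun C => (X ∩ C).card < (Y ∩ C).card with hS
  have hrun : ∀ a ∈ S, ∃ (m : ℕ) (st : ℕ → TraceState V), m ≤ k ∧
      TraceRun G a.1 a.2.1 a.2.2 (st 0) m st ∧ (st 0).M = a.1 ∧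
      insert s((st 0).v, (st 0).w) (st 0).F = a.2.1 ∧ s((st 0).v, (st 0).w) ∈ a.2.2 := by
    rintro ⟨X, Y, C⟩ ha
    simp only [hS, mem_sigma, mem_filter, mem_matchingsOfCard] at ha
    obtain ⟨⟨hX, hk⟩, ⟨hY, hj⟩, hC, hmaj⟩ := ha
    obtain ⟨v, w, hvwY, hvwC, m, hm, st, h⟩ := exists_traceRun hX hY hC hmaj
    have h0 := h.zero
    refine ⟨m, st, hk ▸ hm, by rw [h0]; exact h, by rw [h0], ?_, by rw [h0]; exact hvwC⟩
    rw [h0]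
    exact insert_erase hvwY
  rcases S.eq_empty_or_nonempty with hemp | ⟨a₀, ha₀⟩
  · rw [hemp, sum_empty]
    have := swapEnergy_nonneg (G := G) k f
    positivity
  have : Nonempty (ℕ → TraceState V) := by
    obtain ⟨m, st, -⟩ := hrun a₀ ha₀
    exact ⟨st⟩
  choose! m st hm hrun hM hF hC using hrun
  -- the sum of the costs of all states, as tuples
  set T := matchingsOfCard G k ×ˢ matchingsOfCard G j ×ˢ
    (univ.filter fun q : V × V => G.Adj q.1 q.2) with hT
  have hTsum : ∑ t ∈ T, traceCost G k f t.1 s(t.2.2.1, t.2.2.2) ≤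
      (matchingsOfCard G j).card * (4 * swapEnergy G k f) := by
    rw [hT, sum_product]
    simp only [sum_product, sum_const, nsmul_eq_mul]
    rw [← mul_sum]
    refine mul_le_mul_of_nonneg_left ?_ (Nat.cast_nonneg _)
    calc ∑ M ∈ matchingsOfCard G k, ∑ q : V × V with G.Adj q.1 q.2, traceCost G k f M s(q.1, q.2)
        ≤ ∑ M ∈ matchingsOfCard G k, 2 * ∑ e ∈ G.edgeFinset, traceCost G k f M e :=
          sum_le_sum fun M _ => sum_adj_le _ fun e => traceCost_nonneg k f M e
      _ ≤ 4 * swapEnergy G k f := by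
          rw [← mul_sum]
          linarith [sum_traceCost_le (G := G) k f]
  have hvisit : ∀ i, ∑ a ∈ S with i ≤ m a,
      traceCost G k f (st a i).M s((st a i).v, (st a i).w) ≤
      (matchingsOfCard G j).card * (4 * swapEnergy G k f) := by
    intro i
    refine le_trans ?_ hTsum
    refine sum_le_sum_of_injOn (fun a => ((st a i).M, (st a i).F, ((st a i).v, (st a i).w)))
      ?_ ?_ (fun _ _ => le_rfl) (fun _ _ => traceCost_nonneg _ _ _ _)
    · intro a ha
      rw [mem_filter] at ha
      have haS := ha.1
      rw [hS, mem_sigma, mem_sigma] at haS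
      have hval := (hrun a ha.1).valid i ha.2
      have hcM := (hrun a ha.1).card_M i ha.2
      have hcF := (hrun a ha.1).card_F i ha.2
      rw [(mem_matchingsOfCard.1 haS.1).2] at hcM
      rw [(mem_matchingsOfCard.1 haS.2.1).2] at hcF
      simp only [hT, mem_product, mem_filter, mem_univ, true_and, mem_matchingsOfCard]
      exact ⟨⟨hval.matchingM, hcM⟩, ⟨hval.matchingF, by omega⟩, hval.adj⟩
    · rintro a ha b hb heq
      rw [mem_coe, mem_filter] at ha hb
      simp only [Prod.mk.injEq] at heq
      have hst : st a i = st b i := TraceState.ext heq.1 heq.2.1 heq.2.2.1 heq.2.2.2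
      have h0 := (hrun a ha.1).start_eq (hrun b hb.1) i ha.2 hb.2 hst
      have e1 : a.1 = b.1 := by rw [← hM a ha.1, h0, hM b hb.1]
      have e2 : a.2.1 = b.2.1 := by rw [← hF a ha.1, h0, hF b hb.1]
      have e3 : a.2.2 = b.2.2 := by
        have haS := ha.1
        have hbS := hb.1
        rw [hS, mem_sigma, mem_sigma, mem_filter] at haS hbS
        have hCb := hbS.2.2.1
        rw [← e1, ← e2] at hCb
        have hmem := hC a ha.1
        rw [h0] at hmem
        exact eq_of_mem_components haS.2.2.1 hCb hmem (hC b hb.1)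
      obtain ⟨X, Y, C⟩ := a
      obtain ⟨X', Y', C'⟩ := b
      dsimp only at e1 e2 e3
      rw [e1, e2, e3]
  calc ∑ a ∈ S, (f a.1 - upAverage f (a.1 ∆ a.2.2)) ^ 2
      ≤ ∑ a ∈ S, ((k : ℝ) + 1) * ∑ i ∈ range (k + 1), (if i ≤ m a then
          traceCost G k f (st a i).M s((st a i).v, (st a i).w) else 0) := by
        refine sum_le_sum fun a ha => ?_
        have haS := ha
        rw [hS, mem_sigma, mem_sigma, mem_filter] at haS
        have hXC := symmDiff_mem_matchingsOfCard_of_lt haS.1 (mem_matchingsOfCard.1 haS.2.1).1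
          haS.2.2.1 haS.2.2.2
        refine ((hrun a ha).sq_sub_le (mem_matchingsOfCard.1 haS.1).2 (hM a ha) hXC f).trans ?_
        have hmk : (m a : ℝ) ≤ k := by exact_mod_cast hm a ha
        refine mul_le_mul (by linarith) ?_
          (sum_nonneg fun _ _ => traceCost_nonneg _ _ _ _) (by positivity)
        rw [← sum_filter]
        refine sum_le_sum_of_subset_of_nonneg ?_ fun _ _ _ => traceCost_nonneg _ _ _ _
        intro i hi
        rw [mem_range] at hi
        rw [mem_filter, mem_range]
        have := hm a ha
        omega
    _ = (k + 1) * ∑ i ∈ range (k + 1), ∑ a ∈ S with i ≤ m a,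
          traceCost G k f (st a i).M s((st a i).v, (st a i).w) := by
        rw [← mul_sum, sum_comm]
        simp only [sum_filter]
    _ ≤ (k + 1) * ∑ i ∈ range (k + 1), (matchingsOfCard G j).card * (4 * swapEnergy G k f) :=
        mul_le_mul_of_nonneg_left (sum_le_sum fun i _ => hvisit i) (by positivity)
    _ = 4 * (k + 1) ^ 2 * (matchingsOfCard G j).card * swapEnergy G k f := by
        rw [sum_const, card_range, nsmul_eq_mul]
        push_cast
        ring

/-- Exchanging one balanced component of a pair in the upper layer: remove an edge, then transform
the remaining alternating path. -/
theorem sum_flip_even_le (j : ℕ) (f : Finset (Sym2 V) → ℝ) :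
    ∑ X ∈ matchingsOfCard G (j + 2), ∑ Y ∈ matchingsOfCard G (j + 1),
      ∑ C ∈ components (X ∆ Y) with (X ∩ C).card = (Y ∩ C).card,
        (upAverage f X - upAverage f (X ∆ C)) ^ 2 ≤
      2 * (matchingsOfCard G (j + 1)).card * swapEnergy G (j + 1) f +
        2 * (G.edgeFinset.card * (4 * (j + 2) ^ 2 * (matchingsOfCard G j).card *
          swapEnergy G (j + 1) f)) := by
  have hodd := sum_flip_odd_le (G := G) (j + 1) j f
  have hup : ∑ Y ∈ matchingsOfCard G (j + 1), ∑ X ∈ matchingsOfCard G (j + 2),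
      ∑ e ∈ X, (upAverage f X - f (X.erase e)) ^ 2 ≤
      (matchingsOfCard G (j + 1)).card * swapEnergy G (j + 1) f := by
    rw [sum_const, nsmul_eq_mul]
    exact mul_le_mul_of_nonneg_left (sum_upAverage_sq_le (j + 1) f) (Nat.cast_nonneg _)
  simp only [sum_sigma'] at hodd hup ⊢
  set S := (matchingsOfCard G (j + 2)).sigma fun X => (matchingsOfCard G (j + 1)).sigma fun Y =>
    (components (X ∆ Y)).filter fun C => (X ∩ C).card = (Y ∩ C).card with hS
  have hex : ∀ a ∈ S, ∃ x, x ∈ a.1 ∧ x ∈ a.2.2 ∧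
      a.2.2.erase x ∈ components ((a.1.erase x) ∆ a.2.1) ∧
      ((a.1.erase x) ∩ a.2.2.erase x).card < (a.2.1 ∩ a.2.2.erase x).card ∧
      (a.1.erase x) ∆ (a.2.2.erase x) = a.1 ∆ a.2.2 := by
    rintro ⟨X, Y, C⟩ ha
    simp only [hS, mem_sigma, mem_filter, mem_matchingsOfCard] at ha
    exact exists_erase_mem_components ha.1.1 ha.2.1.1 ha.2.2.1 ha.2.2.2
  rcases S.eq_empty_or_nonempty with hemp | ⟨a₀, ha₀⟩
  · rw [hemp, sum_empty]
    have := swapEnergy_nonneg (G := G) (j + 1) f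
    positivity
  have : Nonempty (Sym2 V) := by
    obtain ⟨x, -⟩ := hex a₀ ha₀
    exact ⟨x⟩
  choose! x hxX hxC hcomp hlt hsd using hex
  have h1 : ∑ a ∈ S, (upAverage f a.1 - f (a.1.erase (x a))) ^ 2 ≤
      (matchingsOfCard G (j + 1)).card * swapEnergy G (j + 1) f := by
    refine le_trans ?_ hup
    refine sum_le_sum_of_injOn (fun a => ⟨a.2.1, a.1, x a⟩) ?_ ?_ ?_ ?_
    · intro a ha
      have haS := ha
      rw [hS, mem_sigma, mem_sigma] at haS
      simp only [mem_sigma]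
      exact ⟨haS.2.1, haS.1, hxX a ha⟩
    · intro a ha b hb heq
      rw [mem_coe] at ha hb
      simp only [Sigma.mk.injEq, heq_eq_eq] at heq
      obtain ⟨e2, e1, ex⟩ := heq
      have e3 : a.2.2 = b.2.2 := by
        have haS := ha
        have hbS := hb
        rw [hS, mem_sigma, mem_sigma, mem_filter] at haS hbS
        have hCb := hbS.2.2.1
        rw [← e1, ← e2] at hCb
        exact eq_of_mem_components haS.2.2.1 hCb (hxC a ha) (ex ▸ hxC b hb)
      obtain ⟨X, Y, C⟩ := a
      obtain ⟨X', Y', C'⟩ := b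
      dsimp only at e1 e2 e3
      rw [e1, e2, e3]
    · intro a _
      exact le_refl ((upAverage f a.1 - f (a.1.erase (x a))) ^ 2)
    · intro b _
      exact sq_nonneg _
  have h2 : ∑ a ∈ S, (f (a.1.erase (x a)) - upAverage f (a.1 ∆ a.2.2)) ^ 2 ≤
      G.edgeFinset.card * (4 * (j + 2) ^ 2 * (matchingsOfCard G j).card *
          swapEnergy G (j + 1) f) := by
    have e : (4 : ℝ) * (j + 2) ^ 2 = 4 * (((j + 1 : ℕ) : ℝ) + 1) ^ 2 := by
      push_cast
      ring
    rw [e]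
    have hodd' := mul_le_mul_of_nonneg_left hodd (Nat.cast_nonneg (α := ℝ) G.edgeFinset.card)
    refine le_trans ?_ hodd'
    rw [← nsmul_eq_mul, ← sum_const, ← sum_product']
    refine sum_le_sum_of_injOn (fun a => (x a, ⟨a.1.erase (x a), a.2.1, a.2.2.erase (x a)⟩))
      ?_ ?_ ?_ (fun _ _ => sq_nonneg _)
    · intro a ha
      have haS := ha
      rw [hS, mem_sigma, mem_sigma] at haS
      simp only [mem_product, mem_sigma, mem_filter]
      refine ⟨?_, erase_mem_matchingsOfCard haS.1 (hxX a ha), haS.2.1, hcomp a ha, hlt a ha⟩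
      simpa using (mem_matchingsOfCard.1 haS.1).1.1 _ (hxX a ha)
    · intro a ha b hb heq
      rw [mem_coe] at ha hb
      simp only [Prod.mk.injEq, Sigma.mk.injEq, heq_eq_eq] at heq
      obtain ⟨ex, e1, e2, e3⟩ := heq
      have e1' : a.1 = b.1 := by
        rw [← insert_erase (hxX a ha), e1, ex, insert_erase (hxX b hb)]
      have e3' : a.2.2 = b.2.2 := by
        rw [← insert_erase (hxC a ha), e3, ex, insert_erase (hxC b hb)]
      obtain ⟨X, Y, C⟩ := a
      obtain ⟨X', Y', C'⟩ := b
      dsimp only at e1' e2 e3'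
      rw [e1', e2, e3']
    · intro a ha
      dsimp only
      rw [hsd a ha]
  calc ∑ a ∈ S, (upAverage f a.1 - upAverage f (a.1 ∆ a.2.2)) ^ 2
      ≤ ∑ a ∈ S, (2 * (upAverage f a.1 - f (a.1.erase (x a))) ^ 2 +
          2 * (f (a.1.erase (x a)) - upAverage f (a.1 ∆ a.2.2)) ^ 2) := by
        refine sum_le_sum fun a _ => ?_
        nlinarith [sq_nonneg (upAverage f a.1 - 2 * f (a.1.erase (x a)) +
          upAverage f (a.1 ∆ a.2.2))]
    _ ≤ _ := by
        rw [sum_add_distrib, ← mul_sum, ← mul_sum]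
        linarith

/-- Comparison of `k`-matchings with `(k+1)`-matchings, for `k = j + 1`. -/
theorem sum_pairs_upAverage_le (j : ℕ) (f : Finset (Sym2 V) → ℝ) :
    ∑ X ∈ matchingsOfCard G (j + 1), ∑ Y ∈ matchingsOfCard G (j + 2),
      (f X - upAverage f Y) ^ 2 ≤
      2 * (2 * j + 3) * (4 * (j + 2) ^ 2 * (matchingsOfCard G (j + 1)).card +
        2 * (matchingsOfCard G (j + 1)).card +
        8 * G.edgeFinset.card * (j + 2) ^ 2 * (matchingsOfCard G j).card) *
        swapEnergy G (j + 1) f := by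
  set g : Finset (Sym2 V) → ℝ := fun M => if M.card = j + 1 then f M else upAverage f M with hg
  have hgf : ∀ M ∈ matchingsOfCard G (j + 1), g M = f M := fun M hM =>
    if_pos (mem_matchingsOfCard.1 hM).2
  have hgu : ∀ M ∈ matchingsOfCard G (j + 2), g M = upAverage f M := fun M hM =>
    if_neg (by rw [(mem_matchingsOfCard.1 hM).2]; omega)
  have h := sum_pairs_sq_sub_le (G := G) (j + 1) g
  have e0 : ∑ X ∈ matchingsOfCard G (j + 1), ∑ Y ∈ matchingsOfCard G (j + 2),
      (g X - g Y) ^ 2 = ∑ X ∈ matchingsOfCard G (j + 1), ∑ Y ∈ matchingsOfCard G (j + 2),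
      (f X - upAverage f Y) ^ 2 :=
    sum_congr rfl fun X hX => sum_congr rfl fun Y hY => by rw [hgf X hX, hgu Y hY]
  have e1 : ∑ X ∈ matchingsOfCard G (j + 1), ∑ Y ∈ matchingsOfCard G (j + 2),
      ∑ C ∈ components (X ∆ Y) with (X ∩ C).card < (Y ∩ C).card, (g X - g (X ∆ C)) ^ 2 =
      ∑ X ∈ matchingsOfCard G (j + 1), ∑ Y ∈ matchingsOfCard G (j + 2),
      ∑ C ∈ components (X ∆ Y) with (X ∩ C).card < (Y ∩ C).card,
        (f X - upAverage f (X ∆ C)) ^ 2 := by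
    refine sum_congr rfl fun X hX => sum_congr rfl fun Y hY => sum_congr rfl fun C hC => ?_
    rw [mem_filter] at hC
    rw [hgf X hX, hgu _ (symmDiff_mem_matchingsOfCard_of_lt hX (mem_matchingsOfCard.1 hY).1
      hC.1 hC.2)]
  have e2 : ∑ X ∈ matchingsOfCard G (j + 2), ∑ Y ∈ matchingsOfCard G (j + 1),
      ∑ C ∈ components (X ∆ Y) with (X ∩ C).card = (Y ∩ C).card, (g X - g (X ∆ C)) ^ 2 =
      ∑ X ∈ matchingsOfCard G (j + 2), ∑ Y ∈ matchingsOfCard G (j + 1),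
      ∑ C ∈ components (X ∆ Y) with (X ∩ C).card = (Y ∩ C).card,
        (upAverage f X - upAverage f (X ∆ C)) ^ 2 := by
    refine sum_congr rfl fun X hX => sum_congr rfl fun Y hY => sum_congr rfl fun C hC => ?_
    rw [mem_filter] at hC
    rw [hgu X hX, hgu _ (symmDiff_mem_matchingsOfCard_of_eq hX (mem_matchingsOfCard.1 hY).1
      hC.1 hC.2)]
  have hodd := sum_flip_odd_le (G := G) (j + 1) (j + 1) f
  have heven := sum_flip_even_le (G := G) j f
  rw [show j + 1 + 1 = j + 2 from rfl] at h hodd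
  rw [e0, e1, e2] at h
  push_cast at h hodd
  refine h.trans ?_
  have hj : (0 : ℝ) ≤ 2 * (2 * (j + 1) + 1) := by positivity
  refine (mul_le_mul_of_nonneg_left (add_le_add hodd heven) hj).trans (le_of_eq ?_)
  ring

end Congestion

/-! ### Ratios of numbers of matchings and the Poincaré inequality -/

section Ratios

variable {V : Type*} [Fintype V] {G : SimpleGraph V}

theorem exists_matching_card_eq (G : SimpleGraph V) :
    ∃ M, IsMatching G M ∧ M.card = matchingNumber G := by
  have hne : (univ.filter fun M : Finset (Sym2 V) => IsMatching G M).Nonempty :=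
    ⟨∅, mem_filter.2 ⟨mem_univ _, by simp [IsMatching]⟩⟩
  obtain ⟨M, hM, hcard⟩ := exists_mem_eq_sup _ hne Finset.card
  refine ⟨M, (mem_filter.1 hM).2, ?_⟩
  rw [← hcard, matchingNumber]

theorem IsMatching.card_le_matchingNumber {M : Finset (Sym2 V)} (hM : IsMatching G M) :
    M.card ≤ matchingNumber G :=
  le_sup (f := Finset.card) (mem_filter.2 ⟨mem_univ _, hM⟩)

theorem two_mul_matchingNumber_le (G : SimpleGraph V) :
    2 * matchingNumber G ≤ Fintype.card V := by
  obtain ⟨M, hM, hcard⟩ := exists_matching_card_eq G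
  rw [← hcard, ← hM.card_covered]
  exact card_le_univ _

theorem card_matchingsOfCard_pos {a : ℕ} (ha : a ≤ matchingNumber G) :
    0 < (matchingsOfCard G a).card := by
  obtain ⟨M, hM, hcard⟩ := exists_matching_card_eq G
  obtain ⟨N, hNM, hN⟩ := exists_subset_card_eq (hcard ▸ ha)
  exact card_pos.2 ⟨N, mem_matchingsOfCard.2 ⟨hM.subset hNM, hN⟩⟩

theorem card_matchingsOfCard_le_choose (k : ℕ) :
    (matchingsOfCard G k).card ≤ G.edgeFinset.card.choose k := by
  rw [← card_powersetCard]
  refine card_le_card fun M hM => ?_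
  rw [mem_matchingsOfCard] at hM
  refine mem_powersetCard.2 ⟨fun e he => ?_, hM.2⟩
  simpa using hM.1.1 e he

theorem card_matchingsOfCard_le_two_pow (k : ℕ) :
    (matchingsOfCard G k).card ≤ 2 ^ G.edgeFinset.card :=
  (card_matchingsOfCard_le_choose k).trans (Nat.choose_le_two_pow _ _)

theorem card_matchingsOfCard_le_pow (k : ℕ) :
    (matchingsOfCard G k).card ≤ Fintype.card V ^ (2 * k) := by
  refine (card_matchingsOfCard_le_choose k).trans ((Nat.choose_le_pow _ _).trans ?_)
  rw [pow_mul]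
  refine Nat.pow_le_pow_left ?_ k
  refine le_trans ?_ (Nat.choose_le_pow (Fintype.card V) 2)
  convert G.card_edgeFinset_le_card_choose_two

/-- By log-concavity, the ratio of consecutive terms only gets larger, so its powers are bounded by
the number of matchings. -/
theorem ratio_pow_le {k : ℕ} (hk : k < matchingNumber G) :
    (((matchingsOfCard G k).card : ℝ) / (matchingsOfCard G (k + 1)).card) ^
      (matchingNumber G - k) ≤ (matchingsOfCard G k).card := by
  set N : ℕ → ℝ := fun a => ((matchingsOfCard G a).card : ℝ) with hN
  have hpos : ∀ a ≤ matchingNumber G, 0 < N a := fun a ha =>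
    Nat.cast_pos.2 (card_matchingsOfCard_pos ha)
  set r : ℝ := N k / N (k + 1) with hr
  have hr0 : 0 ≤ r := div_nonneg (Nat.cast_nonneg _) (Nat.cast_nonneg _)
  have hA : ∀ i, k + i + 1 ≤ matchingNumber G → r * N (k + i + 1) ≤ N (k + i) := by
    intro i
    induction i with
    | zero =>
      intro h
      have := hpos (k + 1) (by omega)
      rw [hr, add_zero, div_mul_cancel₀ _ this.ne']
    | succ i ih =>
      intro h
      have h1 := ih (by omega)
      have h2 : N (k + i) * N (k + i + 2) ≤ N (k + i + 1) ^ 2 :=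
        card_matchingsOfCard_log_concave (k + i)
      have h3 := hpos (k + i + 1) (by omega)
      have h4 := hpos (k + i + 2) (by omega)
      have h5 : N (k + i + 1) * (r * N (k + i + 2)) ≤ N (k + i + 1) * N (k + i + 1) := by
        nlinarith
      exact le_of_mul_le_mul_left h5 h3
  have hB : ∀ i, k + i ≤ matchingNumber G → r ^ i * N (k + i) ≤ N k := by
    intro i
    induction i with
    | zero => intro _; simp
    | succ i ih =>
      intro h
      calc r ^ (i + 1) * N (k + (i + 1)) = r ^ i * (r * N (k + i + 1)) := by
            rw [pow_succ, mul_assoc, add_assoc]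
        _ ≤ r ^ i * N (k + i) := mul_le_mul_of_nonneg_left (hA i h) (pow_nonneg hr0 i)
        _ ≤ N k := ih (by omega)
  have h := hB (matchingNumber G - k) (by omega)
  have h1 : (1 : ℝ) ≤ N (k + (matchingNumber G - k)) := by
    have := card_matchingsOfCard_pos (G := G) (a := k + (matchingNumber G - k)) (by omega)
    exact Nat.one_le_cast.2 this
  exact le_trans (le_mul_of_one_le_right (pow_nonneg hr0 _) h1) h

theorem card_matchingsOfCard_le_mul_succ {k : ℕ} {R : ℝ}
    (h : ((matchingsOfCard G (k + 1)).card : ℝ) ≤ R * (matchingsOfCard G (k + 2)).card)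
    (hpos : 0 < (matchingsOfCard G (k + 2)).card) :
    ((matchingsOfCard G k).card : ℝ) ≤ R * (matchingsOfCard G (k + 1)).card := by
  have h1 := card_matchingsOfCard_log_concave (G := G) k
  have h2 : (0 : ℝ) < (matchingsOfCard G (k + 2)).card := Nat.cast_pos.2 hpos
  refine le_of_mul_le_mul_right ?_ h2
  calc _ ≤ ((matchingsOfCard G (k + 1)).card : ℝ) ^ 2 := h1
    _ ≤ (matchingsOfCard G (k + 1)).card * (R * (matchingsOfCard G (k + 2)).card) := by
      rw [sq]
      exact mul_le_mul_of_nonneg_left h (Nat.cast_nonneg _)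
    _ = _ := by ring

theorem lt_matchingNumber_of_le {k : ℕ} {δ : ℝ} (hδ : 0 < δ) (hδ1 : δ < 1) (hk : 1 ≤ k)
    (h : (k : ℝ) ≤ (1 - δ) * matchingNumber G) : k < matchingNumber G := by
  have h1 : (1 : ℝ) ≤ k := by exact_mod_cast hk
  have h2 : (0 : ℝ) < matchingNumber G := by
    by_contra hneg
    nlinarith [mul_nonneg (sub_nonneg.2 hδ1.le) (sub_nonneg.2 (not_lt.1 hneg))]
  have : (k : ℝ) < matchingNumber G := by nlinarith
  exact_mod_cast this

/-- If `r ^ (m* - k)` is at most `B ^ p`, then `r` is at most `B ^ q` as soon as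
`p ≤ q (m* - k)`. -/
theorem le_rpow_of_pow_le {r B p q : ℝ} {d : ℕ} (hd : 0 < d) (hB : 1 ≤ B)
    (h : r ^ d ≤ B ^ p) (hpq : p ≤ q * d) : r ≤ B ^ q := by
  refine le_of_pow_le_pow_left₀ hd.ne' (by positivity) (h.trans ?_)
  rw [← Real.rpow_natCast (B ^ q), ← Real.rpow_mul (by linarith)]
  exact Real.rpow_le_rpow_of_exponent_le hB hpq

theorem card_le_rpow_mul_card_succ {k : ℕ} {δ : ℝ} (hδ : 0 < δ) (hδ1 : δ < 1) (hk : 1 ≤ k)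
    (h : (k : ℝ) ≤ (1 - δ) * matchingNumber G) :
    ((matchingsOfCard G k).card : ℝ) ≤
      (Fintype.card V : ℝ) ^ (2 / δ - 2) * (matchingsOfCard G (k + 1)).card := by
  have hlt := lt_matchingNumber_of_le hδ hδ1 hk h
  have hpos : (0 : ℝ) < (matchingsOfCard G (k + 1)).card :=
    Nat.cast_pos.2 (card_matchingsOfCard_pos hlt)
  have hn : (1 : ℝ) ≤ Fintype.card V := by
    have := two_mul_matchingNumber_le G
    exact_mod_cast (by omega : 1 ≤ Fintype.card V)
  rw [← div_le_iff₀ hpos]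
  refine le_rpow_of_pow_le (p := (2 * k : ℕ)) (Nat.sub_pos_of_lt hlt) hn
    ((ratio_pow_le hlt).trans ?_) ?_
  · rw [Real.rpow_natCast]
    exact_mod_cast card_matchingsOfCard_le_pow k
  · rw [Nat.cast_sub hlt.le]
    push_cast
    have : (2 / δ - 2) * ((matchingNumber G : ℝ) - k) - 2 * k =
        2 / δ * ((1 - δ) * matchingNumber G - k) := by
      field_simp
      ring
    have h2 : 0 ≤ 2 / δ * ((1 - δ) * matchingNumber G - k) :=
      mul_nonneg (by positivity) (by linarith)
    linarith

/-- The vertices of a maximum matching cover all edges. -/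
theorem card_edgeFinset_le_of_degree_le {Δ : ℕ} (hΔ : ∀ v, G.degree v ≤ Δ) :
    G.edgeFinset.card ≤ 2 * Δ * matchingNumber G := by
  obtain ⟨M, hM, hcard⟩ := exists_matching_card_eq G
  have hsub : G.edgeFinset ⊆ (covered M).biUnion fun v => G.incidenceFinset v := by
    intro e he
    rw [SimpleGraph.mem_edgeFinset] at he
    by_contra hne
    have hfree : ∀ v ∈ e, ∀ f ∈ M, v ∉ f := by
      intro v hv f hf hvf
      refine hne (mem_biUnion.2 ⟨v, mem_covered.2 ⟨f, hf, hvf⟩, ?_⟩)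
      rw [SimpleGraph.mem_incidenceFinset]
      exact ⟨he, hv⟩
    induction e using Sym2.ind with
    | _ a b =>
    have hmem : s(a, b) ∉ M := fun h => hfree a (by simp) _ h (by simp)
    have hins := hM.insert_mk (v := a) (w := b) (by simpa using he) (hfree a (by simp))
      (hfree b (by simp))
    have h := hins.card_le_matchingNumber
    rw [card_insert_of_notMem hmem] at h
    omega
  calc G.edgeFinset.card ≤ _ := card_le_card hsub
    _ ≤ (covered M).card * Δ := by
      refine card_biUnion_le_card_mul _ _ _ fun v _ => ?_
      rw [SimpleGraph.card_incidenceFinset_eq_degree]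
      exact hΔ v
    _ = 2 * Δ * matchingNumber G := by
      rw [hM.card_covered, hcard]
      ring

theorem card_le_two_rpow_mul_card_succ {k Δ : ℕ} {δ : ℝ} (hδ : 0 < δ) (hδ1 : δ < 1) (hk : 1 ≤ k)
    (h : (k : ℝ) ≤ (1 - δ) * matchingNumber G) (hΔ : ∀ v, G.degree v ≤ Δ) :
    ((matchingsOfCard G k).card : ℝ) ≤
      (2 : ℝ) ^ (2 * Δ / δ) * (matchingsOfCard G (k + 1)).card := by
  have hlt := lt_matchingNumber_of_le hδ hδ1 hk h
  have hpos : (0 : ℝ) < (matchingsOfCard G (k + 1)).card :=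
    Nat.cast_pos.2 (card_matchingsOfCard_pos hlt)
  rw [← div_le_iff₀ hpos]
  refine le_rpow_of_pow_le (p := (G.edgeFinset.card : ℕ)) (Nat.sub_pos_of_lt hlt)
    one_le_two ((ratio_pow_le hlt).trans ?_) ?_
  · rw [Real.rpow_natCast]
    exact_mod_cast card_matchingsOfCard_le_two_pow k
  · rw [Nat.cast_sub hlt.le]
    have h1 : (G.edgeFinset.card : ℝ) ≤ 2 * Δ * matchingNumber G := by
      exact_mod_cast card_edgeFinset_le_of_degree_le hΔ
    refine h1.trans ?_
    have : 2 * Δ / δ * ((matchingNumber G : ℝ) - k) - 2 * Δ * matchingNumber G =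
        2 * Δ / δ * ((1 - δ) * matchingNumber G - k) := by
      field_simp
      ring
    have h2 : 0 ≤ 2 * Δ / δ * ((1 - δ) * matchingNumber G - k) :=
      mul_nonneg (by positivity) (by linarith)
    linarith

theorem card_edgeFinset_le_mul_card {Δ : ℕ} (hΔ : ∀ v, G.degree v ≤ Δ) :
    G.edgeFinset.card ≤ Δ * Fintype.card V := by
  have h1 := card_edgeFinset_le_of_degree_le hΔ
  have h2 := Nat.mul_le_mul_left Δ (two_mul_matchingNumber_le G)
  calc _ ≤ _ := h1
    _ = Δ * (2 * matchingNumber G) := by ring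
    _ ≤ _ := h2

/-- A Poincaré inequality for the `k`-matchings. -/
theorem sum_sq_le_swapEnergy {k : ℕ} (hk : 1 ≤ k) (hlt : k < matchingNumber G) {R : ℝ}
    (hR : 1 ≤ R)
    (h : ((matchingsOfCard G k).card : ℝ) ≤ R * (matchingsOfCard G (k + 1)).card)
    (f : Finset (Sym2 V) → ℝ) (hf : ∑ M ∈ matchingsOfCard G k, f M = 0) :
    ∑ M ∈ matchingsOfCard G k, f M ^ 2 ≤
      300 * k ^ 3 * G.edgeFinset.card * R ^ 2 * swapEnergy G k f := by
  obtain ⟨j, rfl⟩ : ∃ j, k = j + 1 := ⟨k - 1, by omega⟩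
  have hpos : 0 < (matchingsOfCard G (j + 2)).card := card_matchingsOfCard_pos hlt
  have hpos' : (0 : ℝ) < (matchingsOfCard G (j + 2)).card := Nat.cast_pos.2 hpos
  have h' := card_matchingsOfCard_le_mul_succ h hpos
  have hm : (1 : ℝ) ≤ G.edgeFinset.card := by
    obtain ⟨M, hM⟩ := card_pos.1 hpos
    rw [mem_matchingsOfCard] at hM
    have h1 : M ⊆ G.edgeFinset := fun e he => by simpa using hM.1.1 e he
    have h2 := card_le_card h1
    exact_mod_cast (by omega : 1 ≤ G.edgeFinset.card)
  have hmain := sum_pairs_upAverage_le (G := G) j f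
  have hE := swapEnergy_nonneg (G := G) (j + 1) f
  set N₀ : ℝ := ((matchingsOfCard G j).card : ℝ)
  set N₁ : ℝ := ((matchingsOfCard G (j + 1)).card : ℝ)
  set N₂ : ℝ := ((matchingsOfCard G (j + 1 + 1)).card : ℝ) with hN₂
  set m : ℝ := (G.edgeFinset.card : ℝ)
  set E := swapEnergy G (j + 1) f
  have hlow : N₂ * ∑ M ∈ matchingsOfCard G (j + 1), f M ^ 2 ≤
      ∑ X ∈ matchingsOfCard G (j + 1), ∑ Y ∈ matchingsOfCard G (j + 2),
        (f X - upAverage f Y) ^ 2 := by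
    rw [sum_comm, hN₂, ← nsmul_eq_mul, ← sum_const]
    refine sum_le_sum fun Y _ => ?_
    have : ∑ X ∈ matchingsOfCard G (j + 1), (f X - upAverage f Y) ^ 2 =
        ∑ X ∈ matchingsOfCard G (j + 1), f X ^ 2 -
          2 * upAverage f Y * ∑ X ∈ matchingsOfCard G (j + 1), f X +
          ∑ X ∈ matchingsOfCard G (j + 1), upAverage f Y ^ 2 := by
      rw [mul_sum, ← sum_sub_distrib, ← sum_add_distrib]
      exact sum_congr rfl fun X _ => by ring
    rw [this, hf]
    have : 0 ≤ ∑ X ∈ matchingsOfCard G (j + 1), upAverage f Y ^ 2 :=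
      sum_nonneg fun _ _ => sq_nonneg _
    linarith
  refine le_of_mul_le_mul_left ?_ hpos'
  refine hlow.trans (hmain.trans ?_)
  set K : ℝ := ((j + 1 : ℕ) : ℝ) with hK
  have hj : (j : ℝ) = K - 1 := by rw [hK]; push_cast; ring
  have hK1 : 1 ≤ K := by rw [hK]; push_cast; linarith [Nat.cast_nonneg (α := ℝ) j]
  have hR2 : R * N₂ ≤ R ^ 2 * N₂ := by nlinarith [mul_nonneg (by linarith : 0 ≤ R) hpos'.le]
  have hN₁ : N₁ ≤ R ^ 2 * N₂ := h.trans hR2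
  have hN₀ : N₀ ≤ R ^ 2 * N₂ := by
    refine h'.trans ?_
    have := mul_le_mul_of_nonneg_left h (by linarith : 0 ≤ R)
    calc _ ≤ _ := this
      _ = _ := by ring
  set Q : ℝ := R ^ 2 * N₂ with hQ
  have hQ0 : 0 ≤ Q := by positivity
  have hb1 : 2 * (2 * (j : ℝ) + 3) ≤ 6 * K := by rw [hj]; linarith
  have hb2 : ((j : ℝ) + 2) ^ 2 ≤ 4 * K ^ 2 := by rw [hj]; nlinarith
  have hj0 : (0 : ℝ) ≤ j := Nat.cast_nonneg _
  have hN₀0 : 0 ≤ N₀ := Nat.cast_nonneg _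
  have hN₁0 : 0 ≤ N₁ := Nat.cast_nonneg _
  have hKm : 1 ≤ m * K ^ 2 := by nlinarith
  have hb3 : 4 * ((j : ℝ) + 2) ^ 2 * N₁ + 2 * N₁ + 8 * m * (j + 2) ^ 2 * N₀ ≤
      50 * (m * K ^ 2) * Q := by
    have t1 : 4 * ((j : ℝ) + 2) ^ 2 * N₁ ≤ 4 * (4 * K ^ 2) * Q := by gcongr
    have t2 : 8 * m * ((j : ℝ) + 2) ^ 2 * N₀ ≤ 8 * m * (4 * K ^ 2) * Q := by gcongr
    have t3 : 4 * (4 * K ^ 2) * Q ≤ 16 * (m * K ^ 2) * Q := by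
      have : K ^ 2 * Q ≤ m * (K ^ 2 * Q) := le_mul_of_one_le_left (by positivity) hm
      linarith
    have t4 : 2 * N₁ ≤ 2 * (m * K ^ 2) * Q := by nlinarith
    linarith
  calc _ ≤ 6 * K * (50 * (m * K ^ 2) * Q) * E := by gcongr
    _ = _ := by rw [hQ]; ring

end Ratios

/-! ### Mixing of symmetric chains and the down-up walk -/

section Mixing

variable {Ω : Type*} [Fintype Ω]

/-- `‖g‖² - ‖P g‖²` is the Dirichlet form of `P²`, which dominates that of `P` because of the
holding probability. -/
theorem sum_sq_mulVec_le {P : Matrix Ω Ω ℝ} {α : ℝ} (hnn : ∀ x y, 0 ≤ P x y)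
    (hsymm : ∀ x y, P x y = P y x) (hrow : ∀ x, ∑ y, P x y = 1) (hα : ∀ x, α ≤ P x x)
    (g : Ω → ℝ) :
    ∑ x, (∑ y, P x y * g y) ^ 2 + α * ∑ x, ∑ y, P x y * (g x - g y) ^ 2 ≤ ∑ x, g x ^ 2 := by
  have hpw : ∀ w, (∑ y, P w y * g y) ^ 2 +
      (1 / 2) * ∑ x, ∑ y, P w x * P w y * (g x - g y) ^ 2 = ∑ y, P w y * g y ^ 2 := by
    intro w
    have h1 : ∑ x, ∑ y, P w x * P w y * (g x - g y) ^ 2 =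
        2 * ((∑ x, P w x) * ∑ y, P w y * g y ^ 2) - 2 * (∑ y, P w y * g y) ^ 2 := by
      have e1 : (∑ y, P w y * g y) ^ 2 = ∑ x, ∑ y, (P w x * g x) * (P w y * g y) := by
        rw [sq, sum_mul_sum]
      have e2 : (∑ x, P w x) * ∑ y, P w y * g y ^ 2 =
          ∑ x, ∑ y, P w x * (P w y * g y ^ 2) := by rw [sum_mul_sum]
      have e3 : (∑ x, P w x) * ∑ y, P w y * g y ^ 2 =
          ∑ x, ∑ y, (P w x * g x ^ 2) * P w y := by
        rw [mul_comm, sum_mul_sum]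
      have e4 : 2 * ((∑ x, P w x) * ∑ y, P w y * g y ^ 2) =
          ∑ x, ∑ y, P w x * (P w y * g y ^ 2) + ∑ x, ∑ y, (P w x * g x ^ 2) * P w y := by
        rw [← e2, ← e3]; ring
      rw [e4, e1, mul_sum, ← sum_add_distrib, ← sum_sub_distrib]
      refine sum_congr rfl fun x _ => ?_
      rw [mul_sum, ← sum_add_distrib, ← sum_sub_distrib]
      exact sum_congr rfl fun y _ => by ring
    rw [h1, hrow]
    ring
  have hsum : ∑ w, ∑ y, P w y * g y ^ 2 = ∑ x, g x ^ 2 := by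
    rw [sum_comm]
    refine sum_congr rfl fun y _ => ?_
    rw [← sum_mul, sum_congr rfl fun w _ => hsymm w y, hrow, one_mul]
  rw [← hsum, ← sum_congr rfl fun w _ => hpw w, sum_add_distrib, ← mul_sum]
  have hkey : 2 * α * ∑ x, ∑ y, P x y * (g x - g y) ^ 2 ≤
      ∑ w, ∑ x, ∑ y, P w x * P w y * (g x - g y) ^ 2 := by
    have hswap : ∑ w, ∑ x, ∑ y, P w x * P w y * (g x - g y) ^ 2 =
        ∑ x, ∑ y, (∑ w, P w x * P w y) * (g x - g y) ^ 2 := by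
      rw [sum_comm]
      refine sum_congr rfl fun x _ => ?_
      rw [sum_comm]
      exact sum_congr rfl fun y _ => by rw [sum_mul]
    rw [hswap, mul_sum]
    refine sum_le_sum fun x _ => ?_
    rw [mul_sum]
    refine sum_le_sum fun y _ => ?_
    by_cases hxy : x = y
    · subst hxy; simp
    · rw [← mul_assoc]
      refine mul_le_mul_of_nonneg_right ?_ (sq_nonneg _)
      have h1 : ∑ w ∈ {x, y}, P w x * P w y ≤ ∑ w, P w x * P w y :=
        sum_le_sum_of_subset_of_nonneg (subset_univ _) fun w _ _ => mul_nonneg (hnn _ _) (hnn _ _)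
      rw [sum_pair hxy, hsymm y x] at h1
      have h2 := mul_le_mul_of_nonneg_right (hα x) (hnn x y)
      have h3 := mul_le_mul_of_nonneg_left (hα y) (hnn x y)
      linarith
  linarith

theorem sum_pow_apply_eq_one {P : Matrix Ω Ω ℝ} (hrow : ∀ x, ∑ y, P x y = 1) (t : ℕ) (x : Ω) :
    ∑ y, (P ^ t) x y = 1 := by
  induction t with
  | zero => simp [Matrix.one_apply]
  | succ t ih =>
    simp only [pow_succ, Matrix.mul_apply]
    rw [sum_comm]
    simp only [← mul_sum, hrow, mul_one]
    exact ih

/-- Convergence in mean square of a symmetric chain with holding probability, from a Poincaré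
inequality. -/
theorem sum_sq_pow_sub_le {P : Matrix Ω Ω ℝ} {α K : ℝ} (hnn : ∀ x y, 0 ≤ P x y)
    (hsymm : ∀ x y, P x y = P y x) (hrow : ∀ x, ∑ y, P x y = 1) (hα : ∀ x, α ≤ P x x)
    (hα0 : 0 ≤ α) (hK : 0 < K)
    (hpoin : ∀ g : Ω → ℝ, ∑ x, g x = 0 →
      ∑ x, g x ^ 2 ≤ K * ∑ x, ∑ y, P x y * (g x - g y) ^ 2) (x : Ω) (t : ℕ) :
    ∑ y, ((P ^ t) x y - uniformDist Ω y) ^ 2 ≤ Real.exp (-(α / K) * t) := by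
  have hN : (0 : ℝ) < Fintype.card Ω := Nat.cast_pos.2 (Fintype.card_pos_iff.2 ⟨x⟩)
  have hunif : ∑ y : Ω, uniformDist Ω y = 1 := by
    simp only [uniformDist, sum_const, card_univ, nsmul_eq_mul]
    field_simp
  have hmean : ∀ t, ∑ y, ((P ^ t) x y - uniformDist Ω y) = 0 := by
    intro t
    rw [sum_sub_distrib, sum_pow_apply_eq_one hrow, hunif, sub_self]
  induction t with
  | zero =>
    simp only [pow_zero, Nat.cast_zero, mul_zero, Real.exp_zero]
    have h1 : ∀ y, ((1 : Matrix Ω Ω ℝ) x y - uniformDist Ω y) ^ 2 =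
        (if x = y then 1 - 2 * (1 / (Fintype.card Ω : ℝ)) else 0) +
          (1 / (Fintype.card Ω : ℝ)) ^ 2 := by
      intro y
      rw [Matrix.one_apply, uniformDist]
      split_ifs <;> ring
    rw [sum_congr rfl fun y _ => h1 y, sum_add_distrib, sum_ite_eq, if_pos (mem_univ x), sum_const,
      card_univ, nsmul_eq_mul]
    have h2 : (Fintype.card Ω : ℝ) * (1 / (Fintype.card Ω : ℝ)) ^ 2 =
        1 / (Fintype.card Ω : ℝ) := by field_simp
    rw [h2]
    have : 0 ≤ 1 / (Fintype.card Ω : ℝ) := by positivity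
    linarith
  | succ t ih =>
    set ν : Ω → ℝ := fun y => (P ^ t) x y - uniformDist Ω y with hν
    have hstep : ∀ y, (P ^ (t + 1)) x y - uniformDist Ω y = ∑ z, P y z * ν z := by
      intro y
      simp only [hν, mul_sub, sum_sub_distrib, pow_succ, Matrix.mul_apply]
      congr 1
      · exact sum_congr rfl fun z _ => by rw [hsymm z y, mul_comm]
      · simp only [uniformDist]
        rw [← sum_mul, hrow, one_mul]
    have h1 := sum_sq_mulVec_le hnn hsymm hrow hα ν
    have h2 := hpoin ν (hmean t)
    have h3 : α / K * ∑ y, ν y ^ 2 ≤ α * ∑ x, ∑ y, P x y * (ν x - ν y) ^ 2 := by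
      rw [div_mul_eq_mul_div, div_le_iff₀ hK]
      calc _ ≤ _ := mul_le_mul_of_nonneg_left h2 hα0
        _ = _ := by ring
    have h4 : 1 - α / K ≤ Real.exp (-(α / K)) := by
      have := Real.add_one_le_exp (-(α / K))
      linarith
    have h5 : 0 ≤ ∑ y, ν y ^ 2 := sum_nonneg fun _ _ => sq_nonneg _
    calc ∑ y, ((P ^ (t + 1)) x y - uniformDist Ω y) ^ 2
        = ∑ y, (∑ z, P y z * ν z) ^ 2 := sum_congr rfl fun y _ => by rw [hstep]
      _ ≤ (1 - α / K) * ∑ y, ν y ^ 2 := by linarith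
      _ ≤ Real.exp (-(α / K)) * Real.exp (-(α / K) * t) :=
        mul_le_mul h4 ih h5 (Real.exp_pos _).le
      _ = Real.exp (-(α / K) * (t + 1 : ℕ)) := by
        rw [← Real.exp_add]
        congr 1
        push_cast
        ring

theorem tvDist_le_of_sum_sq_le {μ ν : Ω → ℝ} {s b : ℝ} (hb : 0 ≤ b)
    (h : ∑ x, (μ x - ν x) ^ 2 ≤ s) (hs : Fintype.card Ω * s ≤ b ^ 2) :
    tvDist μ ν ≤ b / 2 := by
  have h1 : (∑ x, |μ x - ν x|) ^ 2 ≤ b ^ 2 := by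
    have := sq_sum_le_card_mul_sum_sq (s := (univ : Finset Ω)) (f := fun x => |μ x - ν x|)
    simp only [sq_abs, card_univ] at this
    exact (this.trans (mul_le_mul_of_nonneg_left h (Nat.cast_nonneg _))).trans hs
  have h2 := abs_le_of_sq_le_sq h1 hb
  rw [tvDist]
  linarith [(le_abs_self _).trans h2]

theorem mixingTime_le_of_forall {P : Matrix Ω Ω ℝ} {π : Ω → ℝ} {ε : ℝ} {t : ℕ}
    (h : ∀ x, tvDist (fun y => (P ^ t) x y) π < ε) : mixingTime P π ε ≤ t :=
  iSup_le fun x => iInf₂_le t (h x)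

/-- A bound on the mixing time of a symmetric chain on at most `exp b` states. -/
theorem exists_mixingTime_eq {P : Matrix Ω Ω ℝ} {α K b ε : ℝ} (hnn : ∀ x y, 0 ≤ P x y)
    (hsymm : ∀ x y, P x y = P y x) (hrow : ∀ x, ∑ y, P x y = 1) (hα : ∀ x, α ≤ P x x)
    (hα0 : 0 < α) (hK : 0 < K)
    (hpoin : ∀ g : Ω → ℝ, ∑ x, g x = 0 →
      ∑ x, g x ^ 2 ≤ K * ∑ x, ∑ y, P x y * (g x - g y) ^ 2)
    (hb : (Fintype.card Ω : ℝ) ≤ Real.exp b) (hb0 : 0 ≤ b) (hε : 0 < ε) (hε1 : ε ≤ 1 / 2) :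
    ∃ T : ℕ, mixingTime P (uniformDist Ω) ε = (T : ℕ∞) ∧
      (T : ℝ) ≤ K / α * (b + 2 * Real.log (1 / ε)) + 1 := by
  have hL : 0 ≤ Real.log (1 / ε) := by
    apply Real.log_nonneg
    rw [le_div_iff₀ hε]
    linarith
  set t := ⌈K / α * (b + 2 * Real.log (1 / ε))⌉₊ with ht
  have hpos : 0 ≤ K / α * (b + 2 * Real.log (1 / ε)) := by positivity
  have hle : mixingTime P (uniformDist Ω) ε ≤ t := by
    refine mixingTime_le_of_forall fun x => ?_
    have h1 := sum_sq_pow_sub_le hnn hsymm hrow hα hα0.le hK hpoin x t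
    refine (tvDist_le_of_sum_sq_le hε.le h1 ?_).trans_lt (by linarith)
    have h2 : b + 2 * Real.log (1 / ε) ≤ α / K * t := by
      have := Nat.le_ceil (K / α * (b + 2 * Real.log (1 / ε)))
      rw [← ht, div_mul_eq_mul_div, div_le_iff₀ hα0] at this
      rw [div_mul_eq_mul_div, le_div_iff₀ hK]
      linarith
    have h3 : ε ^ 2 = Real.exp (b - (b + 2 * Real.log (1 / ε))) := by
      have : b - (b + 2 * Real.log (1 / ε)) = 2 * Real.log ε := by
        rw [one_div, Real.log_inv]
        ring
      rw [this, two_mul, Real.exp_add, Real.exp_log hε, sq]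
    rw [h3]
    calc (Fintype.card Ω : ℝ) * Real.exp (-(α / K) * t) ≤ Real.exp b * Real.exp (-(α / K) * t) :=
          mul_le_mul_of_nonneg_right hb (Real.exp_pos _).le
      _ = Real.exp (b + -(α / K) * t) := (Real.exp_add _ _).symm
      _ ≤ _ := Real.exp_le_exp.2 (by linarith)
  obtain ⟨T, hT, hTt⟩ := ENat.le_natCast_iff.1 hle
  refine ⟨T, hT, ?_⟩
  have h1 : (T : ℝ) ≤ t := by exact_mod_cast hTt
  exact h1.trans (Nat.ceil_lt_add_one hpos).le

end Mixing

section Walk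

variable {V : Type*} {G : SimpleGraph V} {k : ℕ}

theorem step_eq_iff {x y : Matchings G k} (hxy : x ≠ y) {e e' : Sym2 V} (he : e ∈ x.1) :
    step x e e' = y ↔ e' ∉ x.1 ∧ y.1 = insert e' (x.1.erase e) := by
  have key : ∀ z : Finset (Sym2 V), z.card = k → z = (x.1 ∪ {e'}) \ {e} → e' ∉ x.1 := by
    intro z hz hzeq he'
    have : (x.1 ∪ {e'}) \ {e} ⊆ x.1.erase e := by
      intro a ha
      simp only [mem_sdiff, mem_union, mem_singleton, mem_erase] at ha ⊢
      refine ⟨ha.2, ?_⟩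
      rcases ha.1 with h | h
      · exact h
      · exact h ▸ he'
    have h1 := card_le_card this
    rw [← hzeq, hz, card_erase_of_mem he, x.2.2] at h1
    have := card_pos.2 ⟨e, he⟩
    rw [x.2.2] at this
    omega
  have hins : e' ∉ x.1 → (x.1 ∪ {e'}) \ {e} = insert e' (x.1.erase e) := fun h =>
    union_singleton_sdiff fun h' => h (h' ▸ he)
  constructor
  · intro h
    unfold step at h
    split_ifs at h with hc
    · have h1 : y.1 = (x.1 ∪ {e'}) \ {e} := by rw [← h]
      have h2 := key y.1 y.2.2 h1
      exact ⟨h2, h1.trans (hins h2)⟩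
    · exact absurd h hxy
  · rintro ⟨h1, h2⟩
    rw [← hins h1] at h2
    unfold step
    rw [dif_pos (h2 ▸ y.2)]
    exact Subtype.ext h2.symm

variable [Fintype V]

theorem card_matchings (G : SimpleGraph V) (k : ℕ) :
    Fintype.card (Matchings G k) = (matchingsOfCard G k).card := by
  rw [Fintype.card_subtype, matchingsOfCard]

theorem sum_matchings (φ : Finset (Sym2 V) → ℝ) :
    ∑ x : Matchings G k, φ x.1 = ∑ M ∈ matchingsOfCard G k, φ M := by
  symm
  exact sum_subtype _ (fun M => mem_matchingsOfCard) φ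

theorem sum_downUpWalk_mul (x : Matchings G k) (φ : Matchings G k → ℝ) :
    ∑ y, downUpWalk G k x y * φ y =
      (∑ e ∈ x.1, ∑ e' ∈ G.edgeFinset, φ (step x e e')) / (k * G.edgeFinset.card) := by
  have hcard : ((x.1 ×ˢ G.edgeFinset).card : ℝ) = k * G.edgeFinset.card := by
    rw [card_product, x.2.2]
    push_cast
    rfl
  simp only [downUpWalk, Matrix.of_apply, hcard]
  rw [← sum_product', ← sum_fiberwise (x.1 ×ˢ G.edgeFinset) (fun p => step x p.1 p.2), sum_div]
  refine sum_congr rfl fun y _ => ?_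
  have : ∑ p ∈ x.1 ×ˢ G.edgeFinset with step x p.1 p.2 = y, φ (step x p.1 p.2) =
      ((x.1 ×ˢ G.edgeFinset).filter fun p => step x p.1 p.2 = y).card * φ y := by
    rw [sum_congr rfl (g := fun _ => φ y), sum_const, nsmul_eq_mul]
    intro p hp
    rw [(mem_filter.1 hp).2]
  rw [this]
  ring

theorem downUpWalk_nonneg (x y : Matchings G k) : 0 ≤ downUpWalk G k x y := by
  simp only [downUpWalk, Matrix.of_apply]
  positivity

theorem sum_downUpWalk (hk : 0 < k) (hm : 0 < G.edgeFinset.card) (x : Matchings G k) :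
    ∑ y, downUpWalk G k x y = 1 := by
  have h := sum_downUpWalk_mul x (fun _ => 1)
  simp only [mul_one] at h
  rw [h, sum_const, sum_const, x.2.2]
  have h1 : (k : ℝ) ≠ 0 := by exact_mod_cast hk.ne'
  have h2 : (G.edgeFinset.card : ℝ) ≠ 0 := by exact_mod_cast hm.ne'
  simp only [nsmul_eq_mul, mul_one]
  exact div_self (mul_ne_zero h1 h2)

theorem downUpWalk_symm (x y : Matchings G k) : downUpWalk G k x y = downUpWalk G k y x := by
  by_cases hxy : x = y
  · rw [hxy]
  have hle : ∀ x y : Matchings G k, x ≠ y →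
      ((x.1 ×ˢ G.edgeFinset).filter fun p => step x p.1 p.2 = y).card ≤
      ((y.1 ×ˢ G.edgeFinset).filter fun p => step y p.1 p.2 = x).card := by
    intro x y hxy
    refine card_le_card_of_injOn Prod.swap ?_ Prod.swap_injective.injOn
    rintro ⟨e, e'⟩ h
    simp only [coe_filter, mem_product, Set.mem_ofPred_eq] at h
    obtain ⟨⟨he, he'⟩, hst⟩ := h
    obtain ⟨h1, h2⟩ := (step_eq_iff hxy he).1 hst
    have hey : e' ∈ y.1 := by rw [h2]; exact mem_insert_self _ _
    simp only [Prod.swap_prod_mk, coe_filter, mem_product, Set.mem_ofPred_eq]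
    refine ⟨⟨hey, ?_⟩, (step_eq_iff hxy.symm hey).2 ⟨?_, ?_⟩⟩
    · simpa using x.2.1.1 e he
    · rw [h2, mem_insert, mem_erase, not_or]
      exact ⟨fun h => h1 (h ▸ he), fun h => h.1 rfl⟩
    · rw [h2, erase_insert (fun h => h1 (mem_of_mem_erase h)), insert_erase he]
  simp only [downUpWalk, Matrix.of_apply, card_product, x.2.2, y.2.2]
  rw [le_antisymm (hle x y hxy) (hle y x (Ne.symm hxy))]

/-- The walk stays put whenever the edge to be added is already present. -/
theorem le_downUpWalk_self (hk : 0 < k) (x : Matchings G k) :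
    (k : ℝ) / G.edgeFinset.card ≤ downUpWalk G k x x := by
  have hsub : x.1 ×ˢ x.1 ⊆ (x.1 ×ˢ G.edgeFinset).filter fun p => step x p.1 p.2 = x := by
    rintro ⟨e, e'⟩ h
    rw [mem_product] at h
    rw [mem_filter, mem_product]
    refine ⟨⟨h.1, by simpa using x.2.1.1 e' h.2⟩, ?_⟩
    by_contra hne
    exact ((step_eq_iff (Ne.symm hne) h.1).1 rfl).1 h.2
  have h1 := card_le_card hsub
  rw [card_product, x.2.2] at h1
  simp only [downUpWalk, Matrix.of_apply, card_product, x.2.2]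
  have h2 : (k : ℝ) / G.edgeFinset.card = (k * k : ℕ) / ((k * G.edgeFinset.card : ℕ) : ℝ) := by
    have : (k : ℝ) ≠ 0 := by exact_mod_cast hk.ne'
    push_cast
    rw [mul_div_mul_left _ _ this]
  rw [h2]
  gcongr

/-- The Dirichlet form of the walk is the normalized swap energy. -/
theorem sum_downUpWalk_mul_sq (f : Finset (Sym2 V) → ℝ) :
    ∑ x : Matchings G k, ∑ y, downUpWalk G k x y * (f x.1 - f y.1) ^ 2 =
      swapEnergy G k f / (k * G.edgeFinset.card) := by
  rw [swapEnergy, ← sum_matchings (k := k) (fun M => ∑ e' ∈ G.edgeFinset, ∑ e ∈ M,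
    if (M ∪ {e'}) \ {e} ∈ matchingsOfCard G k then (f M - f ((M ∪ {e'}) \ {e})) ^ 2 else 0),
    sum_div]
  refine sum_congr rfl fun x _ => ?_
  rw [sum_downUpWalk_mul x (fun y => (f x.1 - f y.1) ^ 2), sum_comm]
  congr 1
  refine sum_congr rfl fun e' _ => sum_congr rfl fun e _ => ?_
  unfold step
  by_cases h : IsMatching G ((x.1 ∪ {e'}) \ {e}) ∧ ((x.1 ∪ {e'}) \ {e}).card = k
  · rw [dif_pos h, if_pos (mem_matchingsOfCard.2 h)]
  · rw [dif_neg h, if_neg fun h' => h (mem_matchingsOfCard.1 h')]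
    simp

theorem exists_mixingTime_downUpWalk (hk : 1 ≤ k) (hlt : k < matchingNumber G) {R ε : ℝ}
    (hR : 1 ≤ R)
    (h : ((matchingsOfCard G k).card : ℝ) ≤ R * (matchingsOfCard G (k + 1)).card)
    (hε : 0 < ε) (hε1 : ε ≤ 1 / 2) :
    ∃ T : ℕ, mixingTime (downUpWalk G k) (uniformDist (Matchings G k)) ε = (T : ℕ∞) ∧
      (T : ℝ) ≤ 1202 * ((k : ℝ) ^ 3 * (G.edgeFinset.card : ℝ) ^ 4 * R ^ 2 *
        Real.log (1 / ε)) := by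
  have hmk : k ≤ G.edgeFinset.card := by
    obtain ⟨M, hM⟩ := card_pos.1 (card_matchingsOfCard_pos hlt.le)
    rw [mem_matchingsOfCard] at hM
    rw [← hM.2]
    exact card_le_card fun e he => by simpa using hM.1.1 e he
  have hm0 : 0 < G.edgeFinset.card := by omega
  have hm : (1 : ℝ) ≤ G.edgeFinset.card := by exact_mod_cast hm0
  have hk1 : (1 : ℝ) ≤ k := by exact_mod_cast hk
  set m : ℝ := (G.edgeFinset.card : ℝ) with hmdef
  have hL : 1 / 2 ≤ Real.log (1 / ε) := by
    have h1 : Real.log 2 ≤ Real.log (1 / ε) := by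
      apply Real.log_le_log two_pos
      rw [le_div_iff₀ hε]
      linarith
    linarith [Real.log_two_gt_d9]
  have hpoin : ∀ g : Matchings G k → ℝ, ∑ x, g x = 0 → ∑ x, g x ^ 2 ≤
      300 * k ^ 4 * m ^ 2 * R ^ 2 * ∑ x, ∑ y, downUpWalk G k x y * (g x - g y) ^ 2 := by
    intro g hg
    obtain ⟨f, rfl⟩ : ∃ f : Finset (Sym2 V) → ℝ, g = fun x => f x.1 :=
      ⟨fun M => if hM : IsMatching G M ∧ M.card = k then g ⟨M, hM⟩ else 0,
        funext fun x => by simp only [dif_pos x.2]⟩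
    dsimp only at hg ⊢
    rw [sum_matchings] at hg
    have h1 := sum_sq_le_swapEnergy hk hlt hR h f hg
    rw [sum_downUpWalk_mul_sq, sum_matchings (fun M => f M ^ 2)]
    refine h1.trans (le_of_eq ?_)
    rw [← hmdef]
    have : (k : ℝ) ≠ 0 := by positivity
    have : m ≠ 0 := by positivity
    field_simp
  have hb : (Fintype.card (Matchings G k) : ℝ) ≤ Real.exp m := by
    rw [card_matchings]
    have h1 : ((matchingsOfCard G k).card : ℝ) ≤ 2 ^ G.edgeFinset.card := by
      exact_mod_cast card_matchingsOfCard_le_two_pow k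
    refine h1.trans ?_
    have h2 : (2 : ℝ) ≤ Real.exp 1 := by linarith [Real.add_one_le_exp (1 : ℝ)]
    calc (2 : ℝ) ^ G.edgeFinset.card ≤ Real.exp 1 ^ G.edgeFinset.card := by gcongr
      _ = Real.exp m := by rw [← Real.exp_nat_mul, mul_one]
  obtain ⟨T, hT, hle⟩ := exists_mixingTime_eq (P := downUpWalk G k) (α := k / m)
    (K := 300 * k ^ 4 * m ^ 2 * R ^ 2) (b := m) downUpWalk_nonneg downUpWalk_symm
    (sum_downUpWalk hk hm0) (le_downUpWalk_self hk) (by positivity) (by positivity) hpoin hb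
    (by positivity) hε hε1
  refine ⟨T, hT, hle.trans ?_⟩
  set L := Real.log (1 / ε)
  have e1 : 300 * (k : ℝ) ^ 4 * m ^ 2 * R ^ 2 / (k / m) = 300 * (k ^ 3 * m ^ 3 * R ^ 2) := by
    field_simp
  rw [e1]
  have hA : 1 ≤ (k : ℝ) ^ 3 * m ^ 3 * R ^ 2 :=
    one_le_mul_of_one_le_of_one_le (one_le_mul_of_one_le_of_one_le (one_le_pow₀ hk1)
      (one_le_pow₀ hm)) (one_le_pow₀ hR)
  set A : ℝ := (k : ℝ) ^ 3 * m ^ 3 * R ^ 2 with hAdef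
  have e2 : (k : ℝ) ^ 3 * m ^ 4 * R ^ 2 * L = A * (m * L) := by rw [hAdef]; ring
  rw [e2]
  have hmL : L ≤ m * L := le_mul_of_one_le_left (by linarith) hm
  have h1 : m + 2 * L ≤ 4 * (m * L) := by nlinarith
  have h2 : A * (m + 2 * L) ≤ A * (4 * (m * L)) := mul_le_mul_of_nonneg_left h1 (by linarith)
  have h3 : 1 / 2 ≤ A * (m * L) := by nlinarith
  linarith

end Walk

/-! ### The two bounds -/

section Bounds

variable {V : Type*} [Fintype V] {G : SimpleGraph V} {k : ℕ} {δ ε : ℝ}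

theorem exists_mixingTime_le_rpow (hδ : 0 < δ) (hδ1 : δ < 1) (hk : 1 ≤ k)
    (hkδ : (k : ℝ) ≤ (1 - δ) * matchingNumber G) (hε : 0 < ε) (hε1 : ε ≤ 1 / 2) {m : ℕ}
    (hm : m = G.edgeFinset.card) :
    ∃ T : ℕ, mixingTime (downUpWalk G k) (uniformDist (Matchings G k)) ε = (T : ℕ∞) ∧
      (T : ℝ) ≤ 1202 * ((Fintype.card V : ℝ) ^ (4 / δ) * (m : ℝ) ^ 4 * (k : ℝ) *
        Real.log (1 / ε)) := by
  have hlt := lt_matchingNumber_of_le hδ hδ1 hk hkδ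
  have h2 := two_mul_matchingNumber_le G
  have hn : (1 : ℝ) ≤ Fintype.card V := by exact_mod_cast (by omega : 1 ≤ Fintype.card V)
  have hkn : (k : ℝ) ≤ Fintype.card V := by exact_mod_cast (by omega : k ≤ Fintype.card V)
  have hexp : 0 ≤ 2 / δ - 2 := by
    rw [sub_nonneg, le_div_iff₀ hδ]
    linarith
  obtain ⟨T, hT, hle⟩ := exists_mixingTime_downUpWalk hk hlt (Real.one_le_rpow hn hexp)
    (card_le_rpow_mul_card_succ hδ hδ1 hk hkδ) hε hε1
  refine ⟨T, hT, hle.trans (mul_le_mul_of_nonneg_left ?_ (by norm_num))⟩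
  have hL : 0 ≤ Real.log (1 / ε) := by
    apply Real.log_nonneg
    rw [le_div_iff₀ hε]
    linarith
  refine mul_le_mul_of_nonneg_right ?_ hL
  rw [hm]
  -- the exponent `2 / δ - 2` leaves room for two factors `k ≤ n`
  have hR : (k : ℝ) ^ 2 * ((Fintype.card V : ℝ) ^ (2 / δ - 2)) ^ 2 ≤
      (Fintype.card V : ℝ) ^ (4 / δ) := by
    calc (k : ℝ) ^ 2 * ((Fintype.card V : ℝ) ^ (2 / δ - 2)) ^ 2
        ≤ (Fintype.card V : ℝ) ^ 2 * ((Fintype.card V : ℝ) ^ (2 / δ - 2)) ^ 2 := by gcongr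
      _ = (Fintype.card V : ℝ) ^ (2 + (2 / δ - 2) * 2) := by
        rw [Real.rpow_add (by linarith), Real.rpow_mul (by linarith)]
        norm_cast
      _ ≤ (Fintype.card V : ℝ) ^ (4 / δ) := by
        refine Real.rpow_le_rpow_of_exponent_le hn ?_
        have : (4 : ℝ) / δ = 2 / δ * 2 := by ring
        rw [this]
        linarith
  calc (k : ℝ) ^ 3 * (G.edgeFinset.card : ℝ) ^ 4 * ((Fintype.card V : ℝ) ^ (2 / δ - 2)) ^ 2
      = ((k : ℝ) ^ 2 * ((Fintype.card V : ℝ) ^ (2 / δ - 2)) ^ 2) *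
        (G.edgeFinset.card : ℝ) ^ 4 * k := by ring
    _ ≤ _ := by gcongr

theorem exists_mixingTime_le_of_degree_le {Δ : ℕ} (hδ : 0 < δ) (hδ1 : δ < 1) (hk : 1 ≤ k)
    (hkδ : (k : ℝ) ≤ (1 - δ) * matchingNumber G) (hε : 0 < ε) (hε1 : ε ≤ 1 / 2)
    (hΔ : ∀ v, G.degree v ≤ Δ) :
    ∃ T : ℕ, mixingTime (downUpWalk G k) (uniformDist (Matchings G k)) ε = (T : ℕ∞) ∧
      (T : ℝ) ≤ 1202 * (Δ ^ 4 * ((2 : ℝ) ^ (2 * Δ / δ)) ^ 2) *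
        ((Fintype.card V : ℝ) ^ 6 * (k : ℝ) * Real.log (1 / ε)) := by
  have hlt := lt_matchingNumber_of_le hδ hδ1 hk hkδ
  have h2 := two_mul_matchingNumber_le G
  have hkn : (k : ℝ) ≤ Fintype.card V := by exact_mod_cast (by omega : k ≤ Fintype.card V)
  have hm : (G.edgeFinset.card : ℝ) ≤ Δ * Fintype.card V := by
    exact_mod_cast card_edgeFinset_le_mul_card hΔ
  obtain ⟨T, hT, hle⟩ := exists_mixingTime_downUpWalk hk hlt
    (Real.one_le_rpow one_le_two (by positivity))
    (card_le_two_rpow_mul_card_succ hδ hδ1 hk hkδ hΔ) hε hε1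
  refine ⟨T, hT, hle.trans ?_⟩
  have hL : 0 ≤ Real.log (1 / ε) := by
    apply Real.log_nonneg
    rw [le_div_iff₀ hε]
    linarith
  set R : ℝ := (2 : ℝ) ^ (2 * Δ / δ)
  calc 1202 * ((k : ℝ) ^ 3 * (G.edgeFinset.card : ℝ) ^ 4 * R ^ 2 * Real.log (1 / ε))
      = 1202 * (((k : ℝ) ^ 2 * (G.edgeFinset.card : ℝ) ^ 4) * R ^ 2 * k * Real.log (1 / ε)) := by
        ring
    _ ≤ 1202 * (((Fintype.card V : ℝ) ^ 2 * (Δ * Fintype.card V) ^ 4) * R ^ 2 * k *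
        Real.log (1 / ε)) := by gcongr
    _ = _ := by ring

end Bounds

end MatchingWalk

theorem theorem1 :
    (∃ C : ℝ, ∀ (δ : ℝ), 0 < δ → δ < 1 →
      ∀ (V : Type*) [Fintype V] (G : SimpleGraph V) [DecidableRel G.Adj] (k : ℕ),
        1 ≤ k → (k : ℝ) ≤ (1 - δ) * (MatchingWalk.matchingNumber G : ℝ) →
      ∀ (ε : ℝ), 0 < ε → ε ≤ 1 / 2 →
        ∃ T : ℕ,
          MatchingWalk.mixingTime (MatchingWalk.downUpWalk G k)
            (MatchingWalk.uniformDist (MatchingWalk.Matchings G k)) ε = (T : ℕ∞) ∧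
          (T : ℝ) ≤ C * ((Fintype.card V : ℝ) ^ (4 / δ) * (G.edgeFinset.card : ℝ) ^ 4 * (k : ℝ)
            * Real.log (1 / ε))) ∧
    (∀ (Δ : ℕ) (δ : ℝ), 0 < δ → δ < 1 → ∃ C : ℝ,
      ∀ (V : Type*) [Fintype V] (G : SimpleGraph V) [DecidableRel G.Adj] (k : ℕ),
        G.maxDegree ≤ Δ →
        1 ≤ k → (k : ℝ) ≤ (1 - δ) * (MatchingWalk.matchingNumber G : ℝ) →
      ∀ (ε : ℝ), 0 < ε → ε ≤ 1 / 2 →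
        ∃ T : ℕ,
          MatchingWalk.mixingTime (MatchingWalk.downUpWalk G k)
            (MatchingWalk.uniformDist (MatchingWalk.Matchings G k)) ε = (T : ℕ∞) ∧
          (T : ℝ) ≤ C * ((Fintype.card V : ℝ) ^ 6 * (k : ℝ) * Real.log (1 / ε))) := by
  refine ⟨⟨1202, ?_⟩, fun Δ δ hδ hδ1 => ⟨1202 * (Δ ^ 4 * ((2 : ℝ) ^ (2 * Δ / δ)) ^ 2), ?_⟩⟩
  · intro δ hδ hδ1 V _ G _ k hk hkδ ε hε hε1
    exact MatchingWalk.exists_mixingTime_le_rpow hδ hδ1 hk hkδ hε hε1 (by convert rfl)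
  · intro V _ G _ k hΔ hk hkδ ε hε hε1
    refine MatchingWalk.exists_mixingTime_le_of_degree_le hδ hδ1 hk hkδ hε hε1 fun v => ?_
    refine le_trans (le_of_eq ?_) ((G.degree_le_maxDegree v).trans hΔ)
    convert rfl
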